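/- Let $Q$ be a smooth manifold and consider the nonholonomic system given by a lagrangian $\mathcal L=\kappa+U$ ($\kappa$ the kinetic energy of a Riemannian metric on $Q$, also denoted $\kappa$, and $U\in C^\infty(Q)$) and a constraint distribution $D\subseteq TQ$ (a vector subbundle). Let $\mathcal M=\kappa^\flat(D)\subseteq T^*Q$ be the constraint submanifold, where $\kappa^\flat(v)=\kappa(v,\cdot)$, with projection $\tau:\mathcal M\to Q$; let $\Theta_{\mathcal M}$, $\Omega_{\mathcal M}$ be the pullbacks to $\mathcal M$ of the Liouville form $\Theta_Q$ and of $\Omega_Q=-d\Theta_Q$, and let $\mathcal C=\{v\in T\mathcal M : T\tau(v)\in D\}$. The nonholonomic bivector field $\pi_{nh}$ on $\mathcal M$ is determined by $\pi_{nh}^\sharp(\alpha)=-X \iff X\in\mathcal C$ and ${\bf i}_X\Omega_{\mathcal M}|_{\mathcal C}=\alpha|_{\mathcal C}$, where $\beta(\pi^\sharp(\alpha))=\pi(\alpha,\beta)$. Let a Lie group $G$ act freely and properly on $Q$, such that the tangent lift preserves $\mathcal L$ and $D$; let $G$ act on $\mathcal M$ by the restriction of the cotangent lift, with infinitesimal generators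 $\xi_{\mathcal M}$, orbit projection $\rho:\mathcal M\to\mathcal M/G$, and vertical spaces $\mathcal V_m=\{\xi_{\mathcal M}(m):\xi\in\mathfrak g\}$. Assume $T\mathcal M=\mathcal C+\mathcal V$. Let $\mathcal W\subseteq\mathcal V$ be a $G$-invariant regular distribution with $T\mathcal M=\mathcal C\oplus\mathcal W$, with projections $P_{\mathcal C}$, $P_{\mathcal W}$. Define the $\mathfrak g$-valued 1-form $\mathcal A_{\mathcal W}$ by $P_{\mathcal W}(v)=(\mathcal A_{\mathcal W}(v))_{\mathcal M}(m)$ for $v\in T_m\mathcal M$, the $\mathcal W$-curvature $\mathcal K_{\mathcal W}(X,Y)=d\mathcal A_{\mathcal W}(P_{\mathcal C}X,P_{\mathcal C}Y)$, the momentum map $\mathcal J:\mathcal M\to\mathfrak g^*$, $\langle\mathcal J,\eta\rangle={\bf i}_{\eta_{\mathcal M}}\Theta_{\mathcal M}$, and the 3-form $(d\mathcal J\wedge\mathcal K_{\mathcal W})(X,Y,Z)=\langle d\mathcal J(Z),\mathcal K_{\mathcal W}(X,Y)\rangle+\langle d\mathcal J(X),\mathcal K_{\mathcal W}(Y,Z)\rangle+\langle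 d\mathcal J(Y),\mathcal K_{\mathcal W}(Z,X)\rangle$. Let $B$ be a $G$-invariant 2-form on $\mathcal M$ with ${\bf i}_ZB=0$ for all $Z\in\mathcal W$ and such that $\mathrm{Id}+B^\flat\circ\pi_{nh}^\sharp$ is invertible, where $B^\flat(X)={\bf i}_XB$; let $\pi_B^\sharp=\pi_{nh}^\sharp\circ(\mathrm{Id}+B^\flat\circ\pi_{nh}^\sharp)^{-1}$ be the gauge transformation of $\pi_{nh}$ by $B$, and let $\pi_{red}^B$ be the reduced bivector field on $\mathcal M/G$, determined by $(\pi_{red}^B)^\sharp(\alpha)=T\rho(\pi_B^\sharp(\rho^*\alpha))$. Suppose that $d\mathcal J\wedge\mathcal K_{\mathcal W}$ is closed, and that $dB+d\mathcal J\wedge\mathcal K_{\mathcal W}$ is basic for $\rho$, i.e. $G$-invariant and annihilated by ${\bf i}_X$ whenever $T\rho(X)=0$. Then $\pi_{red}^B$ is $\phi$-twisted Poisson, where $\phi$ is the unique 3-form on $\mathcal M/G$ with $\rho^*\phi=-(dB+d\mathcal J\wedge\mathcal K_{\mathcal W})$; that is, $\phi$ is smooth and closed and $$\tfrac12[\pi_{red}^B,\pi_{red}^B]=(\pi_{red}^B)^\sharp(\phi),$$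 where $\tfrac12[\pi,\pi](df,dg,dh)=\{f,\{g,h\}\}+\{g,\{h,f\}\}+\{h,\{f,g\}\}$ with $\{f,g\}=\pi(df,dg)$, and $\pi^\sharp(\phi)(\alpha,\beta,\gamma)=-\phi(\pi^\sharp\alpha,\pi^\sharp\beta,\pi^\sharp\gamma)$. In particular, the characteristic distribution $(\pi_{red}^B)^\sharp(T^*(\mathcal M/G))$ is integrable: through every point of $\mathcal M/G$ there passes an integral manifold of it. -/

import Mathlib

open scoped Manifold ContDiff Topology

noncomputable section

namespace Nonholonomic

/-! ### Linear algebra -/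

section LinearAlgebra

variable {T : Type*} [AddCommGroup T] [Module ℝ T] [TopologicalSpace T]

open Classical in
/-- The inverse of a linear map (zero if the map is not bijective). -/
def linearInverse {V V' : Type*} [AddCommGroup V] [Module ℝ V] [AddCommGroup V'] [Module ℝ V']
    (f : V →ₗ[ℝ] V') : V' →ₗ[ℝ] V :=
  if h : Function.Bijective f then ((LinearEquiv.ofBijective f h).symm : V' →ₗ[ℝ] V) else 0

open Classical in
/-- A left inverse of a linear map (zero if the map is not injective). -/
def linearLeftInverse {V V' : Type*} [AddCommGroup V] [Module ℝ V] [AddCommGroup V'] [Module ℝ V']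
    (f : V →ₗ[ℝ] V') : V' →ₗ[ℝ] V :=
  if h : LinearMap.ker f = ⊥ then (f.exists_leftInverse_of_injective h).choose else 0

/-- The map `θ♭ : X ↦ i_X θ = θ(X, ·)` of a 2-form `θ`. -/
def flat (θ : T [⋀^Fin 2]→L[ℝ] ℝ) : T →ₗ[ℝ] (T →L[ℝ] ℝ) where
  toFun X :=
    { toFun := fun Y => θ ![X, Y]
      map_add' := fun Y Y' => by
        have h : ∀ Z, Function.update ![X, 0] 1 Z = ![X, Z] := fun Z => by
          ext i; fin_cases i <;> rfl
        have := θ.map_update_add ![X, 0] 1 Y Y'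
        rwa [h, h, h] at this
      map_smul' := fun c Y => by
        have h : ∀ Z, Function.update ![X, 0] 1 Z = ![X, Z] := fun Z => by
          ext i; fin_cases i <;> rfl
        have := θ.map_update_smul ![X, 0] 1 c Y
        rwa [h, h] at this
      cont := by
        refine θ.cont.comp (continuous_pi fun i => ?_)
        fin_cases i
        · exact continuous_const
        · exact continuous_id }
  map_add' X X' := by
    ext Y
    exact θ.toAlternatingMap.map_vecCons_add ![Y] X X'
  map_smul' c X := by
    ext Y
    exact θ.toAlternatingMap.map_vecCons_smul ![Y] c X

/-- The map `F → F*`, `X ↦ (i_X θ)|_F`. -/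
def flatOn (F : Submodule ℝ T) (θ : T [⋀^Fin 2]→L[ℝ] ℝ) : F →ₗ[ℝ] Module.Dual ℝ F where
  toFun X := (flat θ X).toLinearMap ∘ₗ F.subtype
  map_add' X X' := by ext Y; simp
  map_smul' c X := by ext Y; simp

/-- The map `π♯ : T* → T` determined by a subspace `F` and a 2-form `θ` nondegenerate on `F`:
`π♯(α) = -X`, where `X ∈ F` is the vector with `(i_X θ)|_F = α|_F`. -/
def sharpOfPair (F : Submodule ℝ T) (θ : T [⋀^Fin 2]→L[ℝ] ℝ) : (T →L[ℝ] ℝ) →ₗ[ℝ] T where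
  toFun α := -((linearInverse (flatOn F θ) (α.toLinearMap ∘ₗ F.subtype) : F) : T)
  map_add' α β := by
    rw [ContinuousLinearMap.toLinearMap_add, LinearMap.add_comp, map_add]
    simp [add_comm]
  map_smul' c α := by
    rw [ContinuousLinearMap.toLinearMap_smul, LinearMap.smul_comp, map_smul]
    simp

/-- The endomorphism `Id + B♭ ∘ π♯` of `T*`. -/
def gaugeEnd (π : (T →L[ℝ] ℝ) →ₗ[ℝ] T) (B : T [⋀^Fin 2]→L[ℝ] ℝ) :
    (T →L[ℝ] ℝ) →ₗ[ℝ] (T →L[ℝ] ℝ) :=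
  LinearMap.id + flat B ∘ₗ π

/-- The gauge transformation `π♯ ∘ (Id + B♭ ∘ π♯)⁻¹`, meaningful if `Id + B♭ ∘ π♯` is bijective. -/
def gaugeTransform (π : (T →L[ℝ] ℝ) →ₗ[ℝ] T) (B : T [⋀^Fin 2]→L[ℝ] ℝ) :
    (T →L[ℝ] ℝ) →ₗ[ℝ] T :=
  π ∘ₗ linearInverse (gaugeEnd π B)

/-- For linear `l : T → V*` and a `V`-valued 2-form `k`, the 3-form
`(X, Y, Z) ↦ ⟨l Z, k(X, Y)⟩ + ⟨l X, k(Y, Z)⟩ + ⟨l Y, k(Z, X)⟩`; see `cyclicWedge_apply`. -/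
def cyclicWedge {V : Type*} [NormedAddCommGroup V] [NormedSpace ℝ V]
    (l : T →L[ℝ] (V →L[ℝ] ℝ)) (k : T [⋀^Fin 2]→L[ℝ] V) : T [⋀^Fin 3]→L[ℝ] ℝ :=
  { AlternatingMap.alternatizeUncurryFin
      { toFun := fun Z => (l Z).toLinearMap.compAlternatingMap k.toAlternatingMap
        map_add' := fun Z Z' => by ext; simp
        map_smul' := fun c Z => by ext; simp } with
    cont := by
      change Continuous fun v : Fin 3 → T => AlternatingMap.alternatizeUncurryFin _ v
      simp only [AlternatingMap.alternatizeUncurryFin_apply]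
      refine continuous_finsetSum _ fun i _ => ?_
      have hc : Continuous fun v : Fin 3 → T => l (v i) (k (i.removeNth v)) :=
        isBoundedBilinearMap_apply.continuous.comp
          ((l.continuous.comp (continuous_apply i)).prodMk
            (k.cont.comp (continuous_pi fun j => continuous_apply (i.succAbove j))))
      exact hc.const_smul ((-1 : ℤ) ^ (i : ℕ)) }

theorem cyclicWedge_apply {V : Type*} [NormedAddCommGroup V] [NormedSpace ℝ V]
    (l : T →L[ℝ] (V →L[ℝ] ℝ)) (k : T [⋀^Fin 2]→L[ℝ] V) (X Y Z : T) :
    cyclicWedge l k ![X, Y, Z] = l Z (k ![X, Y]) + l X (k ![Y, Z]) + l Y (k ![Z, X]) := by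
  have h0 : Fin.removeNth (0 : Fin 3) ![X, Y, Z] = ![Y, Z] := by
    ext i; fin_cases i <;> rfl
  have h1 : Fin.removeNth (1 : Fin 3) ![X, Y, Z] = ![X, Z] := by
    ext i; fin_cases i <;> rfl
  have h2 : Fin.removeNth (2 : Fin 3) ![X, Y, Z] = ![X, Y] := by
    ext i; fin_cases i <;> rfl
  have hs : k ![X, Z] = - k ![Z, X] := by
    have := k.toAlternatingMap.map_swap ![Z, X] (i := 0) (j := 1) (by simp)
    have h : (![Z, X] ∘ Equiv.swap 0 1 : Fin 2 → T) = ![X, Z] := by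
      ext i; fin_cases i <;> simp
    rwa [h] at this
  change AlternatingMap.alternatizeUncurryFin _ ![X, Y, Z] = _
  rw [AlternatingMap.alternatizeUncurryFin_apply, Fin.sum_univ_three, h0, h1, h2]
  simp [hs]
  ring

end LinearAlgebra

/-! ### Forms, distributions and bivector fields on manifolds without boundary -/

section Manifolds

variable {E : Type*} [NormedAddCommGroup E] [NormedSpace ℝ E]
  {H : Type*} [TopologicalSpace H] (I : ModelWithCorners ℝ E H)
  {E' : Type*} [NormedAddCommGroup E'] [NormedSpace ℝ E']
  {H' : Type*} [TopologicalSpace H'] (I' : ModelWithCorners ℝ E' H')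
  {P : Type*} [TopologicalSpace P] [ChartedSpace H P]
  {P' : Type*} [TopologicalSpace P'] [ChartedSpace H' P']
  {V : Type*} [NormedAddCommGroup V] [NormedSpace ℝ V]

variable (P V) in
/-- `V`-valued `k`-forms on `P` (not necessarily smooth). -/
abbrev Form (k : ℕ) : Type _ := Π x : P, TangentSpace I x [⋀^Fin k]→L[ℝ] V

variable {I} in
/-- The local representative of a form in the chart at `x₀`: its pullback to the model space by
the inverse of the chart. -/
def Form.inChart {k : ℕ} (w : Form I P V k) (x₀ : P) (y : E) : E [⋀^Fin k]→L[ℝ] V :=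
  (w ((extChartAt I x₀).symm y)).compContinuousLinearMap
    (mfderiv 𝓘(ℝ, E) I (extChartAt I x₀).symm y)

variable {I} in
/-- A form is smooth if its local representatives are. -/
def Form.Smooth {k : ℕ} (w : Form I P V k) : Prop :=
  ∀ x₀ : P, ContDiffOn ℝ ∞ (w.inChart x₀) (extChartAt I x₀).target

variable {I} in
/-- The exterior derivative, computed in the chart at each point. -/
def Form.d {k : ℕ} (w : Form I P V k) : Form I P V (k + 1) := fun x =>
  (extDeriv (w.inChart x) (extChartAt I x x)).compContinuousLinearMap
    (mfderiv I 𝓘(ℝ, E) (extChartAt I x) x)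

variable {I} in
/-- A form is closed if its exterior derivative vanishes. -/
def Form.Closed {k : ℕ} (w : Form I P V k) : Prop := ∀ x, w.d x = 0

variable {I'} in
/-- The pullback of a form by a map. -/
def Form.pullback {k : ℕ} (f : P → P') (w : Form I' P' V k) : Form I P V k := fun x =>
  (w (f x)).compContinuousLinearMap (mfderiv I I' f x)

/-- A regular distribution (vector subbundle of the tangent bundle): locally spanned by a smooth
linearly independent frame. -/
def IsRegularDistribution [IsManifold I ∞ P] (Δ : Π x : P, Submodule ℝ (TangentSpace I x)) : Prop :=
  ∀ x₀ : P, ∃ (r : ℕ) (X : Fin r → Π x : P, TangentSpace I x), ∃ U ∈ 𝓝 x₀,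
    (∀ i, ContMDiffOn I I.tangent ∞ (fun x => (⟨x, X i x⟩ : TangentBundle I P)) U) ∧
    ∀ x ∈ U, LinearIndependent ℝ (fun i => X i x) ∧
      Submodule.span ℝ (Set.range fun i => X i x) = Δ x

/-- A (possibly singular) distribution is integrable if through every point there passes an
integral manifold: an injectively immersed ball, tangent at each of its points exactly to the
distribution. -/
def IsIntegrable (Δ : Π x : P, Submodule ℝ (TangentSpace I x)) : Prop :=
  ∀ x₀ : P, ∃ (k : ℕ) (ε : ℝ) (j : EuclideanSpace ℝ (Fin k) → P), 0 < ε ∧ j 0 = x₀ ∧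
    ContMDiffOn 𝓘(ℝ, EuclideanSpace ℝ (Fin k)) I ∞ j (Metric.ball 0 ε) ∧
    Set.InjOn j (Metric.ball 0 ε) ∧
    ∀ t ∈ Metric.ball (0 : EuclideanSpace ℝ (Fin k)) ε,
      Function.Injective (mfderiv 𝓘(ℝ, EuclideanSpace ℝ (Fin k)) I j t) ∧
      LinearMap.range (mfderiv 𝓘(ℝ, EuclideanSpace ℝ (Fin k)) I j t).toLinearMap = Δ (j t)

variable (P) in
/-- Fields of linear maps `π♯ : T*P → TP`; a bivector field `π` is encoded by its map `π♯`,
where `β(π♯(α)) = π(α, β)`. -/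
abbrev SharpField : Type _ := Π x : P, (TangentSpace I x →L[ℝ] ℝ) →ₗ[ℝ] TangentSpace I x

/-- The differential of a function. -/
def diff (f : P → ℝ) (x : P) : TangentSpace I x →L[ℝ] ℝ := mfderiv I 𝓘(ℝ, ℝ) f x

variable {I I'}

/-- The bracket `{f, g} = π(df, dg) = dg(π♯(df))`. -/
def SharpField.bracket (π : SharpField I P) (f g : P → ℝ) : P → ℝ := fun x =>
  diff I g x (π x (diff I f x))

/-- `½[π, π](df, dg, dh) = {f, {g, h}} + {g, {h, f}} + {h, {f, g}}`. -/
def SharpField.jacobiator (π : SharpField I P) (f g h : P → ℝ) : P → ℝ := fun x =>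
  π.bracket f (π.bracket g h) x + π.bracket g (π.bracket h f) x + π.bracket h (π.bracket f g) x

/-- `π♯` comes from a smooth bivector field, i.e. from an almost Poisson bracket on `C^∞(P)`. -/
def SharpField.IsBivectorField (π : SharpField I P) : Prop :=
  (∀ (x : P) (α β : TangentSpace I x →L[ℝ] ℝ), β (π x α) = -α (π x β)) ∧
  ∀ f g : P → ℝ, ContMDiff I 𝓘(ℝ, ℝ) ∞ f → ContMDiff I 𝓘(ℝ, ℝ) ∞ g →
    ContMDiff I 𝓘(ℝ, ℝ) ∞ (π.bracket f g)

/-- `π` is `φ`-twisted Poisson: `φ` is a closed smooth 3-form and `½[π, π] = π♯(φ)`, where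
`π♯(φ)(α, β, γ) = -φ(π♯(α), π♯(β), π♯(γ))`. -/
def SharpField.IsTwistedPoisson (π : SharpField I P) (φ : Form I P ℝ 3) : Prop :=
  π.IsBivectorField ∧ φ.Smooth ∧ φ.Closed ∧
  ∀ f g h : P → ℝ, ContMDiff I 𝓘(ℝ, ℝ) ∞ f → ContMDiff I 𝓘(ℝ, ℝ) ∞ g →
    ContMDiff I 𝓘(ℝ, ℝ) ∞ h → ∀ x,
      π.jacobiator f g h x = -φ x ![π x (diff I f x), π x (diff I g x), π x (diff I h x)]

/-- The characteristic distribution of a bivector field, the image of `π♯`. -/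
def SharpField.charDistribution (π : SharpField I P) (x : P) : Submodule ℝ (TangentSpace I x) :=
  LinearMap.range (π x)

/-- `π'` is the image of `π` under `f`: `Tf ∘ π♯ ∘ f^* = π'♯`. -/
def IsReducedBivector (f : P → P') (π : SharpField I P) (π' : SharpField I' P') : Prop :=
  ∀ (x : P) (α : TangentSpace I' (f x) →L[ℝ] ℝ),
    π' (f x) α = mfderiv I I' f x (π x (α ∘L mfderiv I I' f x))

/-- Invariance of a form under a group action: `φ_g^* w = w` for all `g`. -/
def Form.Invariant (G : Type*) [SMul G P] {k : ℕ} (w : Form I P V k) : Prop :=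
  ∀ g : G, w.pullback I (fun x => g • x) = w

variable (I') in
/-- `w` is basic with respect to `ρ : P → P'` (an orbit projection for `G`): it is `G`-invariant,
and `i_X w = 0` whenever `Tρ(X) = 0`. -/
def Form.Basic (G : Type*) [SMul G P] (ρ : P → P') {k : ℕ} (w : Form I P V (k + 1)) : Prop :=
  w.Invariant G ∧
  ∀ (x : P) (v : Fin (k + 1) → TangentSpace I x), mfderiv I I' ρ x (v 0) = 0 → w x v = 0

end Manifolds

/-! ### Nonholonomic systems -/

section Systems

variable {E : Type*} [NormedAddCommGroup E] [NormedSpace ℝ E]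

/-- The cotangent bundle, with Mathlib's structure of a smooth vector bundle. -/
abbrev CotangentBundle (E : Type*) [NormedAddCommGroup E] [NormedSpace ℝ E]
    (Q : Type*) [TopologicalSpace Q] [ChartedSpace E Q] : Type _ :=
  Bundle.TotalSpace (E →L[ℝ] ℝ) (fun q : Q => TangentSpace 𝓘(ℝ, E) q →L[ℝ] ℝ)

section Canonical

variable (Q : Type*) [TopologicalSpace Q] [ChartedSpace E Q] [IsManifold 𝓘(ℝ, E) ∞ Q]

/-- The Liouville 1-form `Θ_Q`: `Θ_Q(p)(v) = p(Tτ_Q v)`. -/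
def liouvilleForm :
    Form (𝓘(ℝ, E).prod 𝓘(ℝ, E →L[ℝ] ℝ)) (CotangentBundle E Q) ℝ 1 := fun p =>
  ContinuousAlternatingMap.ofSubsingleton ℝ _ ℝ (0 : Fin 1)
    (p.2 ∘L mfderiv (𝓘(ℝ, E).prod 𝓘(ℝ, E →L[ℝ] ℝ)) 𝓘(ℝ, E)
      (fun p : CotangentBundle E Q => p.proj) p)

/-- The canonical 2-form `Ω_Q = -dΘ_Q`, locally `dq^i ∧ dp_i`. -/
def canonicalForm :
    Form (𝓘(ℝ, E).prod 𝓘(ℝ, E →L[ℝ] ℝ)) (CotangentBundle E Q) ℝ 2 :=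
  fun p => -(liouvilleForm Q).d p

end Canonical

/-- A nonholonomic system on `Q`: a kinetic energy metric, a potential, and a constraint
distribution. -/
structure NonholonomicSystem (E : Type*) [NormedAddCommGroup E] [NormedSpace ℝ E]
    (Q : Type*) [TopologicalSpace Q] [ChartedSpace E Q] [IsManifold 𝓘(ℝ, E) ∞ Q] where
  /-- the kinetic energy metric `κ` -/
  metric : Bundle.ContMDiffRiemannianMetric 𝓘(ℝ, E) ∞ E (fun q : Q => TangentSpace 𝓘(ℝ, E) q)
  /-- the potential energy `U` -/
  potential : Q → ℝ
  contMDiff_potential : ContMDiff 𝓘(ℝ, E) 𝓘(ℝ, ℝ) ∞ potential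
  /-- the constraint distribution `D` -/
  D : Π q : Q, Submodule ℝ (TangentSpace 𝓘(ℝ, E) q)
  regular_D : IsRegularDistribution 𝓘(ℝ, E) D

namespace NonholonomicSystem

variable {Q : Type*} [TopologicalSpace Q] [ChartedSpace E Q] [IsManifold 𝓘(ℝ, E) ∞ Q]
  (N : NonholonomicSystem E Q)

/-- The lagrangian (kinetic energy of `κ` plus `U`), whose Legendre transform is `v ↦ κ(v, ·)`. -/
def lagrangian (v : TangentBundle 𝓘(ℝ, E) Q) : ℝ :=
  (1 / 2) * N.metric.inner v.proj v.2 v.2 + N.potential v.proj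

/-- The Legendre transform `TQ → T*Q`. -/
def legendre (v : TangentBundle 𝓘(ℝ, E) Q) : CotangentBundle E Q :=
  ⟨v.proj, N.metric.inner v.proj v.2⟩

/-- The constraint submanifold `M = Leg(D) ⊆ T*Q`. -/
def constraintManifold : Set (CotangentBundle E Q) :=
  N.legendre '' {v | v.2 ∈ N.D v.proj}

/-- The group `G` acts on `Q` by smooth symmetries of the system: the tangent lift preserves the
lagrangian and the constraints. -/
class IsSymmetry (G : Type*) [Group G] [MulAction G Q] : Prop where
  contMDiff_smul (g : G) : ContMDiff 𝓘(ℝ, E) 𝓘(ℝ, E) ∞ (fun q : Q => g • q)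
  lagrangian_invariant (g : G) (v : TangentBundle 𝓘(ℝ, E) Q) :
    N.lagrangian (tangentMap 𝓘(ℝ, E) 𝓘(ℝ, E) (fun q : Q => g • q) v) = N.lagrangian v
  constraint_invariant (g : G) (q : Q) (v : TangentSpace 𝓘(ℝ, E) q) (hv : v ∈ N.D q) :
    mfderiv 𝓘(ℝ, E) 𝓘(ℝ, E) (fun q : Q => g • q) q v ∈ N.D (g • q)


section Action

variable (G : Type*) [Group G] [MulAction G Q]

/-- The cotangent lift of the action: `g · (q, p) = (g · q, p ∘ (T_q g)⁻¹)`. -/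
def cotangentLift (g : G) (p : CotangentBundle E Q) : CotangentBundle E Q :=
  ⟨g • p.proj, p.2 ∘L (mfderiv 𝓘(ℝ, E) 𝓘(ℝ, E) (fun q : Q => g • q) p.proj).inverse⟩

variable {N G} in
theorem IsSymmetry.mdifferentiableAt_smul (hG : N.IsSymmetry G) (g : G) (q : Q) :
    MDifferentiableAt 𝓘(ℝ, E) 𝓘(ℝ, E) (fun q : Q => g • q) q :=
  (hG.contMDiff_smul g).mdifferentiable (by simp) q

variable {N G} in
theorem IsSymmetry.isInvertible_mfderiv_smul (hG : N.IsSymmetry G) (g : G) (q : Q) :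
    (mfderiv 𝓘(ℝ, E) 𝓘(ℝ, E) (fun q : Q => g • q) q).IsInvertible := by
  let d : Diffeomorph 𝓘(ℝ, E) 𝓘(ℝ, E) Q Q ∞ :=
    { toFun := fun q => g • q
      invFun := fun q => g⁻¹ • q
      left_inv := fun q => by simp
      right_inv := fun q => by simp
      contMDiff_toFun := hG.contMDiff_smul g
      contMDiff_invFun := hG.contMDiff_smul g⁻¹ }
  exact ⟨d.mfderivToContinuousLinearEquiv (by simp) q, by
    exact d.mfderivToContinuousLinearEquiv_coe (by simp)⟩

variable {N G} in
theorem IsSymmetry.metric_invariant (hG : N.IsSymmetry G) (g : G) (q : Q)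
    (v w : TangentSpace 𝓘(ℝ, E) q) :
    N.metric.inner (g • q) (mfderiv 𝓘(ℝ, E) 𝓘(ℝ, E) (fun q : Q => g • q) q v)
      (mfderiv 𝓘(ℝ, E) 𝓘(ℝ, E) (fun q : Q => g • q) q w) = N.metric.inner q v w := by
  have key : ∀ u : TangentSpace 𝓘(ℝ, E) q, (1 / 2) * N.metric.inner (g • q)
      (mfderiv 𝓘(ℝ, E) 𝓘(ℝ, E) (fun q : Q => g • q) q u)
      (mfderiv 𝓘(ℝ, E) 𝓘(ℝ, E) (fun q : Q => g • q) q u) + N.potential (g • q) =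
      (1 / 2) * N.metric.inner q u u + N.potential q :=
    fun u => hG.lagrangian_invariant g ⟨q, u⟩
  have h0 := key 0
  have h1 := key v
  have h2 := key w
  have h3 := key (v + w)
  simp only [map_add, map_zero, add_apply] at h0 h1 h2 h3
  have s1 := N.metric.symm (g • q) (mfderiv 𝓘(ℝ, E) 𝓘(ℝ, E) (fun q : Q => g • q) q v)
      (mfderiv 𝓘(ℝ, E) 𝓘(ℝ, E) (fun q : Q => g • q) q w)
  have s2 := N.metric.symm q v w
  linarith

variable {N G} in
/-- The constraint submanifold is invariant under the cotangent lift. -/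
theorem IsSymmetry.cotangentLift_mem (hG : N.IsSymmetry G) (g : G) {p : CotangentBundle E Q}
    (hp : p ∈ N.constraintManifold) : cotangentLift G g p ∈ N.constraintManifold := by
  obtain ⟨v, hv, rfl⟩ := hp
  refine ⟨tangentMap 𝓘(ℝ, E) 𝓘(ℝ, E) (fun q : Q => g • q) v,
    hG.constraint_invariant g v.proj v.2 hv, ?_⟩
  obtain ⟨e, he⟩ := hG.isInvertible_mfderiv_smul g v.proj
  unfold legendre cotangentLift tangentMap
  congr 1
  ext w
  have h := hG.metric_invariant g v.proj v.2 (e.symm w)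
  rw [← he] at h ⊢
  simpa using h

set_option linter.unusedSectionVars false in
theorem cotangentLift_one (p : CotangentBundle E Q) : cotangentLift G 1 p = p := by
  have key : ∀ f : Q → Q, f = id → (⟨f p.proj, p.2 ∘L (mfderiv 𝓘(ℝ, E) 𝓘(ℝ, E) f p.proj).inverse⟩ :
      CotangentBundle E Q) = p := by
    rintro f rfl
    rw [mfderiv_id, ContinuousLinearMap.inverse_id]
    rfl
  exact key _ (by ext q; simp)

variable {N G} in
theorem IsSymmetry.cotangentLift_mul (hG : N.IsSymmetry G) (g h : G) (p : CotangentBundle E Q) :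
    cotangentLift G (g * h) p = cotangentLift G g (cotangentLift G h p) := by
  have key : ∀ f : Q → Q, f = (fun q : Q => g • q) ∘ (fun q : Q => h • q) →
      (⟨f p.proj, p.2 ∘L (mfderiv 𝓘(ℝ, E) 𝓘(ℝ, E) f p.proj).inverse⟩ :
      CotangentBundle E Q) = cotangentLift G g (cotangentLift G h p) := by
    rintro f rfl
    rw [mfderiv_comp p.proj (hG.mdifferentiableAt_smul g (h • p.proj))
      (hG.mdifferentiableAt_smul h p.proj),
      (hG.isInvertible_mfderiv_smul g (h • p.proj)).inverse_comp_of_left]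
    rfl
  exact key _ (by ext q; simp [mul_smul])

/-- The action of the symmetry group on `M`, the restriction of the cotangent lift. -/
instance [hG : N.IsSymmetry G] : MulAction G N.constraintManifold where
  smul g m := ⟨cotangentLift G g m.1, hG.cotangentLift_mem g m.2⟩
  one_smul m := Subtype.ext (cotangentLift_one G m.1)
  mul_smul g h m := Subtype.ext (hG.cotangentLift_mul g h m.1)

end Action

section Phase

variable (EM : Type*) [NormedAddCommGroup EM] [NormedSpace ℝ EM]
  [ChartedSpace EM N.constraintManifold]

/-- The bundle projection `τ : M → Q`. -/
def tau (m : N.constraintManifold) : Q := m.1.proj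

/-- `Θ_M`, the pullback of the Liouville form to `M`. -/
def thetaM : Form 𝓘(ℝ, EM) N.constraintManifold ℝ 1 :=
  Form.pullback 𝓘(ℝ, EM) Subtype.val (liouvilleForm Q)

/-- `Ω_M`, the pullback of the canonical 2-form to `M`. -/
def omegaM : Form 𝓘(ℝ, EM) N.constraintManifold ℝ 2 :=
  Form.pullback 𝓘(ℝ, EM) Subtype.val (canonicalForm Q)

/-- The distribution `C` on `M`: the vectors `v` with `Tτ(v) ∈ D`. -/
def distC (m : N.constraintManifold) : Submodule ℝ (TangentSpace 𝓘(ℝ, EM) m) :=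
  (N.D (N.tau m)).comap (mfderiv 𝓘(ℝ, EM) 𝓘(ℝ, E) N.tau m).toLinearMap

/-- The nonholonomic bivector field `π_nh`, determined by `C` and `Ω_M`. -/
def piNH : SharpField 𝓘(ℝ, EM) N.constraintManifold := fun m =>
  sharpOfPair (N.distC EM m) (N.omegaM EM m)

/-- The gauge transformation `π_B` of `π_nh` by a 2-form `B`. -/
def piB (B : Form 𝓘(ℝ, EM) N.constraintManifold ℝ 2) : SharpField 𝓘(ℝ, EM) N.constraintManifold :=
  fun m => gaugeTransform (N.piNH EM m) (B m)

variable (EG : Type*) [NormedAddCommGroup EG] [NormedSpace ℝ EG]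
  (G : Type*) [TopologicalSpace G] [ChartedSpace EG G] [Group G] [MulAction G Q]
  [N.IsSymmetry G]

/-- The infinitesimal generators `ξ ↦ ξ_M(m)`, the tangent map at `1` of `g ↦ g • m`; here and
below `EG` is the Lie algebra `𝔤 = T_1 G`. -/
def generator (m : N.constraintManifold) : EG →L[ℝ] TangentSpace 𝓘(ℝ, EM) m :=
  mfderiv 𝓘(ℝ, EG) 𝓘(ℝ, EM) (fun g : G => g • m) 1

/-- The vertical distribution `V`, tangent to the orbits in `M`. -/
def distV (m : N.constraintManifold) : Submodule ℝ (TangentSpace 𝓘(ℝ, EM) m) :=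
  LinearMap.range (N.generator EM EG G m).toLinearMap

/-- The momentum map `J : M → 𝔤*`, `⟨J(m), η⟩ = Θ_M(η_M(m))`. -/
def momentum (m : N.constraintManifold) : EG →L[ℝ] ℝ :=
  (ContinuousAlternatingMap.ofSubsingleton ℝ (TangentSpace 𝓘(ℝ, EM) m) ℝ (0 : Fin 1)).symm
    (N.thetaM EM m) ∘L N.generator EM EG G m

/-- A `G`-invariant vertical complement `W` of `C` in `TM`. -/
structure VerticalComplement [IsManifold 𝓘(ℝ, EM) ∞ N.constraintManifold] where
  /-- the distribution `W` -/
  dist : Π m : N.constraintManifold, Submodule ℝ (TangentSpace 𝓘(ℝ, EM) m)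
  regular : IsRegularDistribution 𝓘(ℝ, EM) dist
  isCompl (m : N.constraintManifold) : IsCompl (N.distC EM m) (dist m)
  vertical (m : N.constraintManifold) : dist m ≤ N.distV EM EG G m
  invariant (g : G) (m : N.constraintManifold) (v : TangentSpace 𝓘(ℝ, EM) m) (hv : v ∈ dist m) :
    mfderiv 𝓘(ℝ, EM) 𝓘(ℝ, EM) (fun m : N.constraintManifold => g • m) m v ∈ dist (g • m)

namespace VerticalComplement

variable {N EM EG G} [IsManifold 𝓘(ℝ, EM) ∞ N.constraintManifold] [FiniteDimensional ℝ EM]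
  (W : N.VerticalComplement EM EG G)

/-- Linear maps on the (finite-dimensional) tangent spaces are continuous. -/
def toCLM {V : Type*} [AddCommGroup V] [Module ℝ V] [TopologicalSpace V] [IsTopologicalAddGroup V]
    [ContinuousSMul ℝ V] {m : N.constraintManifold} (f : TangentSpace 𝓘(ℝ, EM) m →ₗ[ℝ] V) :
    TangentSpace 𝓘(ℝ, EM) m →L[ℝ] V :=
  haveI : FiniteDimensional ℝ (TangentSpace 𝓘(ℝ, EM) m) := inferInstanceAs (FiniteDimensional ℝ EM)
  haveI : T2Space (TangentSpace 𝓘(ℝ, EM) m) := inferInstanceAs (T2Space EM)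
  LinearMap.toContinuousLinearMap f

/-- The projection `P_C : TM → C` along `W`. -/
def projC (m : N.constraintManifold) : TangentSpace 𝓘(ℝ, EM) m →L[ℝ] TangentSpace 𝓘(ℝ, EM) m :=
  toCLM (Submodule.projection _ _ (W.isCompl m))

/-- The projection `P_W : TM → W` along `C`. -/
def projW (m : N.constraintManifold) : TangentSpace 𝓘(ℝ, EM) m →L[ℝ] TangentSpace 𝓘(ℝ, EM) m :=
  toCLM (Submodule.projection _ _ (W.isCompl m).symm)

/-- The `𝔤`-valued 1-form `A_W`: `A_W(v) = ξ` if and only if `P_W(v) = ξ_M(m)` (for a free action,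
where the generator map is injective). -/
def connection : Form 𝓘(ℝ, EM) N.constraintManifold EG 1 := fun m =>
  ContinuousAlternatingMap.ofSubsingleton ℝ (TangentSpace 𝓘(ℝ, EM) m) EG (0 : Fin 1)
    (toCLM (linearLeftInverse (N.generator EM EG G m).toLinearMap ∘ₗ (W.projW m).toLinearMap))

/-- The `W`-curvature `K_W(X, Y) = dA_W(P_C X, P_C Y)`. -/
def curvature : Form 𝓘(ℝ, EM) N.constraintManifold EG 2 := fun m =>
  (W.connection.d m).compContinuousLinearMap (W.projC m)

/-- The 3-form `dJ ∧ K_W`, the cyclic sum of `⟨dJ(Z), K_W(X, Y)⟩`. -/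
def dJK : Form 𝓘(ℝ, EM) N.constraintManifold ℝ 3 := fun m =>
  cyclicWedge (mfderiv 𝓘(ℝ, EM) 𝓘(ℝ, EG →L[ℝ] ℝ) (N.momentum EM EG G) m) (W.curvature m)

end VerticalComplement

/-- The orbit space `M/G`. -/
abbrev OrbitSpace : Type _ := MulAction.orbitRel.Quotient G N.constraintManifold

/-- The orbit projection `ρ : M → M/G`. -/
def rho (m : N.constraintManifold) : N.OrbitSpace G := Quotient.mk _ m

end Phase

end NonholonomicSystem
end Systems

end Nonholonomic

end

open Nonholonomic

set_option linter.unusedSectionVars false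

noncomputable section

namespace Nonholonomic

/-! ### Smooth families of alternating maps -/

section AlternatingFamilies

variable {X E V : Type*} [NormedAddCommGroup X] [NormedSpace ℝ X] [NormedAddCommGroup E]
  [NormedSpace ℝ E] [NormedAddCommGroup V] [NormedSpace ℝ V]

/-! The gauge transformation replaces Ω_M by Ω_M - B: the field `piB` takes values in C and
satisfies (Ω_M - B)(π_B(α), Y) = -α(Y) for Y in C, which determines it (`piB_spec`, `eq_piB`). For
functions f_i whose differentials kill vertical vectors put X_i = -π_B(df_i), so that i_{X_i}(Ω_M -
B) = df_i on C. If C were integrable, Cartan's formula for d(Ω_M - B) = -dB on three such fields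
would give the Jacobi identity up to dB, as in symplectic geometry. In general [X_i, X_j] has a
component in W, and A_W measures it: A_W([X_i, X_j]) = -dA_W(X_i, X_j), since A_W vanishes on C. The
functions f_k do not see this component, B does not see it because it lies in W, and Ω_M pairs it
with X_k through i_{ξ_M}Ω_M = d⟨J, ξ⟩ (`omegaM_generator`), a consequence of the invariance of Θ_M.
Hence the cyclic sum of brackets equals (dB + dJ ∧ K_W)(π_B df_0, π_B df_1, π_B df_2). The calculus
is `jacobi_core`, on a vector space; `jacobi_piB` applies it in charts of M.

For this to make sense Ω_M must be nondegenerate on C (`omegaM_nondegenerate`), and A_W, dJ ∧ K_W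
and π_B must be smooth (`smooth_connection`, `smooth_dJK`, `smooth_piB`). Both rest on local
parametrizations of M by positions and frame coordinates of velocities (`exists_localParam`), and on
the fact that a smooth family of injective linear maps has a smooth left inverse
(`exists_smooth_leftInverse`).

The identity descends along ρ. Equivariance of π_B and basicness of dB + dJ ∧ K_W give a unique
reduced field and a unique φ on the orbit space; local sections of the submersion ρ transfer
smoothness and closedness, and brackets of pulled back functions are pulled back brackets
(`cyclicBracket_reduced`, `cyclicBracket_eq_of_submersion`).

The rank of the reduced field may vary, so its integral manifolds are built directly. Write Q for
the field in a chart. The twisted Jacobi identity for linear functions says that the vector fields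
Q(·)a are involutive with continuous structure functions Γ. The time-one flows of the fields
Q(·)(Lt), for t in a small ball, sweep out a submanifold through y. Along each flow line, solutions
b of a linear equation with coefficient Γ give solutions Q(c)b of the variation equation. So
variations stay in the range of Q, and the rank of Q does not exceed that at y
(`variation_mem_range`, `transport_finrank_le`, `exists_integral_ball`). Smooth dependence on t
comes from the implicit function theorem in the space of continuous curves (`exists_flow`). -/

theorem contDiffAt_alternating_apply [FiniteDimensional ℝ V] {k : ℕ} {n : WithTop ℕ∞} {θ : X → E [⋀^Fin k]→L[ℝ] V}
    {v : X → Fin k → E} {x : X} (hθ : ContDiffAt ℝ n θ x) (hv : ∀ i, ContDiffAt ℝ n (v · i) x) :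
    ContDiffAt ℝ n (fun y => θ y (v y)) x := by
  have := FiniteDimensional.complete ℝ V
  -- Evaluation is linear in the form and multilinear in the vectors, hence jointly analytic.
  have h := (ContinuousLinearMap.analyticAt_uncurry_of_multilinear
    (ContinuousAlternatingMap.toContinuousMultilinearMapCLM (𝕜 := ℝ) (E := E) (F := V)
      (ι := Fin k) ℝ) (x := (θ x, v x))).contDiffAt (n := n)
  exact h.comp x (hθ.prodMk (contDiffAt_pi.2 hv))

/-- Values on tuples of basis vectors determine an alternating map linearly and injectively; in
finite dimension this injection has a continuous linear left inverse, through which smoothness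
passes. -/
theorem contDiffAt_alternating_of_apply [FiniteDimensional ℝ E] [FiniteDimensional ℝ V] {k : ℕ}
    {n : WithTop ℕ∞} {θ : X → E [⋀^Fin k]→L[ℝ] V} {x : X}
    (hθ : ∀ v : Fin k → E, ContDiffAt ℝ n (fun y => θ y v) x) : ContDiffAt ℝ n θ x := by
  let b := Module.finBasis ℝ E
  let ev : (E [⋀^Fin k]→L[ℝ] V) →ₗ[ℝ] ((Fin k → Fin (Module.finrank ℝ E)) → V) :=
    { toFun := fun f s => f (fun i => b (s i))
      map_add' := fun f g => rfl
      map_smul' := fun c f => rfl }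
  have hev : LinearMap.ker ev = ⊥ := by
    rw [LinearMap.ker_eq_bot]
    intro f g hfg
    refine ContinuousAlternatingMap.toAlternatingMap_injective
      (AlternatingMap.coe_multilinearMap_injective (Module.Basis.ext_multilinear (fun _ => b) ?_))
    intro s
    exact congrFun hfg s
  obtain ⟨L, hL⟩ := ev.exists_leftInverse_of_injective hev
  have h2 : ContDiffAt ℝ n (fun y => ev (θ y)) x := contDiffAt_pi.2 fun s => hθ _
  have h3 := (LinearMap.toContinuousLinearMap L).contDiff.contDiffAt (x := ev (θ x)) (n := n)
  refine (h3.comp x h2).congr_of_eventuallyEq (Filter.Eventually.of_forall fun y => ?_)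
  exact (LinearMap.congr_fun hL (θ y)).symm

theorem contDiffAt_alternating_comp [FiniteDimensional ℝ E] [FiniteDimensional ℝ V] {k : ℕ}
    {E' : Type*} [NormedAddCommGroup E'] [NormedSpace ℝ E'] {n : WithTop ℕ∞}
    {θ : X → E' [⋀^Fin k]→L[ℝ] V} {f : X → E →L[ℝ] E'} {x : X}
    (hθ : ContDiffAt ℝ n θ x) (hf : ContDiffAt ℝ n f x) :
    ContDiffAt ℝ n (fun y => (θ y).compContinuousLinearMap (f y)) x :=
  contDiffAt_alternating_of_apply fun v =>
    contDiffAt_alternating_apply (v := fun y i => f y (v i)) hθ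
      fun _ => hf.clm_apply contDiffAt_const

theorem contDiffAt_clm_of_apply [FiniteDimensional ℝ E] {n : WithTop ℕ∞} {f : X → E →L[ℝ] V}
    {x : X} (hf : ∀ v, ContDiffAt ℝ n (fun y => f y v) x) : ContDiffAt ℝ n f x := by
  let b := Module.finBasis ℝ E
  have : f = fun y => ∑ i, ContinuousLinearMap.smulRight
      (LinearMap.toContinuousLinearMap (b.coord i)) (f y (b i)) := by
    ext y v
    conv_lhs => rw [← b.sum_repr v]
    simp only [map_sum, map_smul, sum_apply,
      ContinuousLinearMap.smulRight_apply]
    rfl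
  rw [this]
  refine ContDiffAt.sum fun i _ => ?_
  exact ((ContinuousLinearMap.smulRightL ℝ E V
    (LinearMap.toContinuousLinearMap (b.coord i))).contDiff.contDiffAt).comp x (hf (b i))

theorem contDiffAt_extDeriv {k : ℕ} {θ : E → E [⋀^Fin k]→L[ℝ] V} {x : E}
    (hθ : ContDiffAt ℝ ∞ θ x) : ContDiffAt ℝ ∞ (extDeriv θ) x :=
  ContDiffAt.comp (f := fderiv ℝ θ)
    (g := ContinuousAlternatingMap.alternatizeUncurryFinCLM ℝ E V) x
    (ContinuousLinearMap.contDiff _).contDiffAt (hθ.fderiv_right (m := ∞) (by simp))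

theorem minSmoothness_two_le_infty : minSmoothness ℝ 2 ≤ (∞ : WithTop ℕ∞) := by
  rw [minSmoothness_of_isRCLikeNormedField]
  exact WithTop.coe_le_coe.2 (le_top : (2 : ℕ∞) ≤ ⊤)

end AlternatingFamilies

/-! ### Pullbacks and the exterior derivative -/

section Pullback

variable {E : Type*} [NormedAddCommGroup E] [NormedSpace ℝ E]
  {H : Type*} [TopologicalSpace H] {I : ModelWithCorners ℝ E H}
  {E' : Type*} [NormedAddCommGroup E'] [NormedSpace ℝ E']
  {H' : Type*} [TopologicalSpace H'] {I' : ModelWithCorners ℝ E' H'}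
  {E'' : Type*} [NormedAddCommGroup E''] [NormedSpace ℝ E'']
  {H'' : Type*} [TopologicalSpace H''] {I'' : ModelWithCorners ℝ E'' H''}
  {P : Type*} [TopologicalSpace P] [ChartedSpace H P]
  {P' : Type*} [TopologicalSpace P'] [ChartedSpace H' P']
  {P'' : Type*} [TopologicalSpace P''] [ChartedSpace H'' P'']
  {V : Type*} [NormedAddCommGroup V] [NormedSpace ℝ V]
  {F : Type*} [NormedAddCommGroup F] [NormedSpace ℝ F] {k : ℕ}

/-- The pullback of a form on `P` by a map from a normed space, as a family of alternating maps on
that space. -/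
def Form.along (f : F → P) (w : Form I P V k) : F → F [⋀^Fin k]→L[ℝ] V := fun y =>
  (w (f y)).compContinuousLinearMap (mfderiv 𝓘(ℝ, F) I f y)

theorem Form.along_apply (f : F → P) (w : Form I P V k) (y : F) (v : Fin k → F) :
    w.along f y v = w (f y) (fun i => mfderiv 𝓘(ℝ, F) I f y (v i)) := rfl

theorem mfderiv_comp_clm {f : P → P'} {g : P' → P''} {x : P}
    (hg : MDifferentiableAt I' I'' g (f x)) (hf : MDifferentiableAt I I' f x)
    (v : TangentSpace I x) :
    mfderiv I I'' (g ∘ f) x v = mfderiv I' I'' g (f x) (mfderiv I I' f x v) := by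
  rw [mfderiv_comp x hg hf]
  rfl

theorem Form.along_comp {f : F → P} {g : P → P'} (w : Form I' P' V k) {y : F}
    (hg : MDifferentiableAt I I' g (f y)) (hf : MDifferentiableAt 𝓘(ℝ, F) I f y) :
    w.along (g ∘ f) y = (w.pullback I g).along f y := by
  ext v
  exact congrArg (w (g (f y))) (funext fun i => mfderiv_comp_clm hg hf (v i))

theorem Form.along_comp_fderiv {F' : Type*} [NormedAddCommGroup F'] [NormedSpace ℝ F']
    {f : F → F'} {g : F' → P} (w : Form I P V k) {y : F}
    (hg : MDifferentiableAt 𝓘(ℝ, F') I g (f y)) (hf : DifferentiableAt ℝ f y) :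
    w.along (g ∘ f) y = (w.along g (f y)).compContinuousLinearMap (fderiv ℝ f y) := by
  ext v
  refine congrArg (w (g (f y))) (funext fun i => ?_)
  refine (mfderiv_comp_clm hg hf.mdifferentiableAt (v i)).trans ?_
  rw [mfderiv_eq_fderiv]
  rfl

theorem Form.along_congr {f g : F → P} (w : Form I P V k) {x : F} (h : f =ᶠ[𝓝 x] g) :
    w.along f x = w.along g x := by
  unfold Form.along
  rw [h.mfderiv_eq, h.eq_of_nhds]

theorem _root_.ContMDiffAt.eventually_mdifferentiableAt [IsManifold I ∞ P] [IsManifold I' ∞ P']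
    {f : P → P'} {x : P} {n : WithTop ℕ∞} (hf : ContMDiffAt I I' n f x) (hn : 1 ≤ n) :
    ∀ᶠ y in 𝓝 x, MDifferentiableAt I I' f y := by
  have : ContMDiffAt I I' 1 f x := hf.of_le hn
  obtain ⟨u, hu, h⟩ := (contMDiffAt_iff_contMDiffOn_nhds (by simp)).1 this
  filter_upwards [eventually_mem_nhds_iff.2 hu] with y hy
  exact (h.contMDiffAt hy).mdifferentiableAt (by simp)

variable [I.Boundaryless] [IsManifold I ∞ P]

theorem extChartAt_eventually_symm {f : F → P} {x₀ : P} {y : F} (hf : ContinuousAt f y)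
    (hy : f y ∈ (extChartAt I x₀).source) :
    f =ᶠ[𝓝 y] (extChartAt I x₀).symm ∘ (extChartAt I x₀ ∘ f) := by
  filter_upwards [hf.preimage_mem_nhds ((isOpen_extChartAt_source x₀).mem_nhds hy)] with z hz
  exact ((extChartAt I x₀).left_inv hz).symm

theorem contMDiffAt_extChartAt_symm {x₀ : P} {y : E} (hy : y ∈ (extChartAt I x₀).target) :
    ContMDiffAt 𝓘(ℝ, E) I ∞ (extChartAt I x₀).symm y :=
  (contMDiffOn_extChartAt_symm x₀).contMDiffAt ((isOpen_extChartAt_target x₀).mem_nhds hy)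

theorem contMDiffAt_extChartAt_of_mem {x₀ x : P} (hx : x ∈ (extChartAt I x₀).source) :
    ContMDiffAt I 𝓘(ℝ, E) ∞ (extChartAt I x₀) x :=
  contMDiffAt_extChartAt' (by rwa [← extChartAt_source I])

/-- Near a point the pullback factors through one chart, which reduces every question about
`Form.along` to a change of variables in the model space. -/
theorem Form.along_eventuallyEq_inChart (w : Form I P V k) {f : F → P} {x₀ : P} {y : F}
    {n : WithTop ℕ∞} (hn : 1 ≤ n)
    (hf : ContMDiffAt 𝓘(ℝ, F) I n f y) (hy : f y ∈ (extChartAt I x₀).source) :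
    w.along f =ᶠ[𝓝 y] fun z =>
      (w.inChart x₀ (extChartAt I x₀ (f z))).compContinuousLinearMap
        (fderiv ℝ (extChartAt I x₀ ∘ f) z) := by
  filter_upwards [hf.continuousAt.preimage_mem_nhds ((isOpen_extChartAt_source x₀).mem_nhds hy),
    hf.eventually_mdifferentiableAt hn,
    (extChartAt_eventually_symm (I := I) hf.continuousAt hy).eventually_nhds] with z hz hfz he
  have hs := (contMDiffAt_extChartAt_symm ((extChartAt I x₀).map_source hz)).mdifferentiableAt
    (by simp)
  have hc := (contMDiffAt_extChartAt_of_mem (I := I) hz).mdifferentiableAt (by simp)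
  rw [Form.along_congr w he]
  exact Form.along_comp_fderiv w hs (hc.comp z hfz).differentiableAt

theorem Form.Smooth.along [FiniteDimensional ℝ F] [FiniteDimensional ℝ V] {w : Form I P V k}
    (hw : w.Smooth) {f : F → P} {y : F} (hf : ContMDiffAt 𝓘(ℝ, F) I ∞ f y) :
    ContDiffAt ℝ ∞ (w.along f) y := by
  have hy := mem_extChartAt_source (I := I) (f y)
  refine ContDiffAt.congr_of_eventuallyEq ?_ (w.along_eventuallyEq_inChart (by simp) hf hy)
  have hg : ContDiffAt ℝ ∞ (extChartAt I (f y) ∘ f) y :=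
    ((contMDiffAt_extChartAt_of_mem hy).comp y hf).contDiffAt
  have hwc := (hw (f y)).contDiffAt (extChartAt_target_mem_nhds (I := I) (f y))
  exact contDiffAt_alternating_comp (ContDiffAt.comp (g := w.inChart (f y)) y hwc hg) (hg.fderiv_right (by simp))

/-- Since `Form.d` uses at each point the chart centred there, this naturality contains its
independence of the chart. It is the pullback formula for `extDeriv`, applied to `f` read in a
single chart. -/
theorem Form.Smooth.extDeriv_along {w : Form I P V k} (hw : w.Smooth) {f : F → P} {y : F}
    (hf : ContMDiffAt 𝓘(ℝ, F) I ∞ f y) : extDeriv (w.along f) y = w.d.along f y := by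
  have hy := mem_extChartAt_source (I := I) (f y)
  have hg : ContDiffAt ℝ ∞ (extChartAt I (f y) ∘ f) y :=
    ((contMDiffAt_extChartAt_of_mem hy).comp y hf).contDiffAt
  have hwc := (hw (f y)).contDiffAt (extChartAt_target_mem_nhds (I := I) (f y))
  rw [(w.along_eventuallyEq_inChart (by simp) hf hy).extDeriv_eq]
  refine (extDeriv_pullback (f := extChartAt I (f y) ∘ f) (x := y)
    (hwc.differentiableAt (by simp)) hg minSmoothness_two_le_infty).trans ?_
  ext v
  refine congrArg (extDeriv (w.inChart (f y)) (extChartAt I (f y) (f y))) (funext fun i => ?_)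
  rw [← mfderiv_eq_fderiv]
  exact mfderiv_comp_clm ((contMDiffAt_extChartAt_of_mem hy).mdifferentiableAt (by simp))
    (hf.mdifferentiableAt (by simp)) (v i)

theorem Form.Smooth.d_inChart {w : Form I P V k} (hw : w.Smooth) {x₀ : P} {y : E}
    (hy : y ∈ (extChartAt I x₀).target) : w.d.inChart x₀ =ᶠ[𝓝 y] extDeriv (w.inChart x₀) := by
  filter_upwards [(isOpen_extChartAt_target (I := I) x₀).mem_nhds hy] with z hz
  exact (hw.extDeriv_along (contMDiffAt_extChartAt_symm hz)).symm

theorem Form.Smooth.contDiffAt {w : Form I P V k} (hw : w.Smooth) {x₀ : P} {y : E}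
    (hy : y ∈ (extChartAt I x₀).target) : ContDiffAt ℝ ∞ (w.inChart x₀) y :=
  (hw x₀).contDiffAt ((isOpen_extChartAt_target (I := I) x₀).mem_nhds hy)

theorem Form.Smooth.d {w : Form I P V k} (hw : w.Smooth) : w.d.Smooth := fun _ _ hy =>
  ((contDiffAt_extDeriv (hw.contDiffAt hy)).congr_of_eventuallyEq
    (hw.d_inChart hy)).contDiffWithinAt

theorem Form.Smooth.d_d {w : Form I P V k} (hw : w.Smooth) : w.d.Closed := by
  intro x
  have h : extDeriv (w.d.inChart x) (extChartAt I x x) = 0 := by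
    rw [(hw.d_inChart (mem_extChartAt_target (I := I) x)).extDeriv_eq]
    exact extDeriv_extDeriv_apply (hw.contDiffAt (mem_extChartAt_target (I := I) x))
      minSmoothness_two_le_infty
  rw [Form.d, h]
  rfl

/-- A form is smooth if its values on the images of constant vectors are smooth in charts. -/
theorem Form.smooth_of_apply [FiniteDimensional ℝ E] [FiniteDimensional ℝ V] {w : Form I P V k}
    (h : ∀ x₀ : P, ∀ y ∈ (extChartAt I x₀).target, ∀ v : Fin k → E,
      ContDiffAt ℝ ∞ (fun z => w.inChart x₀ z v) y) : w.Smooth :=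
  fun x₀ y hy => (contDiffAt_alternating_of_apply (h x₀ y hy)).contDiffWithinAt

end Pullback

/-! ### Calculus on spaces of continuous maps -/

section ContinuousMaps

variable {K : Type*} [TopologicalSpace K] [CompactSpace K]

/-- Pointwise application of a continuous family of linear maps. -/
def pointwiseApply (K : Type*) [TopologicalSpace K] [CompactSpace K]
    (E F : Type*) [NormedAddCommGroup E] [NormedSpace ℝ E]
    [NormedAddCommGroup F] [NormedSpace ℝ F] : C(K, E →L[ℝ] F) →L[ℝ] C(K, E) →L[ℝ] C(K, F) :=
  LinearMap.mkContinuous₂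
    (LinearMap.mk₂ ℝ (fun (A : C(K, E →L[ℝ] F)) (v : C(K, E)) => (⟨fun s => A s (v s), A.continuous.clm_apply v.continuous⟩ : C(K, F)))
      (fun A A' v => by ext; simp) (fun c A v => by ext; simp)
      (fun A v v' => by ext; simp) (fun c A v => by ext; simp)) 1 fun A v => by
    refine (ContinuousMap.norm_le _ (by positivity)).2 fun s => ?_
    rw [one_mul]
    exact ((A s).le_opNorm (v s)).trans
      (mul_le_mul (A.norm_coe_le_norm s) (v.norm_coe_le_norm s) (norm_nonneg _) (norm_nonneg A))

variable {E F : Type*} [NormedAddCommGroup E] [NormedSpace ℝ E]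
  [NormedAddCommGroup F] [NormedSpace ℝ F]

@[simp] theorem pointwiseApply_apply (A : C(K, E →L[ℝ] F)) (v : C(K, E)) (s : K) :
    pointwiseApply K E F A v s = A s (v s) := rfl

theorem norm_pointwiseApply_le (A : C(K, E →L[ℝ] F)) : ‖pointwiseApply K E F A‖ ≤ ‖A‖ := by
  refine ContinuousLinearMap.opNorm_le_bound _ (norm_nonneg A) fun v => ?_
  refine (ContinuousMap.norm_le _ (by positivity)).2 fun s => ?_
  exact ((A s).le_opNorm (v s)).trans
    (mul_le_mul (A.norm_coe_le_norm s) (v.norm_coe_le_norm s) (norm_nonneg _) (norm_nonneg A))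

/-- Composition with a continuous map, as a map between spaces of continuous maps. -/
def postComp (f : E → F) (hf : Continuous f) (c : C(K, E)) : C(K, F) := ⟨f ∘ c, hf.comp c.continuous⟩

@[simp] theorem postComp_apply (f : E → F) (hf : Continuous f) (c : C(K, E)) (s : K) :
    postComp f hf c s = f (c s) := rfl

/-- The range of `c` is compact, so `fderiv ℝ f` varies by at most ε on δ-balls around its points,
with one δ for all of them; the mean value inequality on these balls bounds the remainder uniformly
over `K`. -/
theorem hasFDerivAt_postComp {f : E → F} (hf : ContDiff ℝ 1 f) (c : C(K, E)) :
    HasFDerivAt (postComp (K := K) f hf.continuous)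
      (pointwiseApply K E F (postComp (fderiv ℝ f) (hf.continuous_fderiv (by simp)) c)) c := by
  rw [hasFDerivAt_iff_isLittleO_nhds_zero, Asymptotics.isLittleO_iff]
  intro ε hε
  have hc := hf.continuous_fderiv (by simp)
  have hK : IsCompact (Set.range c) := isCompact_range c.continuous
  have hu := hK.uniformContinuousAt_of_continuousAt (fderiv ℝ f)
    (fun x _ => hc.continuousAt) (Metric.dist_mem_uniformity hε)
  obtain ⟨δ, hδ, hsub⟩ := Metric.mem_uniformity_dist.1 hu
  filter_upwards [Metric.ball_mem_nhds (0 : C(K, E)) hδ] with h hh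
  rw [mem_ball_zero_iff] at hh
  refine (ContinuousMap.norm_le _ (by positivity)).2 fun s => ?_
  have hs : ‖h s‖ < δ := (h.norm_coe_le_norm s).trans_lt hh
  have key := Convex.norm_image_sub_le_of_norm_hasFDerivWithin_le' (𝕜 := ℝ) (f := f)
    (f' := fderiv ℝ f) (φ := fderiv ℝ f (c s)) (C := ε) (s := Metric.ball (c s) δ)
    (x := c s) (y := c s + h s)
    (fun x _ => ((hf.differentiable (by simp)) x).hasFDerivAt.hasFDerivWithinAt)
    (fun x hx => by
      have := hsub (a := c s) (b := x) (by rw [dist_comm]; exact hx) (Set.mem_range_self s)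
      rw [← dist_eq_norm, dist_comm]
      exact le_of_lt this)
    (convex_ball _ _) (Metric.mem_ball_self hδ) (by simpa using hs)
  simp only [add_sub_cancel_left] at key
  exact key.trans (mul_le_mul_of_nonneg_left (h.norm_coe_le_norm s) hε.le)

/-- The derivative of post-composition with `f` is, up to the bounded bilinear `pointwiseApply`,
post-composition with `fderiv ℝ f`; each further order of differentiability is one step of an
induction over all targets. The common universe lets the induction pass from `F` to `E →L[ℝ] F`. -/
theorem contDiff_postComp {K : Type*} [TopologicalSpace K] [CompactSpace K]
    {E F : Type u} [NormedAddCommGroup E] [NormedSpace ℝ E] [NormedAddCommGroup F]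
    [NormedSpace ℝ F] {f : E → F} (hf : ContDiff ℝ ∞ f) :
    ContDiff ℝ ∞ (postComp (K := K) f hf.continuous) := by
  have key : ∀ n : ℕ, ∀ (F : Type u) [NormedAddCommGroup F] [NormedSpace ℝ F] (f : E → F)
      (hf : ContDiff ℝ ∞ f), ContDiff ℝ n (postComp (K := K) f hf.continuous) := by
    intro n
    induction n with
    | zero =>
      intro F _ _ f hf
      rw [Nat.cast_zero, contDiff_zero]
      exact continuous_iff_continuousAt.2 fun c =>
        (hasFDerivAt_postComp (hf.of_le (by simp)) c).continuousAt
    | succ n ih =>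
      intro F _ _ f hf
      have h1 : ContDiff ℝ 1 f := hf.of_le (by simp)
      have hd : ContDiff ℝ ∞ (fderiv ℝ f) := hf.fderiv_right (by simp)
      push_cast
      refine contDiff_succ_iff_hasFDerivAt.2 ⟨fun c => pointwiseApply K E F (postComp (fderiv ℝ f) hd.continuous c), ?_,
        fun c => hasFDerivAt_postComp h1 c⟩
      exact (pointwiseApply K E F).contDiff.comp (ih _ _ hd)
  exact contDiff_infty.2 fun n => key n F f hf

end ContinuousMaps

/-! ### Integral equations on the unit interval -/

section Integration

variable {E F : Type*} [NormedAddCommGroup E] [NormedSpace ℝ E]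
  [NormedAddCommGroup F] [NormedSpace ℝ F]

open unitInterval

/-- The extension of a function on the unit interval by constants. -/
def extendI (c : C(I, E)) (r : ℝ) : E := c (Set.projIcc 0 1 zero_le_one r)

theorem continuous_extendI (c : C(I, E)) : Continuous (extendI c) :=
  c.continuous.comp continuous_projIcc

theorem extendI_coe (c : C(I, E)) (s : I) : extendI c s = c s := by
  unfold extendI; rw [Set.projIcc_val]

theorem norm_extendI_le (c : C(I, E)) (r : ℝ) : ‖extendI c r‖ ≤ ‖c‖ := c.norm_coe_le_norm _

/-- The primitive vanishing at `0`. -/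
def primitive (E : Type*) [NormedAddCommGroup E] [NormedSpace ℝ E] : C(I, E) →L[ℝ] C(I, E) :=
  LinearMap.mkContinuous
    { toFun := fun c => ⟨fun s => ∫ r in (0 : ℝ)..s, extendI c r,
        (intervalIntegral.continuous_primitive
          (fun a b => (continuous_extendI c).intervalIntegrable a b) 0).comp
            continuous_subtype_val⟩
      map_add' := fun c c' => by
        ext s
        exact intervalIntegral.integral_add ((continuous_extendI c).intervalIntegrable _ _)
          ((continuous_extendI c').intervalIntegrable _ _)
      map_smul' := fun a c => by
        ext s
        exact intervalIntegral.integral_smul a (extendI c) } 1 fun c => by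
    refine (ContinuousMap.norm_le _ (by positivity)).2 fun s => ?_
    refine (intervalIntegral.norm_integral_le_of_norm_le_const
      fun r _ => norm_extendI_le c r).trans ?_
    rw [sub_zero, one_mul, abs_of_nonneg s.2.1]
    exact mul_le_of_le_one_right (norm_nonneg _) s.2.2

theorem primitive_apply (c : C(I, E)) (s : I) :
    primitive E c s = ∫ r in (0 : ℝ)..s, extendI c r := rfl

theorem norm_primitive_le : ‖primitive E‖ ≤ 1 :=
  LinearMap.mkContinuous_norm_le _ zero_le_one _

/-- A product rule for primitives. -/
theorem clm_apply_primitive [CompleteSpace E] [CompleteSpace F] {Q : E → F →L[ℝ] E}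
    (hQ : ContDiff ℝ 1 Q) {c g : C(I, E)} {b h : C(I, F)} {y : E} {b₀ : F}
    (hc : c = ContinuousMap.const I y + primitive E g)
    (hb : b = ContinuousMap.const I b₀ + primitive F h) {p : C(I, E)}
    (hp : ∀ s, p s = fderiv ℝ Q (c s) (g s) (b s) + Q (c s) (h s)) (s : I) :
    Q (c s) (b s) = Q y b₀ + primitive E p s := by
  -- The integral formulas extend both curves to the whole line, so that derivatives are two-sided
  -- even at the endpoints of the interval.
  let ce : ℝ → E := fun s => y + ∫ r in (0 : ℝ)..s, extendI g r
  let be : ℝ → F := fun s => b₀ + ∫ r in (0 : ℝ)..s, extendI h r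
  have hce : ∀ s : I, ce s = c s := fun s => by rw [hc]; rfl
  have hbe : ∀ s : I, be s = b s := fun s => by rw [hb]; rfl
  have dce : ∀ s, HasDerivAt ce (extendI g s) s := fun s =>
    (intervalIntegral.integral_hasDerivAt_right ((continuous_extendI g).intervalIntegrable _ _)
      (continuous_extendI g).aestronglyMeasurable.stronglyMeasurableAtFilter
      (continuous_extendI g).continuousAt).const_add y
  have dbe : ∀ s, HasDerivAt be (extendI h s) s := fun s =>
    (intervalIntegral.integral_hasDerivAt_right ((continuous_extendI h).intervalIntegrable _ _)
      (continuous_extendI h).aestronglyMeasurable.stronglyMeasurableAtFilter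
      (continuous_extendI h).continuousAt).const_add b₀
  have dq : ∀ s, HasDerivAt (fun s => Q (ce s) (be s))
      (fderiv ℝ Q (ce s) (extendI g s) (be s) + Q (ce s) (extendI h s)) s := fun s =>
    (((hQ.differentiable (by simp)) (ce s)).hasFDerivAt.comp_hasDerivAt s (dce s)).clm_apply (dbe s)
  have hd : ∀ r ∈ Set.uIcc (0 : ℝ) s, HasDerivAt (fun s => Q (ce s) (be s)) (extendI p r) r := by
    intro r hr
    rw [Set.uIcc_of_le s.2.1] at hr
    obtain ⟨r', rfl⟩ : ∃ r' : I, r = r' := ⟨⟨r, hr.1, hr.2.trans s.2.2⟩, rfl⟩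
    have := dq r'
    rwa [hce, hbe, extendI_coe, extendI_coe, ← hp, ← extendI_coe] at this
  have := intervalIntegral.integral_eq_sub_of_hasDerivAt hd
    ((continuous_extendI p).intervalIntegrable _ _)
  rw [primitive_apply, this, hce, hbe]
  simp [ce, be]

end Integration

/-! ### Linear transport along a flow line -/

section

set_option maxSynthPendingDepth 3

section Transport

open unitInterval

variable {E F : Type*} [NormedAddCommGroup E] [NormedSpace ℝ E]
  [NormedAddCommGroup F] [NormedSpace ℝ F]

/-- The Volterra operator with kernel `A`. -/
def volterra (A : C(I, E →L[ℝ] E)) : C(I, E) →L[ℝ] C(I, E) :=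
  primitive E ∘L pointwiseApply I E E A

theorem norm_volterra_le (A : C(I, E →L[ℝ] E)) : ‖volterra A‖ ≤ ‖A‖ :=
  (ContinuousLinearMap.opNorm_comp_le _ _).trans
    ((mul_le_of_le_one_left (norm_nonneg _) norm_primitive_le).trans (norm_pointwiseApply_le A))

theorem norm_volterra_apply_le {A : C(I, E →L[ℝ] E)} (hA : ‖A‖ ≤ 1 / 4) (v : C(I, E)) :
    ‖volterra A v‖ ≤ 1 / 4 * ‖v‖ :=
  (ContinuousLinearMap.le_opNorm _ _).trans
    (mul_le_mul_of_nonneg_right ((norm_volterra_le A).trans hA) (norm_nonneg _))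

theorem volterra_unique {A : C(I, E →L[ℝ] E)} (hA : ‖A‖ ≤ 1 / 4) {v p g : C(I, E)}
    (hv : v = g + volterra A v) (hp : p = g + volterra A p) : v = p := by
  have h : v - p = volterra A (v - p) := by
    rw [map_sub]
    nth_rewrite 1 [hv, hp]
    abel
  have h2 := norm_volterra_apply_le hA (v - p)
  rw [← h] at h2
  have : ‖v - p‖ = 0 := by linarith [norm_nonneg (v - p)]
  exact sub_eq_zero.1 (norm_eq_zero.1 this)

/-- Inversion of `1 - volterra A`, an operator at distance less than 1 from the identity. Having the
solution operator as one linear map makes solutions depend linearly on the data. -/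
theorem exists_volterra_resolvent [CompleteSpace E] {A : C(I, E →L[ℝ] E)} (hA : ‖A‖ ≤ 1 / 4) :
    ∃ S : C(I, E) →L[ℝ] C(I, E), ∀ g, S g = g + volterra A (S g) := by
  have h1 : ‖volterra A‖ < 1 := ((norm_volterra_le A).trans hA).trans_lt (by norm_num)
  have hu := isUnit_one_sub_of_norm_lt_one (R := C(I, E) →L[ℝ] C(I, E)) h1
  obtain ⟨S, hS⟩ := hu.exists_right_inv
  refine ⟨S, fun g => ?_⟩
  have := DFunLike.congr_fun hS g
  simp only [mul_apply_eq_comp, sub_apply, one_apply_eq_self] at this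
  exact sub_eq_iff_eq_add.1 this

variable [FiniteDimensional ℝ E] [FiniteDimensional ℝ F]

variable {Q : E → F →L[ℝ] E} (hQ : ContDiff ℝ ∞ Q)
  {Γ : E → F →L[ℝ] F →L[ℝ] F}
  {U : Set E}
  (H : ∀ x ∈ U, ∀ a b, fderiv ℝ Q x (Q x a) b + Q x (Γ x a b) = fderiv ℝ Q x (Q x b) a)
  {y : E} {a : F} {c : C(I, E)}
  (hc : ∀ s, c s ∈ U)
  {g : C(I, E)} (hg : ∀ s, g s = Q (c s) a) (hcg : c = ContinuousMap.const I y + primitive E g)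
  {A₁ : C(I, F →L[ℝ] F)} (hA₁ : ∀ s, A₁ s = Γ (c s) a) (nA₁ : ‖A₁‖ ≤ 1 / 4)
  {A₂ : C(I, E →L[ℝ] E)} (hA₂ : ∀ s w, A₂ s w = fderiv ℝ Q (c s) w a) (nA₂ : ‖A₂‖ ≤ 1 / 4)

include hQ H hc hg hcg hA₁ hA₂ in
-- Along c' = Q(c)a let b' = u + Γ(c)(a, b). Then the derivative of Q(c)b is DQ(c)(Qa)b + Q(c)Γ(a,
-- b) + Q(c)u, and the involutivity relation `H` turns the first two terms into DQ(c)(Qb)a. So Q(c)b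
-- solves the variation equation of the flow.
theorem transport_equation {b : C(I, F)} {b₀ u : F}
    (hb : b = ContinuousMap.const I b₀ + primitive _ (ContinuousMap.const I u) + volterra A₁ b)
    {p q : C(I, E)} (hp : ∀ s, p s = Q (c s) (b s)) (hq : ∀ s, q s = Q (c s) u) :
    p = ContinuousMap.const I (Q y b₀) + primitive E q + volterra A₂ p := by
  have hb' : b = ContinuousMap.const I b₀ + primitive _
      (ContinuousMap.const I u + pointwiseApply I _ _ A₁ b) := by
    rw [map_add, ← add_assoc]; exact hb
  have := FiniteDimensional.complete ℝ E
  have := FiniteDimensional.complete ℝ F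
  ext s
  have hd : ∀ s, (q + pointwiseApply I _ _ A₂ p) s =
      fderiv ℝ Q (c s) (g s) (b s) + Q (c s) ((ContinuousMap.const I u +
        pointwiseApply I _ _ A₁ b) s) := by
    intro s
    have := H (c s) (hc s) a (b s)
    simp only [ContinuousMap.add_apply, pointwiseApply_apply, hA₁, hA₂, hp, hq, hg,
      ContinuousMap.const_apply, map_add]
    rw [← this]
    abel
  rw [hp, clm_apply_primitive (hQ.of_le (by simp)) hcg hb' hd s, map_add]
  exact (add_assoc _ _ _).symm

include hQ H hc hg hcg hA₁ hA₂ nA₁ nA₂ in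
-- Both `v` and Q(c)b, where b is the transport with source `u` and b(0) = 0, solve the variation
-- equation with initial value 0; by uniqueness they agree.
theorem variation_mem_range {u : F} {v q : C(I, E)} (hq : ∀ s, q s = Q (c s) u)
    (hv : v = primitive E q + volterra A₂ v) (s : I) : v s ∈ LinearMap.range (Q (c s)).toLinearMap := by
  have := FiniteDimensional.complete ℝ F
  obtain ⟨S, hS⟩ := exists_volterra_resolvent nA₁
  have hb := hS (ContinuousMap.const I 0 + primitive _ (ContinuousMap.const I u))
  set b := S (ContinuousMap.const I 0 + primitive _ (ContinuousMap.const I u))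
  let p : C(I, E) := ⟨fun s => Q (c s) (b s),
    (hQ.continuous.comp c.continuous).clm_apply b.continuous⟩
  have hp := transport_equation hQ H hc hg hcg hA₁ hA₂ hb (p := p) (fun _ => rfl) hq
  rw [map_zero] at hp
  have hv' : v = ContinuousMap.const I 0 + primitive E q + volterra A₂ v := by
    rw [show (ContinuousMap.const I (0 : E)) = 0 from rfl, zero_add]; exact hv
  rw [volterra_unique nA₂ hv' hp]
  exact ⟨b s, rfl⟩

include hQ H hc hg hcg hA₁ hA₂ nA₁ nA₂ in
-- Transport b₀ ↦ b(1) without source is bijective on `F`. If Q(y)b₀ = 0, then Q(c)b solves a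
-- homogeneous linear equation with zero initial value and vanishes, so transport maps ker Q(y) into
-- ker Q(c(1)).
theorem transport_finrank_le : Module.finrank ℝ (LinearMap.range (Q (c 1)).toLinearMap) ≤
    Module.finrank ℝ (LinearMap.range (Q y).toLinearMap) := by
  have := FiniteDimensional.complete ℝ F
  obtain ⟨S, hS⟩ := exists_volterra_resolvent nA₁
  let R : F →ₗ[ℝ] F :=
    { toFun := fun b₀ => S (ContinuousMap.const I b₀) 1
      map_add' := fun b b' => by
        rw [show ContinuousMap.const I (b + b') = ContinuousMap.const I b + ContinuousMap.const I b'
          from rfl, map_add]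
        rfl
      map_smul' := fun r b => by
        rw [show ContinuousMap.const I (r • b) = r • ContinuousMap.const I b from rfl, map_smul]
        rfl }
  have hker : LinearMap.ker R = ⊥ := by
    refine LinearMap.ker_eq_bot'.2 fun b₀ hb₀ => ?_
    have hb := hS (ContinuousMap.const I b₀)
    have hb₀ : S (ContinuousMap.const I b₀) 1 = 0 := hb₀
    set b := S (ContinuousMap.const I b₀)
    -- If b(1) = 0 then ‖b₀‖ ≤ ‖b‖/4, while always ‖b‖ ≤ ‖b₀‖ + ‖b‖/4; together these force b₀ = 0.
    -- Any kernel bound below 1/2 would do.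
    have h1 : ‖b‖ ≤ ‖b₀‖ + 1 / 4 * ‖b‖ := by
      calc ‖b‖ = ‖ContinuousMap.const I b₀ + volterra A₁ b‖ := by rw [← hb]
        _ ≤ ‖ContinuousMap.const I b₀‖ + ‖volterra A₁ b‖ := norm_add_le _ _
        _ ≤ ‖b₀‖ + 1 / 4 * ‖b‖ := add_le_add
            ((ContinuousMap.norm_le _ (norm_nonneg _)).2 fun _ => le_rfl)
            (norm_volterra_apply_le nA₁ b)
    have h2 : ‖b₀‖ ≤ 1 / 4 * ‖b‖ := by
      have h3 : b₀ + volterra A₁ b 1 = 0 := by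
        rw [← hb₀]; exact (DFunLike.congr_fun hb 1).symm
      rw [eq_neg_of_add_eq_zero_left h3, norm_neg]
      exact ((volterra A₁ b).norm_coe_le_norm 1).trans (norm_volterra_apply_le nA₁ b)
    have : ‖b₀‖ = 0 := by linarith [norm_nonneg b₀]
    exact norm_eq_zero.1 this
  have hsurj : LinearMap.range R = ⊤ := LinearMap.ker_eq_bot_iff_range_eq_top.1 hker
  have hle : LinearMap.ker (Q y).toLinearMap ≤ LinearMap.ker ((Q (c 1)).toLinearMap ∘ₗ R) := by
    intro b₀ hb₀
    have hb₀ : Q y b₀ = 0 := hb₀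
    have hb : S (ContinuousMap.const I b₀) = ContinuousMap.const I b₀ +
        primitive _ (ContinuousMap.const I 0) + volterra A₁ (S (ContinuousMap.const I b₀)) := by
      rw [show ContinuousMap.const I (0 : F) = 0 from rfl, map_zero, add_zero]
      exact hS _
    set b := S (ContinuousMap.const I b₀) with hbdef
    let p : C(I, E) := ⟨fun s => Q (c s) (b s),
      (hQ.continuous.comp c.continuous).clm_apply b.continuous⟩
    have hp := transport_equation hQ H hc hg hcg hA₁ hA₂ hb (p := p) (q := 0) (fun _ => rfl)
      (by simp)
    rw [hb₀, map_zero] at hp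
    have h0 : (0 : C(I, E)) = ContinuousMap.const I 0 + 0 + volterra A₂ 0 := by
      rw [map_zero, add_zero, add_zero]; rfl
    have := volterra_unique nA₂ hp h0
    exact DFunLike.congr_fun this 1
  have e1 := LinearMap.finrank_range_add_finrank_ker (Q y).toLinearMap
  have e2 := LinearMap.finrank_range_add_finrank_ker ((Q (c 1)).toLinearMap ∘ₗ R)
  have e3 := Submodule.finrank_mono hle
  rw [LinearMap.range_comp, hsurj, Submodule.map_top] at e2
  omega

end Transport

end

/-! ### Flows depending on parameters, and integral balls -/

section

set_option maxSynthPendingDepth 3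

section IntegralBall

open unitInterval

variable {E F : Type u} [NormedAddCommGroup E] [NormedSpace ℝ E]
  [NormedAddCommGroup F] [NormedSpace ℝ F]
  {T : Type*} [NormedAddCommGroup T] [NormedSpace ℝ T]

/-- Constant functions. -/
def constI (F : Type*) [NormedAddCommGroup F] [NormedSpace ℝ F] : F →L[ℝ] C(I, F) :=
  LinearMap.mkContinuous
    { toFun := fun a => ContinuousMap.const I a
      map_add' := fun _ _ => rfl
      map_smul' := fun _ _ => rfl } 1 fun a => by
    rw [one_mul]
    exact (ContinuousMap.norm_le _ (norm_nonneg _)).2 fun _ => le_rfl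

@[simp] theorem constI_apply (a : F) (s : I) : constI F a s = a := rfl

variable [FiniteDimensional ℝ E] [FiniteDimensional ℝ F]

/-- Solutions of `c' = Q(c)(Lt)`, `c(0) = y` on the unit interval, depending smoothly on `t`. -/
theorem exists_flow {Q : E → F →L[ℝ] E} (hQ : ContDiff ℝ ∞ Q) (y : E) [CompleteSpace T]
    (L : T →L[ℝ] F) :
    ∃ ψ : T → C(I, E), ψ 0 = constI E y ∧ ∀ᶠ t in 𝓝 0, ContDiffAt ℝ ∞ ψ t ∧ ψ t = constI E y +
        primitive E (pointwiseApply I F E (postComp Q hQ.continuous (ψ t)) (constI F (L t))) := by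
  have := FiniteDimensional.complete ℝ E
  -- The integral equation as a zero set in the space of curves. At t = 0 the vector field vanishes:
  -- the constant curve is a solution and the partial derivative of `G` in the curve is the
  -- identity. Shrinking t replaces shrinking the time interval.
  let G : T × C(I, E) → C(I, E) := fun q => q.2 - constI E y -
    primitive E (pointwiseApply I F E (postComp Q hQ.continuous q.2) (constI F (L q.1)))
  have hG : ContDiff ℝ ∞ G := by
    refine (contDiff_snd.sub contDiff_const).sub ((primitive E).contDiff.comp ?_)
    refine ContDiff.clm_apply ((pointwiseApply I F E).contDiff.comp
      ((contDiff_postComp hQ).comp contDiff_snd)) ?_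
    exact (constI F).contDiff.comp (L.contDiff.comp contDiff_fst)
  have hG0 : G (0, constI E y) = 0 := by
    simp [G]
  have hsec : ∀ v, G (0, v) = v - constI E y := fun v => by simp [G]
  have hinr : fderiv ℝ G (0, constI E y) ∘L ContinuousLinearMap.inr ℝ T (C(I, E)) =
      ContinuousLinearMap.id ℝ _ := by
    have h1 : HasFDerivAt (fun v => G (0, v))
        (fderiv ℝ G (0, constI E y) ∘L ContinuousLinearMap.inr ℝ T (C(I, E))) (constI E y) :=
      HasFDerivAt.comp (g := G) (f := fun v => ((0 : T), v)) (constI E y)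
        (hG.differentiable (by simp) _).hasFDerivAt (hasFDerivAt_prodMk_right _ _)
    have h2 : HasFDerivAt (fun v => G (0, v)) (ContinuousLinearMap.id ℝ _) (constI E y) := by
      simp only [hsec]
      exact (hasFDerivAt_id _).sub_const _
    exact h1.unique h2
  have hinv : (fderiv ℝ G (0, constI E y) ∘L ContinuousLinearMap.inr ℝ T (C(I, E))).IsInvertible := by
    rw [hinr]
    exact ⟨ContinuousLinearEquiv.refl ℝ _, rfl⟩
  have hGa : ContDiffAt ℝ ∞ G (0, constI E y) := hG.contDiffAt
  have hn : (∞ : WithTop ℕ∞) ≠ 0 := by simp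
  set ψ := hGa.implicitFunction hn hinv with hψ
  have hψs : ContDiffAt ℝ 1 ψ 0 := (hGa.contDiffAt_implicitFunction hn hinv).of_le (by simp)
  have hψ0 : ψ 0 = constI E y := hGa.implicitFunction_apply_self hn hinv
  have hψG : ∀ᶠ t in 𝓝 0, G (t, ψ t) = 0 := by
    filter_upwards [hGa.eventually_apply_implicitFunction hn hinv] with t ht
    rw [← hG0]; exact ht
  have hinvt : ∀ᶠ t in 𝓝 0,
      (fderiv ℝ G (t, ψ t) ∘L ContinuousLinearMap.inr ℝ T (C(I, E))).IsInvertible := by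
    have hcont : ContinuousAt (fun t => fderiv ℝ G (t, ψ t) ∘L
        ContinuousLinearMap.inr ℝ T (C(I, E))) 0 := by
      refine ContinuousAt.clm_comp ?_ continuousAt_const
      exact (hG.continuous_fderiv (by simp)).continuousAt.comp
        (continuousAt_id.prodMk hψs.continuousAt)
    refine hcont.eventually (p := fun A => A.IsInvertible) ?_
    beta_reduce
    rw [hψ0]
    obtain ⟨e, he⟩ := hinv
    rw [← he]
    exact ContinuousLinearEquiv.nhds e
  refine ⟨ψ, hψ0, ?_⟩
  filter_upwards [hψs.eventually (by simp), hψG.eventually_nhds, hinvt] with t hst hGt hit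
  have hGt' : ContDiffAt ℝ ∞ G (t, ψ t) := hG.contDiffAt
  constructor
  -- Smoothness of infinite order at 0 alone provides no neighbourhood common to all orders. The
  -- implicit function theorem is therefore applied again at each nearby `t`, and its solution
  -- coincides with `ψ` locally.
  · have hloc := hGt'.eventually_apply_eq_iff_implicitFunction hn hit
    have hcts : ContinuousAt (fun t' => (t', ψ t')) t := continuousAt_id.prodMk hst.continuousAt
    refine (hGt'.contDiffAt_implicitFunction hn hit).congr_of_eventuallyEq ?_
    filter_upwards [hcts.eventually hloc, hGt] with t' h1 h2
    exact (h1.1 (h2.trans hGt.self_of_nhds.symm)).symm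
  · exact sub_eq_iff_eq_add'.1 (sub_eq_zero.1 hGt.self_of_nhds)

/-- The variation equation, obtained by differentiating the fixed-point equation: the parameter `t`
contributes the source term, the curve `ψ t` the linear term. -/
theorem hasFDerivAt_flow {Q : E → F →L[ℝ] E} (hQ : ContDiff ℝ ∞ Q) {y : E} {L : T →L[ℝ] F}
    {ψ : T → C(I, E)} {t : T} (hψ : DifferentiableAt ℝ ψ t)
    (h : ∀ᶠ t in 𝓝 t, ψ t = constI E y +
        primitive E (pointwiseApply I F E (postComp Q hQ.continuous (ψ t)) (constI F (L t))))
    (u : T) :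
    fderiv ℝ ψ t u = primitive E (pointwiseApply I F E (postComp Q hQ.continuous (ψ t))
        (constI F (L u))) +
      primitive E (pointwiseApply I F E (pointwiseApply I E _ (postComp (fderiv ℝ Q)
        (hQ.continuous_fderiv (by simp)) (ψ t)) (fderiv ℝ ψ t u)) (constI F (L t))) := by
  have h1 := (hasFDerivAt_postComp (K := I) (hQ.of_le (by simp)) (ψ t)).comp t hψ.hasFDerivAt
  have h2 := ((pointwiseApply I F E).hasFDerivAt (x := postComp Q hQ.continuous (ψ t))).comp t h1
  have h3 := h2.clm_apply ((constI F ∘L L).hasFDerivAt (x := t))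
  have h4 := (((primitive E).hasFDerivAt).comp t h3).const_add (constI E y)
  have h5 := h4.congr_of_eventuallyEq h
  have := DFunLike.congr_fun h5.fderiv u
  refine this.trans ?_
  rw [← map_add]
  rfl

/-- The coefficients of the transport and variation equations are linear in `L t`, so they vanish at
t = 0 and are small nearby. This supplies the bound 1/4. -/
theorem eventually_norm_pointwiseApply_le {X : Type*} [NormedAddCommGroup X] [NormedSpace ℝ X]
    {P : E → F →L[ℝ] X} (hP : Continuous P) (L : T →L[ℝ] F) {ψ : T → C(I, E)}
    (hψ : ContinuousAt ψ 0) :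
    ∀ᶠ t in 𝓝 0, ‖pointwiseApply I F X (postComp P hP (ψ t)) (constI F (L t))‖ ≤ 1 / 4 := by
  have h1 : ContinuousAt (fun t => postComp P hP (ψ t)) 0 :=
    (ContinuousMap.continuous_postcomp ⟨P, hP⟩).continuousAt.comp hψ
  have h2 : ContinuousAt (fun t => pointwiseApply I F X (postComp P hP (ψ t)) (constI F (L t))) 0 :=
    ((pointwiseApply I F X).continuous.continuousAt.comp h1).clm_apply
      ((constI F).continuous.continuousAt.comp L.continuous.continuousAt)
  have h3 := h2.norm.eventually_le_const (u := 1 / 4) (by simp)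
  exact h3

/-- The map `j` is an exponential map at `y`: the endpoint at time one of the flow of Q(·)(Lt). The
image of dj lies in the range of Q by `variation_mem_range`; it fills it because the rank at j(t) is
at most the rank at y, which is the dimension of the ball. The rank of Q is not assumed constant. -/
theorem exists_integral_ball {Q : E → F →L[ℝ] E} (hQ : ContDiff ℝ ∞ Q)
    {Γ : E → F →L[ℝ] F →L[ℝ] F} (hΓ : Continuous Γ) {U : Set E} (hU : IsOpen U)
    (H : ∀ x ∈ U, ∀ a b, fderiv ℝ Q x (Q x a) b + Q x (Γ x a b) = fderiv ℝ Q x (Q x b) a)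
    {y : E} (hy : y ∈ U) :
    ∃ (k : ℕ) (ε : ℝ) (j : EuclideanSpace ℝ (Fin k) → E), 0 < ε ∧ j 0 = y ∧
      ContDiffOn ℝ ∞ j (Metric.ball 0 ε) ∧ Set.InjOn j (Metric.ball 0 ε) ∧
      ∀ t ∈ Metric.ball (0 : EuclideanSpace ℝ (Fin k)) ε, j t ∈ U ∧
        Function.Injective (fderiv ℝ j t) ∧
        LinearMap.range (fderiv ℝ j t).toLinearMap = LinearMap.range (Q (j t)).toLinearMap := by
  have := FiniteDimensional.complete ℝ E
  let k := Module.finrank ℝ (LinearMap.range (Q y).toLinearMap)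
  let e : EuclideanSpace ℝ (Fin k) ≃ₗ[ℝ] LinearMap.range (Q y).toLinearMap :=
    LinearEquiv.ofFinrankEq _ _ (by simp [k])
  obtain ⟨τ, hτ⟩ := (Q y).toLinearMap.rangeRestrict.exists_rightInverse_of_surjective
    (LinearMap.range_rangeRestrict _)
  -- `L` lifts linear coordinates on the range of Q(y) through Q(y); below, `ℓ` is a left inverse of
  -- Q(y) ∘ L, which is the derivative of `j` at 0.
  let L : EuclideanSpace ℝ (Fin k) →L[ℝ] F := LinearMap.toContinuousLinearMap (τ ∘ₗ e.toLinearMap)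
  have hL : ∀ u, Q y (L u) = e u := fun u => by
    have := LinearMap.congr_fun hτ (e u)
    exact congrArg Subtype.val this
  obtain ⟨ℓ₀, hℓ₀⟩ := ((LinearMap.range (Q y).toLinearMap).subtype ∘ₗ
    e.toLinearMap).exists_leftInverse_of_injective
    (by rw [LinearMap.ker_eq_bot]; exact Subtype.val_injective.comp e.injective)
  let ℓ : E →L[ℝ] EuclideanSpace ℝ (Fin k) := LinearMap.toContinuousLinearMap ℓ₀
  have hℓ : ∀ u, ℓ (Q y (L u)) = u := fun u => by
    rw [hL]; exact LinearMap.congr_fun hℓ₀ u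
  obtain ⟨ψ, hψ0, hψ⟩ := exists_flow hQ y L
  have hψc : ContinuousAt ψ 0 := hψ.self_of_nhds.1.continuousAt
  let ev : C(I, E) →L[ℝ] E := ContinuousMap.evalCLM ℝ 1
  let j : EuclideanSpace ℝ (Fin k) → E := fun t => ψ t 1
  have hj : ∀ t, ContDiffAt ℝ ∞ ψ t → ContDiffAt ℝ ∞ j t := fun t ht =>
    ev.contDiff.contDiffAt.comp t ht
  have hdj : ∀ t u, ContDiffAt ℝ ∞ ψ t → fderiv ℝ j t u = fderiv ℝ ψ t u 1 := fun t u ht => by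
    have := (ev.hasFDerivAt.comp t (ht.differentiableAt (by simp)).hasFDerivAt).fderiv
    exact DFunLike.congr_fun this u
  have hdj0 : ∀ u, fderiv ℝ j 0 u = Q y (L u) := fun u => by
    rw [hdj 0 u hψ.self_of_nhds.1, hasFDerivAt_flow hQ
      (hψ.self_of_nhds.1.differentiableAt (by simp)) (hψ.mono fun _ h => h.2)]
    rw [map_zero, map_zero, map_zero, map_zero, add_zero, primitive_apply, hψ0]
    have : ∀ r : ℝ, extendI (pointwiseApply I F E (postComp Q hQ.continuous (constI E y))
        (constI F (L u))) r = Q y (L u) := fun r => rfl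
    simp [this]
  have hℓj : ∀ t, ContDiffAt ℝ ∞ ψ t → ContDiffAt ℝ ∞ (fun t => ℓ (j t)) t := fun t ht =>
    ℓ.contDiff.contDiffAt.comp t (hj t ht)
  have hdℓj : ∀ t, ContDiffAt ℝ ∞ ψ t → fderiv ℝ (fun t => ℓ (j t)) t = ℓ ∘L fderiv ℝ j t :=
    fun t ht => (ℓ.hasFDerivAt.comp t ((hj t ht).differentiableAt (by simp)).hasFDerivAt).fderiv
  -- From this, dj(t) is injective for small t since units are open, and `j` is injective on a small
  -- ball by the inverse function theorem for ℓ ∘ j.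
  have hd1 : fderiv ℝ (fun t => ℓ (j t)) 0 = 1 := by
    rw [hdℓj 0 hψ.self_of_nhds.1]
    ext1 u
    change ℓ (fderiv ℝ j 0 u) = u
    rw [hdj0, hℓ]
  have hinj : ∀ᶠ t in 𝓝 0, Function.Injective (fderiv ℝ j t) := by
    have hc : ContinuousAt (fderiv ℝ (fun t => ℓ (j t))) 0 :=
      ((hℓj 0 hψ.self_of_nhds.1).fderiv_right (m := ∞) (by simp)).continuousAt
    have hu := hc.eventually (p := fun A => IsUnit A)
      (by rw [hd1]; exact Units.isOpen.mem_nhds isUnit_one)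
    filter_upwards [hu, hψ] with t ht hψt
    rw [hdℓj t hψt.1] at ht
    obtain ⟨A, hA⟩ := ht.exists_left_inv
    intro u v huv
    have h1 : ∀ w, A (ℓ (fderiv ℝ j t w)) = w := fun w => DFunLike.congr_fun hA w
    rw [← h1 u, huv, h1]
  have hstrict : HasStrictFDerivAt (fun t => ℓ (j t))
      ((ContinuousLinearEquiv.refl ℝ (EuclideanSpace ℝ (Fin k)) :
        EuclideanSpace ℝ (Fin k) ≃L[ℝ] EuclideanSpace ℝ (Fin k)) :
        EuclideanSpace ℝ (Fin k) →L[ℝ] EuclideanSpace ℝ (Fin k)) 0 := by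
    have := (hℓj 0 hψ.self_of_nhds.1).hasStrictFDerivAt (by simp)
    rw [hd1] at this
    exact this
  let Φ := hstrict.toOpenPartialHomeomorph
  have hΦ : Φ.source ∈ 𝓝 (0 : EuclideanSpace ℝ (Fin k)) :=
    Φ.open_source.mem_nhds hstrict.mem_toOpenPartialHomeomorph_source
  have hcU : ∀ᶠ t in 𝓝 0, ∀ s, ψ t s ∈ U := by
    obtain ⟨δ, hδ, hball⟩ := Metric.isOpen_iff.1 hU y hy
    have := hψc.eventually (Metric.ball_mem_nhds (ψ 0) hδ)
    filter_upwards [this] with t ht s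
    refine hball ?_
    rw [hψ0] at ht
    exact (ContinuousMap.dist_apply_le_dist (f := ψ t) (g := constI E y) s).trans_lt ht
  -- In the variation equation the unknown is the direction of differentiation and `L t` is the
  -- argument of Q, hence the flip.
  have hflip : Continuous fun x => (fderiv ℝ Q x).flip :=
    (ContinuousLinearMap.flipₗᵢ ℝ E F E).continuous.comp (hQ.continuous_fderiv (by simp))
  have hall := ((hψ.eventually_nhds.and hinj).and ((hcU.and
    (eventually_norm_pointwiseApply_le hΓ L hψc)).and
    (eventually_norm_pointwiseApply_le hflip L hψc))).and
      hΦ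
  obtain ⟨ε, hε, hball⟩ := Metric.eventually_nhds_iff_ball.1 hall
  refine ⟨k, ε, j, hε, by simp only [j, hψ0, constI_apply], fun t ht =>
    (hj t (hball t ht).1.1.1.self_of_nhds.1).contDiffWithinAt, ?_, ?_⟩
  · intro t ht t' ht' htt
    exact Φ.injOn (hball t ht).2 (hball t' ht').2 (congrArg ℓ htt)
  · intro t ht
    obtain ⟨⟨⟨hψt, hit⟩, ⟨hUt, hA₁⟩, hA₂⟩, -⟩ := hball t ht
    have hψt0 := hψt.self_of_nhds
    refine ⟨hUt 1, hit, Submodule.eq_of_le_of_finrank_le ?_ ?_⟩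
    · rintro _ ⟨u, rfl⟩
      change fderiv ℝ j t u ∈ _
      rw [hdj t u hψt0.1]
      exact variation_mem_range hQ H hUt (a := L t) (fun s => rfl) hψt0.2 (fun s => rfl) hA₁
        (fun s w => rfl) hA₂ (u := L u) (q := pointwiseApply I F E
          (postComp Q hQ.continuous (ψ t)) (constI F (L u))) (fun s => rfl)
        (hasFDerivAt_flow hQ (hψt0.1.differentiableAt (by simp)) (hψt.mono fun _ h => h.2) u) 1
    · rw [LinearMap.finrank_range_of_inj hit]
      refine (transport_finrank_le hQ H hUt (a := L t) (fun s => rfl) hψt0.2 (fun s => rfl) hA₁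
        (fun s w => rfl) hA₂).trans ?_
      simp [k]

end IntegralBall

end

/-! ### Cartan's formula and the Jacobi defect on a vector space -/

section Cartan

variable {E V : Type*} [NormedAddCommGroup E] [NormedSpace ℝ E] [NormedAddCommGroup V]
  [NormedSpace ℝ V]

open VectorField

theorem removeNth_vec2_zero {α : Type*} (a b : α) : Fin.removeNth (0 : Fin 2) ![a, b] = ![b] := by
  ext i; fin_cases i; rfl

theorem removeNth_vec2_one {α : Type*} (a b : α) : Fin.removeNth (1 : Fin 2) ![a, b] = ![a] := by
  ext i; fin_cases i; rfl

theorem alternating_swap {T V : Type*} [AddCommGroup T] [Module ℝ T] [TopologicalSpace T]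
    [AddCommGroup V] [Module ℝ V] [TopologicalSpace V] (θ : T [⋀^Fin 2]→L[ℝ] V) (a b : T) :
    θ ![a, b] = -θ ![b, a] := by
  have := θ.toAlternatingMap.map_swap ![b, a] (i := 0) (j := 1) (by simp)
  have h : (![b, a] ∘ Equiv.swap 0 1 : Fin 2 → T) = ![a, b] := by
    ext i; fin_cases i <;> simp
  rwa [h] at this

theorem extDeriv_one_apply {A : E → E [⋀^Fin 1]→L[ℝ] V} {x : E} (hA : DifferentiableAt ℝ A x)
    (u v : E) : extDeriv A x ![u, v] =
      fderiv ℝ (fun z => A z ![v]) x u - fderiv ℝ (fun z => A z ![u]) x v := by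
  rw [extDeriv_apply hA, Fin.sum_univ_two]
  simp only [removeNth_vec2_zero, removeNth_vec2_one]
  simp [sub_eq_add_neg]

theorem extDeriv_one_vectorField {A : E → E [⋀^Fin 1]→L[ℝ] V} {x : E}
    (hA : DifferentiableAt ℝ A x) {X Y : E → E} (hX : DifferentiableAt ℝ X x)
    (hY : DifferentiableAt ℝ Y x) : extDeriv A x ![X x, Y x] =
      fderiv ℝ (fun z => A z ![Y z]) x (X x) - fderiv ℝ (fun z => A z ![X z]) x (Y x)
        - A x ![lieBracket ℝ X Y x] := by
  have h := extDeriv_apply_vectorField (V := ![X, Y]) hA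
    (fun i => by fin_cases i <;> assumption)
  have e : (fun i => (![X, Y] : Fin 2 → E → E) i x) = ![X x, Y x] := by
    ext i; fin_cases i <;> rfl
  have e0 : ∀ z, Fin.removeNth (0 : Fin 2) (fun i => (![X, Y] : Fin 2 → E → E) i z) = ![Y z] := by
    intro z; ext i; fin_cases i; rfl
  have e1 : ∀ z, Fin.removeNth (1 : Fin 2) (fun i => (![X, Y] : Fin 2 → E → E) i z) = ![X z] := by
    intro z; ext i; fin_cases i; rfl
  rw [e] at h
  rw [h, Fin.sum_univ_two]
  simp only [e0, e1]
  simp [sub_eq_add_neg]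

theorem extDeriv_two_vectorField {θ : E → E [⋀^Fin 2]→L[ℝ] V} {x : E}
    (hθ : DifferentiableAt ℝ θ x) {X Y Z : E → E} (hX : DifferentiableAt ℝ X x)
    (hY : DifferentiableAt ℝ Y x) (hZ : DifferentiableAt ℝ Z x) :
    extDeriv θ x ![X x, Y x, Z x] =
      fderiv ℝ (fun z => θ z ![Y z, Z z]) x (X x) - fderiv ℝ (fun z => θ z ![X z, Z z]) x (Y x)
        + fderiv ℝ (fun z => θ z ![X z, Y z]) x (Z x)
        - θ x ![lieBracket ℝ X Y x, Z x] + θ x ![lieBracket ℝ X Z x, Y x]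
        - θ x ![lieBracket ℝ Y Z x, X x] := by
  have h := extDeriv_apply_vectorField (V := ![X, Y, Z]) hθ
    (fun i => by fin_cases i <;> assumption)
  have e : (fun i => (![X, Y, Z] : Fin 3 → E → E) i x) = ![X x, Y x, Z x] := by
    ext i; fin_cases i <;> rfl
  have e0 : ∀ z, Fin.removeNth (0 : Fin 3) (fun i => (![X, Y, Z] : Fin 3 → E → E) i z) =
      ![Y z, Z z] := by
    intro z; ext i; fin_cases i <;> rfl
  have e1 : ∀ z, Fin.removeNth (1 : Fin 3) (fun i => (![X, Y, Z] : Fin 3 → E → E) i z) =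
      ![X z, Z z] := by
    intro z; ext i; fin_cases i <;> rfl
  have e2 : ∀ z, Fin.removeNth (2 : Fin 3) (fun i => (![X, Y, Z] : Fin 3 → E → E) i z) =
      ![X z, Y z] := by
    intro z; ext i; fin_cases i <;> rfl
  have s0 : Finset.Ici (0 : Fin 2) = {0, 1} := by decide
  have s1 : Finset.Ici (1 : Fin 2) = {1} := by decide
  have r00 : (0 : Fin 2).removeNth ((0 : Fin 2).castSucc.removeNth
      ![X x, Y x, Z x]) = ![Z x] := by ext i; fin_cases i; rfl
  have r10 : (1 : Fin 2).removeNth ((0 : Fin 2).castSucc.removeNth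
      ![X x, Y x, Z x]) = ![Y x] := by ext i; fin_cases i; rfl
  have r11 : (1 : Fin 2).removeNth ((1 : Fin 2).castSucc.removeNth
      ![X x, Y x, Z x]) = ![X x] := by ext i; fin_cases i; rfl
  rw [e] at h
  rw [h, Fin.sum_univ_three, Fin.sum_univ_two]
  simp only [e0, e1, e2, s0, s1]
  rw [Finset.sum_insert (by decide), Finset.sum_singleton, Finset.sum_singleton, r00, r10, r11]
  have c0 : (![X, Y, Z] : Fin 3 → E → E) (Fin.castSucc 0) = X := rfl
  have c1 : (![X, Y, Z] : Fin 3 → E → E) (Fin.castSucc 1) = Y := rfl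
  have d0 : (![X, Y, Z] : Fin 3 → E → E) (Fin.succ 0) = Y := rfl
  have d1 : (![X, Y, Z] : Fin 3 → E → E) (Fin.succ 1) = Z := rfl
  rw [c0, c1, d0, d1]
  simp
  abel

/-- The Jacobi identity defect for a 2-form `θ` that is nondegenerate along a distribution `S`:
`X i ∈ S` is the hamiltonian vector field of `f i`, and `A` is a connection-like 1-form vanishing
on `S`. -/
theorem jacobi_core {θ : E → E [⋀^Fin 2]→L[ℝ] ℝ} {A : E → E [⋀^Fin 1]→L[ℝ] V} {y : E}
    (hθ : DifferentiableAt ℝ θ y) (hA : DifferentiableAt ℝ A y)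
    {X : Fin 3 → E → E} (hX : ∀ i, DifferentiableAt ℝ (X i) y)
    {f : Fin 3 → E → ℝ} (hf : ∀ i, ContDiffAt ℝ 2 (f i) y) {S : E → Submodule ℝ E}
    (hXS : ∀ᶠ z in 𝓝 y, ∀ i, X i z ∈ S z)
    (hXf : ∀ᶠ z in 𝓝 y, ∀ i, ∀ v ∈ S z, θ z ![X i z, v] = fderiv ℝ (f i) z v)
    (hAS : ∀ᶠ z in 𝓝 y, ∀ v ∈ S z, A z ![v] = 0) {l : E → V → ℝ}
    (hl : ∀ v a, l v (-a) = -l v a)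
    (hdec : ∀ v, ∃ w, v - w ∈ S y ∧ (∀ i, fderiv ℝ (f i) y w = 0) ∧
      ∀ c ∈ S y, θ y ![w, c] = l c (A y ![v])) :
    -fderiv ℝ (fun z => -fderiv ℝ (f 2) z (X 1 z)) y (X 0 y)
      - fderiv ℝ (fun z => -fderiv ℝ (f 0) z (X 2 z)) y (X 1 y)
      - fderiv ℝ (fun z => -fderiv ℝ (f 1) z (X 0 z)) y (X 2 y) =
    extDeriv θ y ![X 0 y, X 1 y, X 2 y] -
      (l (X 2 y) (extDeriv A y ![X 0 y, X 1 y]) + l (X 0 y) (extDeriv A y ![X 1 y, X 2 y]) +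
        l (X 1 y) (extDeriv A y ![X 2 y, X 0 y])) := by
  -- This is the bracket of f_i and f_j; the sign comes from X_i = -π♯(df_i).
  let br : Fin 3 → Fin 3 → E → ℝ := fun i j z => -fderiv ℝ (f j) z (X i z)
  have hskew : ∀ i j, ∀ᶠ z in 𝓝 y, br i j z = -br j i z := by
    intro i j
    filter_upwards [hXS, hXf] with z h1 h2
    simp only [br]
    rw [← h2 j _ (h1 i), ← h2 i _ (h1 j), alternating_swap]
  have hθbr : ∀ i j, ∀ᶠ z in 𝓝 y, θ z ![X i z, X j z] = br i j z := by
    intro i j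
    filter_upwards [hXS, hXf, hskew i j] with z h1 h2 h3
    rw [h2 i _ (h1 j), h3]
    simp [br]
  have hdskew : ∀ i j k, fderiv ℝ (br i j) y (X k y) = -fderiv ℝ (br j i) y (X k y) := by
    intro i j k
    rw [Filter.EventuallyEq.fderiv_eq (hskew i j), fderiv_fun_neg]
    rfl
  have hdθ : ∀ i j k, fderiv ℝ (fun z => θ z ![X i z, X j z]) y (X k y) =
      fderiv ℝ (br i j) y (X k y) := fun i j k => by
    rw [Filter.EventuallyEq.fderiv_eq (hθbr i j)]
  have hdf : ∀ k, DifferentiableAt ℝ (fderiv ℝ (f k)) y := fun k =>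
    ((hf k).fderiv_right (m := 1) (by norm_num)).differentiableAt (by simp)
  have hbr : ∀ i j k, fderiv ℝ (br i j) y (X k y) =
      -(fderiv ℝ (fderiv ℝ (f j)) y (X k y) (X i y) +
        fderiv ℝ (f j) y (fderiv ℝ (X i) y (X k y))) := by
    intro i j k
    have := (((hdf j).hasFDerivAt.clm_apply (hX i).hasFDerivAt).neg).fderiv
    have h2 := DFunLike.congr_fun this (X k y)
    refine h2.trans ?_
    simp [add_comm]
  -- Symmetry of the second derivative of f_k makes the Lie bracket act as the commutator.
  have hlie : ∀ i j k, fderiv ℝ (f k) y (lieBracket ℝ (X i) (X j) y) =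
      -fderiv ℝ (br j k) y (X i y) + fderiv ℝ (br i k) y (X j y) := by
    intro i j k
    have hsymm := ((hf k).isSymmSndFDerivAt (by simp)) (X i y) (X j y)
    rw [hbr, hbr, lieBracket, map_sub]
    linarith
  -- `A` vanishes on all the X_i in a neighbourhood, so only the bracket term of Cartan's formula
  -- survives.
  have hAlie : ∀ i j, A y ![lieBracket ℝ (X i) (X j) y] = -extDeriv A y ![X i y, X j y] := by
    intro i j
    have h0 : ∀ i, (fun z => A z ![X i z]) =ᶠ[𝓝 y] fun _ => 0 := fun i => by
      filter_upwards [hXS, hAS] with z h1 h2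
      exact h2 _ (h1 i)
    rw [extDeriv_one_vectorField hA (hX i) (hX j), (h0 i).fderiv_eq, (h0 j).fderiv_eq]
    simp
  -- The bracket is split into a part in S, where θ(X_k, ·) is df_k, and the part `w`, invisible to
  -- the df_k and paired with X_k through `l`. The failure of S to be involutive enters only here.
  have hθlie : ∀ i j k, θ y ![lieBracket ℝ (X i) (X j) y, X k y] =
      fderiv ℝ (br j k) y (X i y) - fderiv ℝ (br i k) y (X j y) -
        l (X k y) (extDeriv A y ![X i y, X j y]) := by
    intro i j k
    obtain ⟨w, hw1, hw2, hw3⟩ := hdec (lieBracket ℝ (X i) (X j) y)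
    have e1 := hw3 _ (hXS.self_of_nhds k)
    have e2 := hXf.self_of_nhds k _ hw1
    rw [map_sub, hw2, sub_zero, hlie, alternating_swap] at e2
    have e3 : θ y ![lieBracket ℝ (X i) (X j) y, X k y] =
        θ y ![lieBracket ℝ (X i) (X j) y - w, X k y] + θ y ![w, X k y] := by
      have := (θ y).toAlternatingMap.map_vecCons_add ![X k y]
        (lieBracket ℝ (X i) (X j) y - w) w
      rw [sub_add_cancel] at this
      exact this
    rw [hAlie, hl] at e1
    linarith
  -- The derivative terms give the cyclic sum once and the Lie bracket terms subtract it twice; this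
  -- leaves the sign on the left-hand side.
  rw [extDeriv_two_vectorField hθ (hX 0) (hX 1) (hX 2), hdθ, hdθ, hdθ, hθlie, hθlie, hθlie]
  have a1 := hdskew 0 1 2
  have a2 := hdskew 0 2 1
  have a3 := hdskew 1 2 0
  have a4 : l (X 1 y) (extDeriv A y ![X 2 y, X 0 y]) = -l (X 1 y) (extDeriv A y ![X 0 y, X 2 y]) := by
    rw [alternating_swap, hl]
  change -fderiv ℝ (br 1 2) y (X 0 y) - fderiv ℝ (br 2 0) y (X 1 y) -
    fderiv ℝ (br 0 1) y (X 2 y) = _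
  linarith

end Cartan

/-! ### Smooth left inverses -/

section LeftInverse

variable {X R E : Type*} [NormedAddCommGroup X] [NormedSpace ℝ X]
  [NormedAddCommGroup R] [NormedSpace ℝ R] [NormedAddCommGroup E] [NormedSpace ℝ E]
  [FiniteDimensional ℝ R] [FiniteDimensional ℝ E]

/-- A smooth family of linear maps that is injective at a point has a smooth left inverse nearby. -/
theorem exists_smooth_leftInverse {n : WithTop ℕ∞} {w : X → R →L[ℝ] E} {x : X} (hw : ContDiffAt ℝ n w x)
    (hinj : Function.Injective (w x)) :
    ∃ m : X → E →L[ℝ] R, ContDiffAt ℝ n m x ∧ ∀ᶠ z in 𝓝 x, ∀ r, m z (w z r) = r := by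
  have := FiniteDimensional.complete ℝ R
  obtain ⟨L₀, hL₀⟩ := (w x).toLinearMap.exists_leftInverse_of_injective
    (LinearMap.ker_eq_bot.2 hinj)
  let L : E →L[ℝ] R := LinearMap.toContinuousLinearMap L₀
  have hc : ContDiffAt ℝ n (fun z => L ∘L w z) x := contDiffAt_const.clm_comp hw
  have h1 : L ∘L w x = 1 := by ext r; exact LinearMap.congr_fun hL₀ r
  have hu : IsUnit (L ∘L w x) := by rw [h1]; exact isUnit_one
  have hev : ∀ᶠ z in 𝓝 x, IsUnit (L ∘L w z) :=
    hc.continuousAt.eventually (p := fun A => IsUnit A) (Units.isOpen.mem_nhds hu)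
  -- A left inverse `L` at the centre makes L ∘ w(z) invertible for z near x, and one corrects by
  -- its inverse.
  refine ⟨fun z => Ring.inverse (L ∘L w z) ∘L L, ?_, ?_⟩
  · obtain ⟨u, hu⟩ := hu
    have hinv := contDiffAt_ringInverse ℝ (n := n) u
    rw [hu] at hinv
    exact (ContDiffAt.comp (g := Ring.inverse) x hinv hc).clm_comp contDiffAt_const
  · filter_upwards [hev] with z hz r
    exact DFunLike.congr_fun (Ring.inverse_mul_cancel _ hz) r

end LeftInverse

/-! ### Tangent maps, charts and frames -/

section Manifolds

variable {E : Type*} [NormedAddCommGroup E] [NormedSpace ℝ E]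
  {H : Type*} [TopologicalSpace H] {I : ModelWithCorners ℝ E H}
  {E' : Type*} [NormedAddCommGroup E'] [NormedSpace ℝ E']
  {H' : Type*} [TopologicalSpace H'] {I' : ModelWithCorners ℝ E' H'}
  {E'' : Type*} [NormedAddCommGroup E''] [NormedSpace ℝ E'']
  {H'' : Type*} [TopologicalSpace H''] {I'' : ModelWithCorners ℝ E'' H''}
  {P : Type*} [TopologicalSpace P] [ChartedSpace H P] [IsManifold I ∞ P]
  {P' : Type*} [TopologicalSpace P'] [ChartedSpace H' P'] [IsManifold I' ∞ P']
  {X : Type*} [TopologicalSpace X] [ChartedSpace H'' X]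
  {F : Type*} [NormedAddCommGroup F] [NormedSpace ℝ F]

theorem contMDiffAt_tangentMap {f : P → P'} {v : TangentBundle I P}
    (hf : ContMDiffAt I I' ∞ f v.proj) :
    ContMDiffAt I.tangent I'.tangent ∞ (tangentMap I I' f) v := by
  let b₁ : TangentBundle I P → P := fun p ↦ p.1
  let b₂ : TangentBundle I P → P' := f ∘ b₁
  have hb₁ : ContMDiffAt I.tangent I ∞ b₁ v := Bundle.contMDiffAt_proj (TangentSpace I)
  have hb₂ : ContMDiffAt I.tangent I' ∞ b₂ v := hf.comp v hb₁
  have hϕ : ContMDiffAt I.tangent 𝓘(ℝ, E →L[ℝ] E') ∞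
      (fun y ↦ ContinuousLinearMap.inCoordinates E (TangentSpace I (M := P)) E'
      (TangentSpace I' (M := P')) (b₁ v) (b₁ y) (b₂ v) (b₂ y) (mfderiv I I' f (b₁ y))) v :=
    (ContMDiffAt.mfderiv_const (m := ∞) hf (by simp)).comp v hb₁
  exact ContMDiffAt.clm_apply_of_inCoordinates (v := fun y => y.2) hϕ contMDiffAt_id hb₂

theorem contMDiffAt_tangentBundle_mk {h ζ : X → F} {x : X}
    (hh : ContMDiffAt I'' 𝓘(ℝ, F) ∞ h x) (hζ : ContMDiffAt I'' 𝓘(ℝ, F) ∞ ζ x) :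
    ContMDiffAt I'' 𝓘(ℝ, F).tangent ∞ (fun x => (⟨h x, ζ x⟩ : TangentBundle 𝓘(ℝ, F) F)) x := by
  rw [Bundle.contMDiffAt_totalSpace]
  refine ⟨hh, ?_⟩
  simpa using hζ

/-- The derivative of a map from a normed space in a moving direction. -/
theorem contMDiffAt_mfderiv_along {f : F → P} {h ζ : X → F} {x : X}
    (hf : ContMDiffAt 𝓘(ℝ, F) I ∞ f (h x))
    (hh : ContMDiffAt I'' 𝓘(ℝ, F) ∞ h x) (hζ : ContMDiffAt I'' 𝓘(ℝ, F) ∞ ζ x) :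
    ContMDiffAt I'' I.tangent ∞
      (fun x => (⟨f (h x), mfderiv 𝓘(ℝ, F) I f (h x) (ζ x)⟩ : TangentBundle I P)) x :=
  (contMDiffAt_tangentMap (v := (⟨h x, ζ x⟩ : TangentBundle 𝓘(ℝ, F) F)) hf).comp x
    (contMDiffAt_tangentBundle_mk hh hζ)

theorem contMDiffAt_mfderiv_snd {f : P → F} {v : X → TangentBundle I P} {x : X}
    (hf : ContMDiffAt I 𝓘(ℝ, F) ∞ f (v x).proj) (hv : ContMDiffAt I'' I.tangent ∞ v x) :
    ContMDiffAt I'' 𝓘(ℝ, F) ∞ (fun x => (mfderiv I 𝓘(ℝ, F) f (v x).proj (v x).2 : F)) x := by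
  have h1 := (contMDiffAt_tangentMap hf).comp x hv
  exact (contMDiff_snd_tangentBundle_modelSpace F 𝓘(ℝ, F)).contMDiffAt.comp x h1

variable [I.Boundaryless]

theorem mfderiv_extChartAt_symm_apply {x₀ : P} {y : E} (hy : y ∈ (extChartAt I x₀).target)
    (u : E) : mfderiv I 𝓘(ℝ, E) (extChartAt I x₀) ((extChartAt I x₀).symm y)
      (mfderiv 𝓘(ℝ, E) I (extChartAt I x₀).symm y u) = u := by
  have h1 := (contMDiffAt_extChartAt_symm (I := I) hy).mdifferentiableAt (by simp)
  have h2 := (contMDiffAt_extChartAt_of_mem (I := I)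
    ((extChartAt I x₀).map_target hy)).mdifferentiableAt (by simp)
  refine (mfderiv_comp_clm h2 h1 u).symm.trans ?_
  have : extChartAt I x₀ ∘ (extChartAt I x₀).symm =ᶠ[𝓝 y] id := by
    filter_upwards [(isOpen_extChartAt_target (I := I) x₀).mem_nhds hy] with z hz
    exact (extChartAt I x₀).right_inv hz
  rw [this.mfderiv_eq, mfderiv_id]
  rfl

theorem mfderiv_symm_extChartAt_apply {x₀ : P} {y : E} (hy : y ∈ (extChartAt I x₀).target)
    (v : TangentSpace I ((extChartAt I x₀).symm y)) :
    mfderiv 𝓘(ℝ, E) I (extChartAt I x₀).symm y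
      (mfderiv I 𝓘(ℝ, E) (extChartAt I x₀) ((extChartAt I x₀).symm y) v) = v := by
  have hinv := isInvertible_mfderiv_extChartAt (I := I) ((extChartAt I x₀).map_target hy)
  obtain ⟨e, he⟩ := hinv
  have := mfderiv_extChartAt_symm_apply hy (e v)
  rw [← he] at this ⊢
  exact e.injective this

theorem mfderiv_chart_symm_self {x : P} (v : TangentSpace I x) :
    mfderiv 𝓘(ℝ, E) I (extChartAt I x).symm (extChartAt I x x)
      (mfderiv I 𝓘(ℝ, E) (extChartAt I x) x v) = v := by
  have h1 := (contMDiffAt_extChartAt_symm (I := I) (mem_extChartAt_target x)).mdifferentiableAt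
    (by simp)
  have h2 := (contMDiffAt_extChartAt_of_mem (I := I)
    (mem_extChartAt_source x)).mdifferentiableAt (by simp)
  have h3 := mfderiv_comp_clm h1 h2 v
  rw [← h3]
  have : (extChartAt I x).symm ∘ extChartAt I x =ᶠ[𝓝 x] id := by
    filter_upwards [(isOpen_extChartAt_source (I := I) x).mem_nhds (mem_extChartAt_source x)]
      with z hz
    exact (extChartAt I x).left_inv hz
  rw [this.mfderiv_eq, mfderiv_id]
  rfl

/-- A regular distribution is, in a chart, the range of a smooth family of injective maps. -/
theorem IsRegularDistribution.exists_frame {Δ : Π x : P, Submodule ℝ (TangentSpace I x)}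
    (hΔ : IsRegularDistribution I Δ) {x₀ : P} {y : E} (hy : y ∈ (extChartAt I x₀).target) :
    ∃ (r : ℕ) (w : E → EuclideanSpace ℝ (Fin r) →L[ℝ] E), ContDiffAt ℝ ∞ w y ∧
      ∀ᶠ z in 𝓝 y, Function.Injective (w z) ∧
        ∀ u, u ∈ Set.range (w z) ↔
          mfderiv 𝓘(ℝ, E) I (extChartAt I x₀).symm z u ∈ Δ ((extChartAt I x₀).symm z) := by
  obtain ⟨r, X, U, hU, hX, hspan⟩ := hΔ ((extChartAt I x₀).symm y)
  let ψ := (extChartAt I x₀).symm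
  let ξ : Fin r → E → E := fun i z => mfderiv I 𝓘(ℝ, E) (extChartAt I x₀) (ψ z) (X i (ψ z))
  have hψ := contMDiffAt_extChartAt_symm (I := I) hy
  have hξ : ∀ i, ContDiffAt ℝ ∞ (ξ i) y := fun i => by
    refine (contMDiffAt_mfderiv_snd (v := fun z => (⟨ψ z, X i (ψ z)⟩ : TangentBundle I P))
      (contMDiffAt_extChartAt_of_mem ((extChartAt I x₀).map_target hy)) ?_).contDiffAt
    exact ((hX i).contMDiffAt hU).comp y hψ
  refine ⟨r, fun z => ∑ i, (EuclideanSpace.proj i).smulRight (ξ i z), ?_, ?_⟩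
  · refine ContDiffAt.sum fun i _ => ?_
    exact ((ContinuousLinearMap.smulRightL ℝ (EuclideanSpace ℝ (Fin r)) E
      (EuclideanSpace.proj i)).contDiff.contDiffAt).comp y (hξ i)
  · filter_upwards [(isOpen_extChartAt_target (I := I) x₀).mem_nhds hy,
      hψ.continuousAt.preimage_mem_nhds hU] with z hz hzU
    obtain ⟨hli, hsp⟩ := hspan _ hzU
    have hw : ∀ c : EuclideanSpace ℝ (Fin r),
        (∑ i, (EuclideanSpace.proj i).smulRight (ξ i z) : EuclideanSpace ℝ (Fin r) →L[ℝ] E) c =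
          mfderiv I 𝓘(ℝ, E) (extChartAt I x₀) (ψ z) (∑ i, c i • X i (ψ z)) := fun c => by
      rw [map_sum, sum_apply]
      refine Finset.sum_congr rfl fun i _ => ?_
      rw [map_smul]
      rfl
    have hw' : ∀ c : EuclideanSpace ℝ (Fin r), mfderiv 𝓘(ℝ, E) I ψ z
        ((∑ i, (EuclideanSpace.proj i).smulRight (ξ i z) : EuclideanSpace ℝ (Fin r) →L[ℝ] E) c) =
          ∑ i, c i • X i (ψ z) := fun c => by
      rw [hw]; exact mfderiv_symm_extChartAt_apply hz _
    refine ⟨?_, fun u => ⟨?_, fun hu => ?_⟩⟩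
    · intro c c' h
      have h2 := (hw' c).symm.trans ((congrArg _ h).trans (hw' c'))
      ext i
      have h3 := Fintype.linearIndependent_iff.1 hli (fun i => c i - c' i) (by
        simp only [sub_smul, Finset.sum_sub_distrib]
        exact sub_eq_zero.2 h2) i
      exact sub_eq_zero.1 h3
    · rintro ⟨c, rfl⟩
      rw [← hsp]
      refine (hw' c).symm ▸ Submodule.sum_mem _ fun i _ => Submodule.smul_mem _ _ ?_
      exact Submodule.subset_span ⟨i, rfl⟩
    · rw [← hsp, Submodule.mem_span_range_iff_exists_fun] at hu
      obtain ⟨c, hc⟩ := hu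
      refine ⟨WithLp.toLp 2 c, ?_⟩
      have h1 := (hw (WithLp.toLp 2 c)).trans (congrArg _ hc)
      exact h1.trans (mfderiv_extChartAt_symm_apply hz u)

end Manifolds

/-! ### Local sections of submersions -/

section Submersions

variable {E : Type*} [NormedAddCommGroup E] [NormedSpace ℝ E]
  {E' : Type*} [NormedAddCommGroup E'] [NormedSpace ℝ E']
  {P : Type*} [TopologicalSpace P] [ChartedSpace E P] [IsManifold 𝓘(ℝ, E) ∞ P]
  {P' : Type*} [TopologicalSpace P'] [ChartedSpace E' P'] [IsManifold 𝓘(ℝ, E') ∞ P']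

/-- Submersions have smooth local sections. -/
theorem exists_local_section {f : P → P'} (hf : Manifold.IsSubmersion 𝓘(ℝ, E) 𝓘(ℝ, E') ∞ f)
    (x : P) : ∃ s : P' → P, s (f x) = x ∧
      ∀ᶠ p in 𝓝 (f x), ContMDiffAt 𝓘(ℝ, E') 𝓘(ℝ, E) ∞ s p ∧ f (s p) = p := by
  have h := hf.isSubmersionAt x
  let d := h.domChart
  let c := h.codChart
  let e := h.equiv
  -- In adapted charts `f` is a linear projection; the section freezes the complementary coordinates
  -- at those of `x`.
  let g : E' → E := fun z => e.symm (z, (e (d x)).2)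
  let s : P' → P := fun p => d.symm (g (c p))
  have hcd : ∀ p ∈ d.target, c (f (d.symm p)) = (e p).1 := fun p hp =>
    h.writtenInCharts (by simpa using hp)
  have hx : x ∈ d.source := h.mem_domChart_source
  have hcx : c (f x) = (e (d x)).1 := by
    rw [← hcd _ (d.map_source hx), d.left_inv hx]
  have hgx : g (c (f x)) = d x := by
    simp only [g]
    rw [hcx]
    exact e.symm_apply_apply _
  have hgc : Continuous g := e.symm.continuous.comp (continuous_id.prodMk continuous_const)
  have hg : ContDiff ℝ ∞ g := e.symm.contDiff.comp (contDiff_id.prodMk contDiff_const)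
  refine ⟨s, ?_, ?_⟩
  · simp only [s]
    rw [hgx, d.left_inv hx]
  · have h1 : ∀ᶠ p in 𝓝 (f x), p ∈ c.source := c.open_source.mem_nhds h.mem_codChart_source
    have hcc : ContinuousAt (fun p => g (c p)) (f x) :=
      hgc.continuousAt.comp (c.continuousAt h.mem_codChart_source)
    have h2 : ∀ᶠ p in 𝓝 (f x), g (c p) ∈ d.target := by
      refine hcc.eventually (p := fun z => z ∈ d.target) (d.open_target.mem_nhds ?_)
      change g (c (f x)) ∈ d.target
      rw [hgx]; exact d.map_source hx
    filter_upwards [h1, h2] with p hp1 hp2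
    constructor
    · have e1 : ContMDiffAt 𝓘(ℝ, E') 𝓘(ℝ, E') ∞ c p :=
        contMDiffAt_of_mem_maximalAtlas h.codChart_mem_maximalAtlas hp1
      have e2 : ContMDiffAt 𝓘(ℝ, E) 𝓘(ℝ, E) ∞ d.symm (g (c p)) :=
        contMDiffAt_symm_of_mem_maximalAtlas h.domChart_mem_maximalAtlas hp2
      exact ContMDiffAt.comp (g := d.symm) p e2
        (ContMDiffAt.comp (g := g) p hg.contMDiff.contMDiffAt e1)
    · have hs : s p ∈ d.source := d.map_target hp2
      have e1 := hcd _ hp2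
      have e2 : (e (g (c p))).1 = c p := by simp [g]
      exact c.injOn (h.source_subset_preimage_source hs) hp1 (e1.trans e2)

theorem mfderiv_surjective_of_isSubmersion {f : P → P'}
    (hf : Manifold.IsSubmersion 𝓘(ℝ, E) 𝓘(ℝ, E') ∞ f) (x : P) :
    Function.Surjective (mfderiv 𝓘(ℝ, E) 𝓘(ℝ, E') f x) := by
  obtain ⟨s, hsx, hs⟩ := exists_local_section hf x
  intro v
  refine ⟨(mfderiv 𝓘(ℝ, E') 𝓘(ℝ, E) s (f x) v : E), ?_⟩
  have h1 : f ∘ s =ᶠ[𝓝 (f x)] id := hs.mono fun p hp => hp.2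
  have h2 := mfderiv_comp_clm (f := s) (g := f) (x := f x)
    ((hf.contMDiff (s (f x))).mdifferentiableAt (by simp))
    (hs.self_of_nhds.1.mdifferentiableAt (by simp)) v
  rw [h1.mfderiv_eq, mfderiv_id, hsx] at h2
  exact h2.symm

end Submersions

/-! ### Maps into embedded submanifolds, and pullbacks of forms -/

section Embeddings

variable {E : Type*} [NormedAddCommGroup E] [NormedSpace ℝ E]
  {H : Type*} [TopologicalSpace H] {I : ModelWithCorners ℝ E H}
  {E' : Type*} [NormedAddCommGroup E'] [NormedSpace ℝ E']
  {H' : Type*} [TopologicalSpace H'] {I' : ModelWithCorners ℝ E' H'}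
  {E'' : Type*} [NormedAddCommGroup E''] [NormedSpace ℝ E'']
  {H'' : Type*} [TopologicalSpace H''] {I'' : ModelWithCorners ℝ E'' H''}
  {P : Type*} [TopologicalSpace P] [ChartedSpace H P] [IsManifold I ∞ P]
  {P' : Type*} [TopologicalSpace P'] [ChartedSpace H' P'] [IsManifold I' ∞ P']
  {X : Type*} [TopologicalSpace X] [ChartedSpace H'' X] [IsManifold I'' ∞ X]

/-- The charts of M are arbitrary subject to the inclusion being an embedding; maps into M are shown
to be smooth through this universal property. -/
theorem _root_.Manifold.IsSmoothEmbedding.contMDiffAt_of_comp {φ : P → P'}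
    (hφ : Manifold.IsSmoothEmbedding I I' ∞ φ) {f : X → P} {x : X}
    (hf : ContMDiffAt I'' I' ∞ (φ ∘ f) x) : ContMDiffAt I'' I ∞ f x :=
  (ContMDiffAt.iff_comp_isImmersionAt (hφ.isImmersion.isImmersionAt (f x))).2
    ⟨hφ.isEmbedding.isInducing.continuousAt_iff.2 hf.continuousAt, hf⟩

end Embeddings

section Pullbacks

variable {E : Type*} [NormedAddCommGroup E] [NormedSpace ℝ E]
  {H : Type*} [TopologicalSpace H] {I : ModelWithCorners ℝ E H}
  {E' : Type*} [NormedAddCommGroup E'] [NormedSpace ℝ E']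
  {H' : Type*} [TopologicalSpace H'] {I' : ModelWithCorners ℝ E' H'}
  {P : Type*} [TopologicalSpace P] [ChartedSpace H P] [IsManifold I ∞ P] [I.Boundaryless]
  {P' : Type*} [TopologicalSpace P'] [ChartedSpace H' P'] [IsManifold I' ∞ P'] [I'.Boundaryless]
  {V : Type*} [NormedAddCommGroup V] [NormedSpace ℝ V] [FiniteDimensional ℝ V] {k : ℕ}

theorem Form.eq_of_along_symm {w w' : Form I P V k} {x₀ : P} {y : E}
    (hy : y ∈ (extChartAt I x₀).target)
    (h : w.along (extChartAt I x₀).symm y = w'.along (extChartAt I x₀).symm y) :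
    w ((extChartAt I x₀).symm y) = w' ((extChartAt I x₀).symm y) := by
  ext v
  have h1 := DFunLike.congr_fun h
    (fun i => mfderiv I 𝓘(ℝ, E) (extChartAt I x₀) ((extChartAt I x₀).symm y) (v i))
  have e : (fun i => mfderiv 𝓘(ℝ, E) I (extChartAt I x₀).symm y
      (mfderiv I 𝓘(ℝ, E) (extChartAt I x₀) ((extChartAt I x₀).symm y) (v i))) = v :=
    funext fun i => mfderiv_symm_extChartAt_apply hy (v i)
  exact (congrArg (w _) e).symm.trans (h1.trans (congrArg (w' _) e))

theorem Form.eq_of_along {w w' : Form I P V k}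
    (h : ∀ (x₀ : P), ∀ y ∈ (extChartAt I x₀).target,
      w.along (extChartAt I x₀).symm y = w'.along (extChartAt I x₀).symm y) : w = w' := by
  funext x
  have := Form.eq_of_along_symm (mem_extChartAt_target x) (h x _ (mem_extChartAt_target x))
  rwa [extChartAt_to_inv] at this

theorem Form.Smooth.pullback [FiniteDimensional ℝ E] {w : Form I' P' V k} (hw : w.Smooth)
    {f : P → P'} (hf : ContMDiff I I' ∞ f) : (w.pullback I f).Smooth := by
  intro x₀ y hy
  have hψ := contMDiffAt_extChartAt_symm (I := I) hy
  refine ((hw.along ((hf _).comp y hψ)).congr_of_eventuallyEq ?_).contDiffWithinAt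
  filter_upwards [(isOpen_extChartAt_target (I := I) x₀).mem_nhds hy] with z hz
  exact (w.along_comp ((hf _).mdifferentiableAt (by simp))
    ((contMDiffAt_extChartAt_symm hz).mdifferentiableAt (by simp))).symm

/-- Both sides are compared after pulling back by inverse charts, where they are exterior
derivatives along maps from a normed space. -/
theorem Form.Smooth.d_pullback [FiniteDimensional ℝ E] {w : Form I' P' V k} (hw : w.Smooth)
    {f : P → P'} (hf : ContMDiff I I' ∞ f) : (w.pullback I f).d = w.d.pullback I f := by
  refine Form.eq_of_along fun x₀ y hy => ?_
  have hψ := contMDiffAt_extChartAt_symm (I := I) hy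
  rw [← (hw.pullback hf).extDeriv_along hψ]
  have h1 : (w.pullback I f).along (extChartAt I x₀).symm =ᶠ[𝓝 y]
      w.along (f ∘ (extChartAt I x₀).symm) := by
    filter_upwards [(isOpen_extChartAt_target (I := I) x₀).mem_nhds hy] with z hz
    exact (w.along_comp ((hf _).mdifferentiableAt (by simp))
      ((contMDiffAt_extChartAt_symm hz).mdifferentiableAt (by simp))).symm
  rw [h1.extDeriv_eq, hw.extDeriv_along ((hf _).comp y hψ)]
  exact w.d.along_comp ((hf _).mdifferentiableAt (by simp)) (hψ.mdifferentiableAt (by simp))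

end Pullbacks

/-! ### Pairings, the Liouville form and tangent maps of families -/

section Bundles

variable {E : Type*} [NormedAddCommGroup E] [NormedSpace ℝ E]
  {Q : Type*} [TopologicalSpace Q] [ChartedSpace E Q] [IsManifold 𝓘(ℝ, E) ∞ Q]
  {E' : Type*} [NormedAddCommGroup E'] [NormedSpace ℝ E']
  {H' : Type*} [TopologicalSpace H'] {I' : ModelWithCorners ℝ E' H'}
  {X : Type*} [TopologicalSpace X] [ChartedSpace H' X]

theorem contMDiffAt_pairing {b : X → Q} {p : Π x, TangentSpace 𝓘(ℝ, E) (b x) →L[ℝ] ℝ}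
    {v : Π x, TangentSpace 𝓘(ℝ, E) (b x)} {x : X}
    (hp : ContMDiffAt I' (𝓘(ℝ, E).prod 𝓘(ℝ, E →L[ℝ] ℝ)) ∞
      (fun x => (⟨b x, p x⟩ : CotangentBundle E Q)) x)
    (hv : ContMDiffAt I' 𝓘(ℝ, E).tangent ∞ (fun x => (⟨b x, v x⟩ : TangentBundle 𝓘(ℝ, E) Q)) x) :
    ContMDiffAt I' 𝓘(ℝ, ℝ) ∞ (fun x => p x (v x)) x := by
  have h := ContMDiffAt.clm_bundle_apply (E₁ := fun q : Q => TangentSpace 𝓘(ℝ, E) q)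
    (E₂ := Bundle.Trivial Q ℝ) (F₁ := E) (F₂ := ℝ) (b := b) (ϕ := p) (v := v) hp hv
  rw [Bundle.contMDiffAt_totalSpace] at h
  exact h.2

theorem contMDiff_proj_cotangentBundle :
    ContMDiff (𝓘(ℝ, E).prod 𝓘(ℝ, E →L[ℝ] ℝ)) 𝓘(ℝ, E) ∞
      (fun p : CotangentBundle E Q => p.proj) := fun _ =>
  Bundle.contMDiffAt_proj (fun q : Q => TangentSpace 𝓘(ℝ, E) q →L[ℝ] ℝ)

/-- On a constant vector of the chart the form is the pairing of the covector with the tangent map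
of the base projection, both smooth along that projection. -/
theorem smooth_liouvilleForm [FiniteDimensional ℝ E] : (liouvilleForm Q (E := E)).Smooth := by
  refine Form.smooth_of_apply fun p₀ y hy v => ?_
  have hψ := contMDiffAt_extChartAt_symm (I := 𝓘(ℝ, E).prod 𝓘(ℝ, E →L[ℝ] ℝ)) hy
  have hτψ : ∀ z ∈ (extChartAt (𝓘(ℝ, E).prod 𝓘(ℝ, E →L[ℝ] ℝ)) p₀).target,
      ContMDiffAt 𝓘(ℝ, E × (E →L[ℝ] ℝ)) 𝓘(ℝ, E) ∞ ((fun p : CotangentBundle E Q => p.proj) ∘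
        (extChartAt (𝓘(ℝ, E).prod 𝓘(ℝ, E →L[ℝ] ℝ)) p₀).symm) z := fun z hz =>
    (contMDiff_proj_cotangentBundle _).comp z (contMDiffAt_extChartAt_symm hz)
  have h := contMDiffAt_mfderiv_along (X := E × (E →L[ℝ] ℝ)) (I'' := 𝓘(ℝ, E × (E →L[ℝ] ℝ)))
    (h := fun z => z) (ζ := fun _ => v 0) (hτψ y hy) contMDiffAt_id contMDiffAt_const
  refine ((contMDiffAt_pairing (b := fun z =>
    ((extChartAt (𝓘(ℝ, E).prod 𝓘(ℝ, E →L[ℝ] ℝ)) p₀).symm z).proj)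
    (p := fun z => ((extChartAt (𝓘(ℝ, E).prod 𝓘(ℝ, E →L[ℝ] ℝ)) p₀).symm z).2) hψ
    h).congr_of_eventuallyEq ?_).contDiffAt
  filter_upwards [(isOpen_extChartAt_target (I := 𝓘(ℝ, E).prod 𝓘(ℝ, E →L[ℝ] ℝ)) p₀).mem_nhds hy]
    with z hz
  refine congrArg ((extChartAt (𝓘(ℝ, E).prod 𝓘(ℝ, E →L[ℝ] ℝ)) p₀).symm z).2 ?_
  exact (mfderiv_comp_clm ((contMDiff_proj_cotangentBundle _).mdifferentiableAt (by simp))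
    ((contMDiffAt_extChartAt_symm hz).mdifferentiableAt (by simp)) _).symm

end Bundles

section ProductTangent

variable {E : Type*} [NormedAddCommGroup E] [NormedSpace ℝ E]
  {P : Type*} [TopologicalSpace P] [ChartedSpace E P] [IsManifold 𝓘(ℝ, E) ∞ P]
  {E' : Type*} [NormedAddCommGroup E'] [NormedSpace ℝ E']
  {P' : Type*} [TopologicalSpace P'] [ChartedSpace E' P'] [IsManifold 𝓘(ℝ, E') ∞ P']
  {EG : Type*} [NormedAddCommGroup EG] [NormedSpace ℝ EG]
  {G : Type*} [TopologicalSpace G] [ChartedSpace EG G] [IsManifold 𝓘(ℝ, EG) ∞ G]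
  {E'' : Type*} [NormedAddCommGroup E''] [NormedSpace ℝ E'']
  {H'' : Type*} [TopologicalSpace H''] {I'' : ModelWithCorners ℝ E'' H''}
  {X : Type*} [TopologicalSpace X] [ChartedSpace H'' X]

/-- The tangent map of a smooth family of maps is smooth, including in the parameter. -/
theorem contMDiffAt_partial_mfderiv {a : G → P → P'}
    (ha : ContMDiff (𝓘(ℝ, EG).prod 𝓘(ℝ, E)) 𝓘(ℝ, E') ∞ (fun p : G × P => a p.1 p.2))
    {g : X → TangentBundle 𝓘(ℝ, EG) G} {v : X → TangentBundle 𝓘(ℝ, E) P} {x : X}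
    (hg : ContMDiffAt I'' 𝓘(ℝ, EG).tangent ∞ g x) (hv : ContMDiffAt I'' 𝓘(ℝ, E).tangent ∞ v x) :
    ContMDiffAt I'' 𝓘(ℝ, E').tangent ∞ (fun x => (⟨a (g x).proj (v x).proj,
      (mfderiv 𝓘(ℝ, EG) 𝓘(ℝ, E') (fun h => a h (v x).proj) (g x).proj (g x).2 +
        mfderiv 𝓘(ℝ, E) 𝓘(ℝ, E') (a (g x).proj) (v x).proj (v x).2 : E')⟩ :
        TangentBundle 𝓘(ℝ, E') P')) x := by
  have hm1 : IsManifold 𝓘(ℝ, EG) 1 G := IsManifold.of_le (n := ∞) (by simp)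
  have hm2 : IsManifold 𝓘(ℝ, E) 1 P := IsManifold.of_le (n := ∞) (by simp)
  -- The two tangent vectors form one tangent vector of the product, on which the derivative of the
  -- joint map is the sum of its partial derivatives.
  have h1 := (contMDiff_equivTangentBundleProd_symm (n := ∞) (I := 𝓘(ℝ, EG)) (M := G)
    (I' := 𝓘(ℝ, E)) (M' := P) (g x, v x)).comp x (hg.prodMk hv)
  have h2 := (contMDiffAt_tangentMap (ha _)).comp x h1
  refine h2.congr_of_eventuallyEq (Filter.Eventually.of_forall fun z => ?_)
  refine congrArg (Bundle.TotalSpace.mk _) ?_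
  have hd := (ha ((g z).proj, (v z).proj)).mdifferentiableAt (by simp)
  have e1 := mfderiv_comp_clm (f := fun h : G => (h, (v z).proj)) hd
    (mdifferentiableAt_id.prodMk mdifferentiableAt_const) (g z).2
  have e2 := mfderiv_comp_clm (f := fun q : P => ((g z).proj, q)) hd
    (mdifferentiableAt_const.prodMk mdifferentiableAt_id) (v z).2
  refine (congrArg₂ (fun a b : E' => a + b) e1 e2).trans ?_
  rw [mfderiv_prod_left, mfderiv_prod_right]
  refine (map_add (mfderiv (𝓘(ℝ, EG).prod 𝓘(ℝ, E)) 𝓘(ℝ, E') (fun p : G × P => a p.1 p.2)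
    ((g z).proj, (v z).proj)) _ _).symm.trans ?_
  exact congrArg _ (Prod.ext (add_zero ((g z).2 : EG)) (zero_add ((v z).2 : E)))

end ProductTangent

section ClmSmooth

variable {E : Type*} [NormedAddCommGroup E] [NormedSpace ℝ E] [FiniteDimensional ℝ E]
  {V : Type*} [NormedAddCommGroup V] [NormedSpace ℝ V]
  {E'' : Type*} [NormedAddCommGroup E''] [NormedSpace ℝ E'']
  {H'' : Type*} [TopologicalSpace H''] {I'' : ModelWithCorners ℝ E'' H''}
  {X : Type*} [TopologicalSpace X] [ChartedSpace H'' X]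

theorem contMDiffAt_clm_of_apply {f : X → E →L[ℝ] V} {x : X}
    (hf : ∀ v, ContMDiffAt I'' 𝓘(ℝ, V) ∞ (fun y => f y v) x) :
    ContMDiffAt I'' 𝓘(ℝ, E →L[ℝ] V) ∞ f x := by
  let b := Module.finBasis ℝ E
  have : f = fun y => ∑ i, ContinuousLinearMap.smulRight
      (LinearMap.toContinuousLinearMap (b.coord i)) (f y (b i)) := by
    ext y v
    conv_lhs => rw [← b.sum_repr v]
    simp only [map_sum, map_smul, sum_apply, ContinuousLinearMap.smulRight_apply]
    rfl
  rw [this]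
  refine ContMDiffAt.sum fun i _ => ?_
  exact (ContinuousLinearMap.smulRightL ℝ E V
    (LinearMap.toContinuousLinearMap (b.coord i))).contDiff.contMDiff.contMDiffAt.comp x (hf _)

end ClmSmooth

/-! ### Local parametrizations of the constraint manifold -/

namespace NonholonomicSystem

variable {E : Type*} [NormedAddCommGroup E] [NormedSpace ℝ E]
  {Q : Type*} [TopologicalSpace Q] [ChartedSpace E Q] [IsManifold 𝓘(ℝ, E) ∞ Q]
  (N : NonholonomicSystem E Q)

/-- The covector of a point of the cotangent bundle, in the model space. -/
def covector (p : CotangentBundle E Q) : E →L[ℝ] ℝ := p.2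

theorem eq_zero_of_inner_self {q : Q} {v : TangentSpace 𝓘(ℝ, E) q}
    (h : N.metric.inner q v v = 0) : v = 0 := by
  by_contra hv
  exact (N.metric.pos q v hv).ne' h

theorem legendre_injective : Function.Injective N.legendre := by
  rintro ⟨q, v⟩ ⟨q', v'⟩ h
  obtain rfl : q = q' := congrArg (fun p : CotangentBundle E Q => p.proj) h
  have h2 := congrArg covector h
  have h3 : N.metric.inner q (v - v') (v - v') = 0 := by
    have h4 : N.metric.inner q (v - v') = 0 := by
      rw [map_sub, sub_eq_zero]
      exact h2
    rw [h4]
    rfl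
  rw [sub_eq_zero.1 (N.eq_zero_of_inner_self h3)]

theorem contMDiff_legendre : ContMDiff 𝓘(ℝ, E).tangent (𝓘(ℝ, E).prod 𝓘(ℝ, E →L[ℝ] ℝ)) ∞
    N.legendre := by
  intro v
  have h1 : ContMDiffAt 𝓘(ℝ, E).tangent 𝓘(ℝ, E) ∞
      (fun v : TangentBundle 𝓘(ℝ, E) Q => v.proj) v := Bundle.contMDiffAt_proj _
  exact ContMDiffAt.clm_bundle_apply (E₁ := fun q : Q => TangentSpace 𝓘(ℝ, E) q)
    (E₂ := fun q : Q => TangentSpace 𝓘(ℝ, E) q →L[ℝ] ℝ) (F₁ := E) (F₂ := E →L[ℝ] ℝ)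
    (b := fun v : TangentBundle 𝓘(ℝ, E) Q => v.proj) (ϕ := fun v => N.metric.inner v.proj)
    (v := fun v => v.2) ((N.metric.contMDiff _).comp v h1) contMDiffAt_id

theorem exists_velocity (m : N.constraintManifold) (q : Q) (hq : q = N.tau m) :
    ∃ v : TangentSpace 𝓘(ℝ, E) q, v ∈ N.D q ∧ N.legendre ⟨q, v⟩ = m.1 := by
  obtain ⟨p, ⟨v, hv, rfl⟩⟩ := m
  subst hq
  exact ⟨v.2, hv, rfl⟩

/-- The velocity of a point of the constraint manifold. -/
def velocity (m : N.constraintManifold) : TangentSpace 𝓘(ℝ, E) (N.tau m) :=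
  (N.exists_velocity m _ rfl).choose

theorem legendre_velocity (m : N.constraintManifold) : N.legendre ⟨N.tau m, N.velocity m⟩ = m.1 :=
  (N.exists_velocity m _ rfl).choose_spec.2

open Classical in
/-- The point of the constraint manifold with given velocity (velocity zero if the given one is
not admissible). -/
def ofVelocity (v : TangentBundle 𝓘(ℝ, E) Q) : N.constraintManifold :=
  if h : v.2 ∈ N.D v.proj then ⟨N.legendre v, v, h, rfl⟩
  else ⟨N.legendre ⟨v.proj, 0⟩, ⟨v.proj, 0⟩, Submodule.zero_mem _, rfl⟩

theorem val_ofVelocity {v : TangentBundle 𝓘(ℝ, E) Q} (h : v.2 ∈ N.D v.proj) :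
    (N.ofVelocity v).1 = N.legendre v := by
  rw [ofVelocity, dif_pos h]

/-- The metric in the chart at `q₀`. -/
def chartMetric (q₀ : Q) (z : E) : E →L[ℝ] E →L[ℝ] ℝ :=
  let b : E →L[ℝ] E →L[ℝ] ℝ := N.metric.inner ((extChartAt 𝓘(ℝ, E) q₀).symm z)
  let T : E →L[ℝ] E := mfderiv 𝓘(ℝ, E) 𝓘(ℝ, E) (extChartAt 𝓘(ℝ, E) q₀).symm z
  b.bilinearComp T T

theorem chartMetric_apply (q₀ : Q) (z a b : E) : N.chartMetric q₀ z a b =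
    N.metric.inner ((extChartAt 𝓘(ℝ, E) q₀).symm z)
      (mfderiv 𝓘(ℝ, E) 𝓘(ℝ, E) (extChartAt 𝓘(ℝ, E) q₀).symm z a)
      (mfderiv 𝓘(ℝ, E) 𝓘(ℝ, E) (extChartAt 𝓘(ℝ, E) q₀).symm z b) := rfl

theorem chartMetric_definite {q₀ : Q} {z a : E} (hz : z ∈ (extChartAt 𝓘(ℝ, E) q₀).target)
    (h : N.chartMetric q₀ z a a = 0) : a = 0 := by
  have h1 := N.eq_zero_of_inner_self (q := (extChartAt 𝓘(ℝ, E) q₀).symm z)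
    (v := mfderiv 𝓘(ℝ, E) 𝓘(ℝ, E) (extChartAt 𝓘(ℝ, E) q₀).symm z a)
    ((N.chartMetric_apply q₀ z a a).symm.trans h)
  have h2 := mfderiv_extChartAt_symm_apply (I := 𝓘(ℝ, E)) hz a
  rw [← h2]
  exact (congrArg _ h1).trans (map_zero _)

theorem contDiffAt_chartMetric [FiniteDimensional ℝ E] {q₀ : Q} {z : E}
    (hz : z ∈ (extChartAt 𝓘(ℝ, E) q₀).target) : ContDiffAt ℝ ∞ (N.chartMetric q₀) z := by
  refine contDiffAt_clm_of_apply fun a => contDiffAt_clm_of_apply fun b => ?_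
  have hT : ∀ a : E, ContMDiffAt 𝓘(ℝ, E) 𝓘(ℝ, E).tangent ∞
      (fun z => (⟨(extChartAt 𝓘(ℝ, E) q₀).symm z,
        mfderiv 𝓘(ℝ, E) 𝓘(ℝ, E) (extChartAt 𝓘(ℝ, E) q₀).symm z a⟩ : TangentBundle 𝓘(ℝ, E) Q)) z :=
    fun a => contMDiffAt_mfderiv_along (h := fun z => z) (ζ := fun _ => a)
      (contMDiffAt_extChartAt_symm hz) contMDiffAt_id contMDiffAt_const
  exact (contMDiffAt_pairing ((N.contMDiff_legendre _).comp z (hT a)) (hT b)).contDiffAt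

/-- The constraint manifold is an embedded submanifold of the cotangent bundle. -/
abbrev IsEmbedded (EM : Type*) [NormedAddCommGroup EM] [NormedSpace ℝ EM]
    [ChartedSpace EM N.constraintManifold] : Prop :=
  Manifold.IsSmoothEmbedding 𝓘(ℝ, EM) (𝓘(ℝ, E).prod 𝓘(ℝ, E →L[ℝ] ℝ)) ∞
    (Subtype.val : N.constraintManifold → CotangentBundle E Q)

variable {N} {EM : Type*} [NormedAddCommGroup EM] [NormedSpace ℝ EM]
  [ChartedSpace EM N.constraintManifold] [IsManifold 𝓘(ℝ, EM) ∞ N.constraintManifold]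

theorem contMDiff_tau (hM : N.IsEmbedded EM) : ContMDiff 𝓘(ℝ, EM) 𝓘(ℝ, E) ∞ N.tau :=
  contMDiff_proj_cotangentBundle.comp hM.contMDiff

theorem mfderiv_tau (hM : N.IsEmbedded EM) (m : N.constraintManifold) (v : TangentSpace 𝓘(ℝ, EM) m) :
    mfderiv 𝓘(ℝ, EM) 𝓘(ℝ, E) N.tau m v =
      mfderiv (𝓘(ℝ, E).prod 𝓘(ℝ, E →L[ℝ] ℝ)) 𝓘(ℝ, E) (fun p : CotangentBundle E Q => p.proj) m.1
        (mfderiv 𝓘(ℝ, EM) (𝓘(ℝ, E).prod 𝓘(ℝ, E →L[ℝ] ℝ)) Subtype.val m v) :=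
  mfderiv_comp_clm ((contMDiff_proj_cotangentBundle _).mdifferentiableAt (by simp))
    ((hM.contMDiff m).mdifferentiableAt (by simp)) v

theorem thetaM_apply (hM : N.IsEmbedded EM) (m : N.constraintManifold) (v : Fin 1 → TangentSpace 𝓘(ℝ, EM) m) :
    N.thetaM EM m v = m.1.2 (mfderiv 𝓘(ℝ, EM) 𝓘(ℝ, E) N.tau m (v 0)) :=
  congrArg m.1.2 (mfderiv_tau hM m (v 0)).symm

theorem thetaM_along (hM : N.IsEmbedded EM) {F : Type*} [NormedAddCommGroup F] [NormedSpace ℝ F]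
    {f : F → N.constraintManifold} {y : F} (hf : MDifferentiableAt 𝓘(ℝ, F) 𝓘(ℝ, EM) f y)
    (v : Fin 1 → F) : (N.thetaM EM).along f y v =
      (f y).1.2 (mfderiv 𝓘(ℝ, F) 𝓘(ℝ, E) (N.tau ∘ f) y (v 0)) :=
  (thetaM_apply hM (f y) fun i => mfderiv 𝓘(ℝ, F) 𝓘(ℝ, EM) f y (v i)).trans (congrArg (f y).1.2 (mfderiv_comp_clm
    ((contMDiff_tau hM _).mdifferentiableAt (by simp)) hf (v 0)).symm)

variable [FiniteDimensional ℝ E] [FiniteDimensional ℝ EM]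

theorem smooth_thetaM (hM : N.IsEmbedded EM) : (N.thetaM EM).Smooth :=
  smooth_liouvilleForm.pullback hM.contMDiff

theorem omegaM_eq (hM : N.IsEmbedded EM) : N.omegaM EM = fun m => -(N.thetaM EM).d m := by
  have h := smooth_liouvilleForm.d_pullback hM.contMDiff
  unfold thetaM omegaM
  rw [h]
  rfl

/-- Local parametrizations of the constraint manifold by a chart of `Q` and a frame of `D`. -/
theorem exists_localParam (hM : N.IsEmbedded EM) (m₀ : N.constraintManifold) :
    ∃ (r : ℕ) (Fr : E → EuclideanSpace ℝ (Fin r) →L[ℝ] E)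
      (Φ : E × EuclideanSpace ℝ (Fin r) → N.constraintManifold)
      (Ψ : N.constraintManifold → E × EuclideanSpace ℝ (Fin r)),
      ContMDiffAt 𝓘(ℝ, E × EuclideanSpace ℝ (Fin r)) 𝓘(ℝ, EM) ∞ Φ (Ψ m₀) ∧
      ContMDiffAt 𝓘(ℝ, EM) 𝓘(ℝ, E × EuclideanSpace ℝ (Fin r)) ∞ Ψ m₀ ∧
      (∀ᶠ m in 𝓝 m₀, Φ (Ψ m) = m) ∧ ContDiffAt ℝ ∞ Fr (Ψ m₀).1 ∧
      (Ψ m₀).1 ∈ (extChartAt 𝓘(ℝ, E) (N.tau m₀)).target ∧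
      (∀ᶠ z in 𝓝 (Ψ m₀).1, Function.Injective (Fr z) ∧ ∀ u, u ∈ Set.range (Fr z) ↔
          mfderiv 𝓘(ℝ, E) 𝓘(ℝ, E) (extChartAt 𝓘(ℝ, E) (N.tau m₀)).symm z u ∈
            N.D ((extChartAt 𝓘(ℝ, E) (N.tau m₀)).symm z)) ∧
      ∀ᶠ x in 𝓝 (Ψ m₀), (Φ x).1 = N.legendre ⟨(extChartAt 𝓘(ℝ, E) (N.tau m₀)).symm x.1,
        mfderiv 𝓘(ℝ, E) 𝓘(ℝ, E) (extChartAt 𝓘(ℝ, E) (N.tau m₀)).symm x.1 (Fr x.1 x.2)⟩ := by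
  set q₀ := N.tau m₀ with hq₀
  let χ := (extChartAt 𝓘(ℝ, E) q₀).symm
  let y₀ := extChartAt 𝓘(ℝ, E) q₀ q₀
  have hy₀ : y₀ ∈ (extChartAt 𝓘(ℝ, E) q₀).target := mem_extChartAt_target q₀
  obtain ⟨r, Fr, hFr, hfr⟩ := N.regular_D.exists_frame hy₀
  -- Sends frame coordinates of a velocity to the covector of its Legendre transform. Positivity of
  -- the metric makes it injective, so the smooth left inverse `l` recovers the coordinates from a
  -- point of M.
  let w : E → EuclideanSpace ℝ (Fin r) →L[ℝ] (E →L[ℝ] ℝ) := fun z => N.chartMetric q₀ z ∘L Fr z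
  have hw : ContDiffAt ℝ ∞ w y₀ := (N.contDiffAt_chartMetric hy₀).clm_comp hFr
  have hwinj : Function.Injective (w y₀) := by
    refine (injective_iff_map_eq_zero (w y₀)).2 fun c hc => ?_
    refine (injective_iff_map_eq_zero (Fr y₀)).1 hfr.self_of_nhds.1 c ?_
    exact N.chartMetric_definite hy₀ (DFunLike.congr_fun hc (Fr y₀ c))
  obtain ⟨l, hl, hlw⟩ := exists_smooth_leftInverse hw hwinj
  let κ : N.constraintManifold → E := fun m => extChartAt 𝓘(ℝ, E) q₀ (N.tau m)
  have hκ : ContMDiffAt 𝓘(ℝ, EM) 𝓘(ℝ, E) ∞ κ m₀ :=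
    (contMDiffAt_extChartAt_of_mem (mem_extChartAt_source q₀)).comp m₀ (contMDiff_tau hM m₀)
  let T : E → E →L[ℝ] E := fun z => mfderiv 𝓘(ℝ, E) 𝓘(ℝ, E) χ z
  let ℓ : N.constraintManifold → E →L[ℝ] ℝ := fun m => (m.1.2 : E →L[ℝ] ℝ) ∘L T (κ m)
  have hsrc : ∀ᶠ m in 𝓝 m₀, N.tau m ∈ (extChartAt 𝓘(ℝ, E) q₀).source :=
    (contMDiff_tau hM).continuous.continuousAt.preimage_mem_nhds
      ((isOpen_extChartAt_source q₀).mem_nhds (mem_extChartAt_source q₀))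
  have hℓ : ContMDiffAt 𝓘(ℝ, EM) 𝓘(ℝ, E →L[ℝ] ℝ) ∞ ℓ m₀ := by
    refine contMDiffAt_clm_of_apply fun b => ?_
    refine contMDiffAt_pairing (b := N.tau) (p := fun m => m.1.2) (v := fun m => T (κ m) b)
      (hM.contMDiff m₀) ?_
    have h1 := contMDiffAt_mfderiv_along (f := χ) (h := κ) (ζ := fun _ => b)
      (contMDiffAt_extChartAt_symm (I := 𝓘(ℝ, E)) (x₀ := q₀) hy₀) hκ contMDiffAt_const
    refine h1.congr_of_eventuallyEq ?_
    filter_upwards [hsrc] with m hm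
    exact congrArg (fun q => (⟨q, (T (κ m) b : E)⟩ : TangentBundle 𝓘(ℝ, E) Q))
      ((extChartAt 𝓘(ℝ, E) q₀).left_inv hm).symm
  let Ψ : N.constraintManifold → E × EuclideanSpace ℝ (Fin r) := fun m => (κ m, l (κ m) (ℓ m))
  let V : E × EuclideanSpace ℝ (Fin r) → TangentBundle 𝓘(ℝ, E) Q := fun x =>
    ⟨χ x.1, mfderiv 𝓘(ℝ, E) 𝓘(ℝ, E) χ x.1 (Fr x.1 x.2)⟩
  let Φ : E × EuclideanSpace ℝ (Fin r) → N.constraintManifold := fun x => N.ofVelocity (V x)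
  have hΦ : ∀ᶠ x in 𝓝 (Ψ m₀), (Φ x).1 = N.legendre (V x) := by
    have := (continuous_fst.tendsto (Ψ m₀)).eventually (p := fun z => _) hfr
    filter_upwards [this] with x hx
    exact N.val_ofVelocity ((hx.2 _).1 ⟨_, rfl⟩)
  refine ⟨r, Fr, Φ, Ψ, ?_, ?_, ?_, hFr, hy₀, hfr, hΦ⟩
  · refine hM.contMDiffAt_of_comp (ContMDiffAt.congr_of_eventuallyEq ?_ hΦ)
    refine (N.contMDiff_legendre _).comp (Ψ m₀) ?_
    refine contMDiffAt_mfderiv_along (f := χ) (h := fun x : E × EuclideanSpace ℝ (Fin r) => x.1)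
      (ζ := fun x => Fr x.1 x.2) (contMDiffAt_extChartAt_symm (I := 𝓘(ℝ, E)) (x₀ := q₀) hy₀)
      contDiff_fst.contMDiff.contMDiffAt ?_
    exact ((ContDiffAt.comp (g := Fr) (f := Prod.fst) (Ψ m₀) hFr contDiffAt_fst).clm_apply
      contDiffAt_snd).contMDiffAt
  · exact hκ.prodMk_space ((ContMDiffAt.comp (g := l) m₀ hl.contMDiffAt hκ).clm_apply hℓ)
  · have e1 := hκ.continuousAt.eventually (p := fun z => _) hfr
    have e2 := hκ.continuousAt.eventually (p := fun z => _) hlw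
    filter_upwards [hsrc, e1, e2] with m hm h1 h2
    obtain ⟨u, hu, hum⟩ := N.exists_velocity m (χ (κ m)) ((extChartAt 𝓘(ℝ, E) q₀).left_inv hm)
    have hκt : κ m ∈ (extChartAt 𝓘(ℝ, E) q₀).target := (extChartAt 𝓘(ℝ, E) q₀).map_source hm
    have hTu := mfderiv_symm_extChartAt_apply (I := 𝓘(ℝ, E)) hκt u
    obtain ⟨c, hc⟩ := (h1.2 (mfderiv 𝓘(ℝ, E) 𝓘(ℝ, E) (extChartAt 𝓘(ℝ, E) q₀) (χ (κ m)) u)).2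
      (by rw [hTu]; exact hu)
    have hTc : mfderiv 𝓘(ℝ, E) 𝓘(ℝ, E) χ (κ m) (Fr (κ m) c) = u := (congrArg _ hc).trans hTu
    have hℓm : ℓ m = w (κ m) c := by
      have h3 := (congrArg covector hum).symm
      ext b
      refine (DFunLike.congr_fun h3 (T (κ m) b)).trans ?_
      exact congrArg (fun u => N.metric.inner (χ (κ m)) u (T (κ m) b)) hTc.symm
    have hlc : l (κ m) (ℓ m) = c := by rw [hℓm]; exact h2 c
    have hVm : V (Ψ m) = ⟨χ (κ m), u⟩ := by
      simp only [V, Ψ, hlc]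
      exact congrArg (Bundle.TotalSpace.mk (χ (κ m))) hTc
    apply Subtype.ext
    simp only [Φ]
    rw [hVm, N.val_ofVelocity (v := ⟨χ (κ m), u⟩) hu]
    exact hum

end NonholonomicSystem

namespace NonholonomicSystem

variable {E : Type*} [NormedAddCommGroup E] [NormedSpace ℝ E] [FiniteDimensional ℝ E]
  {Q : Type*} [TopologicalSpace Q] [ChartedSpace E Q] [IsManifold 𝓘(ℝ, E) ∞ Q]
  {N : NonholonomicSystem E Q}
  {EM : Type*} [NormedAddCommGroup EM] [NormedSpace ℝ EM] [FiniteDimensional ℝ EM]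
  [ChartedSpace EM N.constraintManifold] [IsManifold 𝓘(ℝ, EM) ∞ N.constraintManifold]

/-- In a local parametrization the velocity is a combination of frame fields with smooth
coefficients; the Legendre transform is injective, so this is the chosen `velocity`. -/
theorem contMDiff_velocity (hM : N.IsEmbedded EM) : ContMDiff 𝓘(ℝ, EM) 𝓘(ℝ, E).tangent ∞
    (fun m => (⟨N.tau m, N.velocity m⟩ : TangentBundle 𝓘(ℝ, E) Q)) := by
  intro m₀
  obtain ⟨r, Fr, Φ, Ψ, hΦ, hΨ, hΦΨ, hFr, hy, hfr, hΦv⟩ := exists_localParam hM m₀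
  have h1 : ContMDiffAt 𝓘(ℝ, EM) 𝓘(ℝ, E) ∞ (fun m => (Ψ m).1) m₀ :=
    contDiff_fst.contMDiff.contMDiffAt.comp m₀ hΨ
  have h2 : ContMDiffAt 𝓘(ℝ, EM) 𝓘(ℝ, EuclideanSpace ℝ (Fin r)) ∞ (fun m => (Ψ m).2) m₀ :=
    contDiff_snd.contMDiff.contMDiffAt.comp m₀ hΨ
  have h3 := contMDiffAt_mfderiv_along (f := (extChartAt 𝓘(ℝ, E) (N.tau m₀)).symm)
    (h := fun m => (Ψ m).1) (ζ := fun m => Fr (Ψ m).1 (Ψ m).2)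
    (contMDiffAt_extChartAt_symm (I := 𝓘(ℝ, E)) hy) h1
    ((ContMDiffAt.comp (g := Fr) m₀ hFr.contMDiffAt h1).clm_apply h2)
  refine h3.congr_of_eventuallyEq ?_
  filter_upwards [hΦΨ, hΨ.continuousAt.eventually hΦv] with m hm1 hm2
  apply N.legendre_injective
  rw [N.legendre_velocity, ← hm2, hm1]

/-- `Ω_M` is nondegenerate on `C`. -/
theorem omegaM_nondegenerate (hM : N.IsEmbedded EM) (m₀ : N.constraintManifold)
    {X : TangentSpace 𝓘(ℝ, EM) m₀} (hX : X ∈ N.distC EM m₀)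
    (h : ∀ Y ∈ N.distC EM m₀, N.omegaM EM m₀ ![X, Y] = 0) : X = 0 := by
  obtain ⟨r, Fr, Φ, Ψ, hΦ, hΨ, hΦΨ, hFr, hy, hfr, hΦv⟩ := exists_localParam hM m₀
  set x₀ := Ψ m₀ with hx₀
  set χ := (extChartAt 𝓘(ℝ, E) (N.tau m₀)).symm with hχ
  have hm₀ : Φ x₀ = m₀ := hΦΨ.self_of_nhds
  have hdΦ := hΦ.mdifferentiableAt (by simp)
  let T : E × EuclideanSpace ℝ (Fin r) → EM := fun a =>
    mfderiv 𝓘(ℝ, E × EuclideanSpace ℝ (Fin r)) 𝓘(ℝ, EM) Φ x₀ a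
  have hT0 : T 0 = 0 :=
    map_zero (mfderiv 𝓘(ℝ, E × EuclideanSpace ℝ (Fin r)) 𝓘(ℝ, EM) Φ x₀)
  have hsurj : ∀ Y : EM, ∃ a, T a = Y := fun Y => by
    refine ⟨mfderiv 𝓘(ℝ, EM) 𝓘(ℝ, E × EuclideanSpace ℝ (Fin r)) Ψ m₀ Y, ?_⟩
    refine (mfderiv_comp_clm (f := Ψ) (g := Φ) (x := m₀) hdΦ
      (hΨ.mdifferentiableAt (by simp)) Y).symm.trans ?_
    have : Φ ∘ Ψ =ᶠ[𝓝 m₀] id := hΦΨ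
    rw [this.mfderiv_eq, mfderiv_id]
    rfl
  have hτΦ : N.tau ∘ Φ =ᶠ[𝓝 x₀] χ ∘ Prod.fst := by
    filter_upwards [hΦv] with x hx
    exact congrArg (fun p : CotangentBundle E Q => p.proj) hx
  have hdχ := (contMDiffAt_extChartAt_symm (I := 𝓘(ℝ, E)) hy).mdifferentiableAt (by simp)
  have hτT : ∀ x, N.tau ∘ Φ =ᶠ[𝓝 x] χ ∘ Prod.fst →
      x.1 ∈ (extChartAt 𝓘(ℝ, E) (N.tau m₀)).target → ∀ a : E × EuclideanSpace ℝ (Fin r),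
      (mfderiv 𝓘(ℝ, E × EuclideanSpace ℝ (Fin r)) 𝓘(ℝ, E) (N.tau ∘ Φ) x a : E) =
        mfderiv 𝓘(ℝ, E) 𝓘(ℝ, E) χ x.1 a.1 := by
    intro x hx hxt a
    rw [hx.mfderiv_eq]
    refine (mfderiv_comp_clm (f := Prod.fst) (g := χ)
      ((contMDiffAt_extChartAt_symm (I := 𝓘(ℝ, E)) hxt).mdifferentiableAt (by simp))
      differentiableAt_fst.mdifferentiableAt a).trans ?_
    rw [mfderiv_eq_fderiv, fderiv_fst]
    rfl
  have hTC : ∀ a, T a ∈ N.distC EM (Φ x₀) ↔ a.1 ∈ Set.range (Fr x₀.1) := by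
    intro a
    rw [hfr.self_of_nhds.2]
    have e : mfderiv 𝓘(ℝ, EM) 𝓘(ℝ, E) N.tau (Φ x₀) (T a) =
        (mfderiv 𝓘(ℝ, E) 𝓘(ℝ, E) χ x₀.1 a.1 : E) :=
      (mfderiv_comp_clm ((contMDiff_tau hM _).mdifferentiableAt (by simp)) hdΦ a).symm.trans
        (hτT x₀ hτΦ hy a)
    have e2 : ∀ q q' : Q, q = q' → ∀ u : E, (u ∈ N.D q ↔ u ∈ N.D q') := by
      rintro q _ rfl u; rfl
    refine Iff.trans ?_ (e2 _ _ hτΦ.self_of_nhds _)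
    exact Iff.of_eq (congrArg (fun u : E => u ∈ N.D (N.tau (Φ x₀))) e)
  let ϑ := (N.thetaM EM).along Φ
  have hϑs : ContDiffAt ℝ ∞ ϑ x₀ := (smooth_thetaM hM).along hΦ
  let K := N.chartMetric (N.tau m₀)
  have hK := N.contDiffAt_chartMetric hy
  -- In coordinates (z, c) the Liouville form is κ(Fr(z)c, dz), with no dc-component.
  have hϑ : ∀ a : E × EuclideanSpace ℝ (Fin r), ∀ᶠ x in 𝓝 x₀,
      ϑ x ![a] = K x.1 (Fr x.1 x.2) a.1 := by
    intro a
    have ht : ∀ᶠ x : E × EuclideanSpace ℝ (Fin r) in 𝓝 x₀,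
        x.1 ∈ (extChartAt 𝓘(ℝ, E) (N.tau m₀)).target :=
      (continuous_fst.tendsto x₀).eventually
        ((isOpen_extChartAt_target (I := 𝓘(ℝ, E)) _).mem_nhds hy)
    filter_upwards [hΦv, hΦ.eventually_mdifferentiableAt (by simp), hτΦ.eventually_nhds, ht]
      with x h1 h2 h3 h4
    refine (thetaM_along hM h2 ![a]).trans ?_
    refine (congrArg (covector (Φ x).1) (hτT x h3 h4 a)).trans ?_
    exact DFunLike.congr_fun (congrArg covector h1) _
  let R := EuclideanSpace ℝ (Fin r)
  -- Only the derivative in a fibre direction contributes, and it is elementary because the fibre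
  -- coordinate enters linearly; derivatives of the metric and of the frame do not appear.
  have hΩ : ∀ (γ : R) (b : E × R),
      N.omegaM EM (Φ x₀) ![T (0, γ), T b] = -K x₀.1 (Fr x₀.1 γ) b.1 := by
    intro γ b
    have e1 : N.omegaM EM (Φ x₀) ![T (0, γ), T b] = -extDeriv ϑ x₀ ![(0, γ), b] := by
      rw [omegaM_eq hM, (smooth_thetaM hM).extDeriv_along hΦ]
      refine congrArg (fun v => -(N.thetaM EM).d (Φ x₀) v) ?_
      ext i; fin_cases i <;> rfl
    rw [e1, extDeriv_one_apply (hϑs.differentiableAt (by simp)), Filter.EventuallyEq.fderiv_eq (hϑ b),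
      Filter.EventuallyEq.fderiv_eq (hϑ (0, γ))]
    simp only [map_zero]
    have hd : DifferentiableAt ℝ (fun x : E × R => K x.1 (Fr x.1 x.2) b.1) x₀ := by
      have h1 : DifferentiableAt ℝ (fun x : E × R => K x.1) x₀ :=
        DifferentiableAt.comp (g := K) (f := Prod.fst) x₀ (hK.differentiableAt (by simp))
          differentiableAt_fst
      have h2 : DifferentiableAt ℝ (fun x : E × R => Fr x.1) x₀ :=
        DifferentiableAt.comp (g := Fr) (f := Prod.fst) x₀ (hFr.differentiableAt (by simp))
          differentiableAt_fst
      exact (h1.clm_apply (h2.clm_apply differentiableAt_snd)).clm_apply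
        (differentiableAt_const _)
    have e3 : fderiv ℝ (fun x : E × R => K x.1 (Fr x.1 x.2) b.1) x₀ (0, γ) =
        K x₀.1 (Fr x₀.1 γ) b.1 := by
      rw [← hd.lineDeriv_eq_fderiv, lineDeriv]
      have e4 : ∀ t : ℝ, K (x₀ + t • ((0, γ) : E × R)).1 (Fr (x₀ + t • ((0, γ) : E × R)).1
          (x₀ + t • ((0, γ) : E × R)).2) b.1 =
          K x₀.1 (Fr x₀.1 x₀.2) b.1 + t * K x₀.1 (Fr x₀.1 γ) b.1 := fun t => by
        simp
      simp only [e4]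
      simp
    rw [e3]
    simp
  -- A vector (ζ, γ) of C has ζ = Fr(e). Testing against (0, e) gives κ(ζ, ζ) = 0; testing what is
  -- left against (Fr(γ), 0) gives Fr(γ) = 0.
  have key : ∀ X ∈ N.distC EM (Φ x₀), (∀ Y ∈ N.distC EM (Φ x₀), N.omegaM EM (Φ x₀) ![X, Y] = 0) →
      X = 0 := by
    intro X hX h
    obtain ⟨⟨ζ, γ⟩, rfl⟩ := hsurj X
    obtain ⟨e, he⟩ := (hTC _).1 hX
    have h1 := h (T (0, e)) ((hTC _).2 ⟨0, map_zero _⟩)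
    rw [alternating_swap, hΩ, neg_neg, he] at h1
    obtain rfl : ζ = 0 := N.chartMetric_definite hy h1
    have h2 := h (T (Fr x₀.1 γ, 0)) ((hTC _).2 ⟨γ, rfl⟩)
    rw [hΩ, neg_eq_zero] at h2
    have h3 := (injective_iff_map_eq_zero (Fr x₀.1)).1 hfr.self_of_nhds.1 γ
      (N.chartMetric_definite hy h2)
    rw [h3]
    exact hT0
  have transfer : ∀ m, m = m₀ → (∀ X ∈ N.distC EM m,
      (∀ Y ∈ N.distC EM m, N.omegaM EM m ![X, Y] = 0) → X = 0) →
      ∀ X ∈ N.distC EM m₀, (∀ Y ∈ N.distC EM m₀, N.omegaM EM m₀ ![X, Y] = 0) → X = 0 := by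
    rintro _ rfl h
    exact h
  exact transfer _ hm₀ key X hX h

end NonholonomicSystem

/-! ### The group action on the constraint manifold -/

namespace NonholonomicSystem

variable {E : Type*} [NormedAddCommGroup E] [NormedSpace ℝ E] [FiniteDimensional ℝ E]
  {Q : Type*} [TopologicalSpace Q] [ChartedSpace E Q] [IsManifold 𝓘(ℝ, E) ∞ Q]
  {N : NonholonomicSystem E Q}
  {EM : Type*} [NormedAddCommGroup EM] [NormedSpace ℝ EM] [FiniteDimensional ℝ EM]
  [ChartedSpace EM N.constraintManifold] [IsManifold 𝓘(ℝ, EM) ∞ N.constraintManifold]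
  {EG : Type*} [NormedAddCommGroup EG] [NormedSpace ℝ EG] [FiniteDimensional ℝ EG]
  {G : Type*} [TopologicalSpace G] [ChartedSpace EG G] [Group G] [LieGroup 𝓘(ℝ, EG) ∞ G]
  [MulAction G Q] [ContMDiffSMul 𝓘(ℝ, EG) 𝓘(ℝ, E) ∞ G Q] [hG : N.IsSymmetry G]

/-- Invariance of the metric makes the Legendre transform equivariant, which turns the cotangent
lift on M into the tangent lift on velocities. -/
theorem cotangentLift_legendre (g : G) (v : TangentBundle 𝓘(ℝ, E) Q) :
    cotangentLift G g (N.legendre v) =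
      N.legendre (tangentMap 𝓘(ℝ, E) 𝓘(ℝ, E) (fun q : Q => g • q) v) := by
  obtain ⟨e, he⟩ := hG.isInvertible_mfderiv_smul g v.proj
  unfold legendre cotangentLift tangentMap
  congr 1
  ext w
  have h := hG.metric_invariant g v.proj v.2 (e.symm w)
  rw [← he] at h ⊢
  simpa using h.symm

theorem val_smul (g : G) (m : N.constraintManifold) :
    (g • m).1 = N.legendre ⟨g • N.tau m,
      mfderiv 𝓘(ℝ, E) 𝓘(ℝ, E) (fun q : Q => g • q) (N.tau m) (N.velocity m)⟩ := by
  change cotangentLift G g m.1 = _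
  rw [← N.legendre_velocity m, cotangentLift_legendre]
  rfl

/-- On velocities the action is v ↦ Tg(v), the partial tangent map of the smooth action on Q. The
inverse of Tg in the cotangent lift thus needs no separate treatment. -/
theorem contMDiff_action (hM : N.IsEmbedded EM) :
    ContMDiff (𝓘(ℝ, EG).prod 𝓘(ℝ, EM)) 𝓘(ℝ, EM) ∞
      (fun p : G × N.constraintManifold => p.1 • p.2) := by
  have hm1 : IsManifold 𝓘(ℝ, EG) 1 G := IsManifold.of_le (n := ∞) (by simp)
  intro p
  refine hM.contMDiffAt_of_comp ?_
  have h1 : ContMDiffAt (𝓘(ℝ, EG).prod 𝓘(ℝ, EM)) 𝓘(ℝ, EG).tangent ∞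
      (fun p : G × N.constraintManifold => (⟨p.1, 0⟩ : TangentBundle 𝓘(ℝ, EG) G)) p :=
    (Bundle.contMDiff_zeroSection (n := ∞) ℝ (TangentSpace 𝓘(ℝ, EG) (M := G)) _).comp p
      contMDiffAt_fst
  have h2 := contMDiffAt_partial_mfderiv (a := fun (g : G) (q : Q) => g • q)
    (contMDiff_smul (I := 𝓘(ℝ, EG)) (I' := 𝓘(ℝ, E)) (n := ∞)) h1
    ((contMDiff_velocity hM p.2).comp p contMDiffAt_snd)
  refine ((N.contMDiff_legendre _).comp p h2).congr_of_eventuallyEq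
    (Filter.Eventually.of_forall fun x => ?_)
  refine (val_smul x.1 x.2).trans ?_
  refine congrArg (fun u : E => N.legendre ⟨x.1 • N.tau x.2, u⟩) ?_
  refine (zero_add _).symm.trans (congrArg (fun u : E => u + _) ?_)
  exact (map_zero (mfderiv 𝓘(ℝ, EG) 𝓘(ℝ, E) (fun h : G => h • N.tau x.2) x.1)).symm

theorem contMDiff_smul_left (hM : N.IsEmbedded EM) (g : G) :
    ContMDiff 𝓘(ℝ, EM) 𝓘(ℝ, EM) ∞ (fun m : N.constraintManifold => g • m) := by
  intro m
  refine hM.contMDiffAt_of_comp ?_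
  exact ((N.contMDiff_legendre _).comp m ((contMDiffAt_tangentMap
    (hG.contMDiff_smul g (N.tau m))).comp m (contMDiff_velocity hM m))).congr_of_eventuallyEq
    (Filter.Eventually.of_forall fun m => val_smul g m)

theorem contMDiff_smul_right (hM : N.IsEmbedded EM) (m : N.constraintManifold) :
    ContMDiff 𝓘(ℝ, EG) 𝓘(ℝ, EM) ∞ (fun g : G => g • m) :=
  (contMDiff_action hM).comp (contMDiff_id.prodMk contMDiff_const)

theorem mfderiv_tau_smul (hM : N.IsEmbedded EM) (g : G) (m : N.constraintManifold)
    (v : TangentSpace 𝓘(ℝ, EM) m) :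
    mfderiv 𝓘(ℝ, EM) 𝓘(ℝ, E) N.tau (g • m)
      (mfderiv 𝓘(ℝ, EM) 𝓘(ℝ, EM) (fun m : N.constraintManifold => g • m) m v) =
    mfderiv 𝓘(ℝ, E) 𝓘(ℝ, E) (fun q : Q => g • q) (N.tau m)
      (mfderiv 𝓘(ℝ, EM) 𝓘(ℝ, E) N.tau m v) :=
  (mfderiv_comp_clm (f := fun m : N.constraintManifold => g • m)
    ((contMDiff_tau hM _).mdifferentiableAt (by simp))
    ((contMDiff_smul_left hM g m).mdifferentiableAt (by simp)) v).symm.trans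
  (mfderiv_comp_clm (g := fun q : Q => g • q) (hG.mdifferentiableAt_smul g (N.tau m))
    ((contMDiff_tau hM _).mdifferentiableAt (by simp)) v)

/-- The projection τ is equivariant, and the inverse of Tg in the cotangent lift cancels Tg. -/
theorem thetaM_invariant (hM : N.IsEmbedded EM) : (N.thetaM EM).Invariant G := by
  intro g
  funext m
  ext v
  refine (thetaM_apply hM (g • m) fun i => mfderiv 𝓘(ℝ, EM) 𝓘(ℝ, EM)
    (fun m : N.constraintManifold => g • m) m (v i)).trans ?_
  rw [thetaM_apply hM]
  refine (congrArg (covector (g • m).1) (mfderiv_tau_smul hM g m (v 0))).trans ?_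
  obtain ⟨e, he⟩ := hG.isInvertible_mfderiv_smul g (N.tau m)
  refine congrArg m.1.2 ?_
  change ContinuousLinearMap.inverse (mfderiv 𝓘(ℝ, E) 𝓘(ℝ, E) (fun q : Q => g • q) (N.tau m))
    (mfderiv 𝓘(ℝ, E) 𝓘(ℝ, E) (fun q : Q => g • q) (N.tau m) _) = _
  rw [← he]
  simp

theorem omegaM_invariant (hM : N.IsEmbedded EM) : (N.omegaM EM).Invariant G := by
  intro g
  have h1 := (smooth_thetaM hM).d_pullback (contMDiff_smul_left hM g)
  rw [thetaM_invariant hM g] at h1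
  rw [omegaM_eq hM]
  funext m
  exact congrArg (fun w : Form 𝓘(ℝ, EM) N.constraintManifold ℝ 2 => -w m) h1.symm

theorem distC_smul (hM : N.IsEmbedded EM) (g : G) {m : N.constraintManifold}
    {v : TangentSpace 𝓘(ℝ, EM) m} (hv : v ∈ N.distC EM m) :
    mfderiv 𝓘(ℝ, EM) 𝓘(ℝ, EM) (fun m : N.constraintManifold => g • m) m v ∈
      N.distC EM (g • m) := by
  have h := hG.constraint_invariant g _ _ hv
  have e := mfderiv_tau_smul hM g m v
  exact (congrArg (fun u => u ∈ N.D (g • N.tau m)) e).mpr h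

/-- Both sides are the derivative at 1 of h ↦ (g h) · m. -/
theorem mfderiv_smul_generator (hM : N.IsEmbedded EM) (g : G) (m : N.constraintManifold)
    (ξ : EG) : mfderiv 𝓘(ℝ, EM) 𝓘(ℝ, EM) (fun m : N.constraintManifold => g • m) m
      (N.generator EM EG G m ξ) =
    mfderiv 𝓘(ℝ, EG) 𝓘(ℝ, EM) (fun h : G => h • m) g
      (mfderiv 𝓘(ℝ, EG) 𝓘(ℝ, EG) (fun h : G => g * h) 1 ξ : EG) := by
  have h1 := mfderiv_comp_clm (I := 𝓘(ℝ, EG)) (f := fun h : G => h • m)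
    (g := fun m : N.constraintManifold => g • m) (x := 1)
    ((contMDiff_smul_left hM g _).mdifferentiableAt (by simp))
    ((contMDiff_smul_right hM m _).mdifferentiableAt (by simp)) ξ
  have h2 := mfderiv_comp_clm (I := 𝓘(ℝ, EG)) (f := fun h : G => g * h)
    (g := fun h : G => h • m) (x := 1)
    ((contMDiff_smul_right hM m _).mdifferentiableAt (by simp))
    ((contMDiff_mul_left (I := 𝓘(ℝ, EG)) (n := ∞) (a := g) _).mdifferentiableAt (by simp)) ξ
  have e : (fun m : N.constraintManifold => g • m) ∘ (fun h : G => h • m) =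
      (fun h : G => h • m) ∘ (fun h : G => g * h) := by
    funext h; exact (mul_smul g h m).symm
  -- The points 1 • m and m are equal without being the same expression, so derivatives at them are
  -- compared as vectors of the model space.
  have tr1 : ∀ m' : N.constraintManifold, m' = m → ∀ u : EM, (mfderiv 𝓘(ℝ, EM) 𝓘(ℝ, EM)
      (fun m : N.constraintManifold => g • m) m' u : EM) =
      (mfderiv 𝓘(ℝ, EM) 𝓘(ℝ, EM) (fun m : N.constraintManifold => g • m) m u : EM) := by
    rintro _ rfl u; rfl
  have tr2 : ∀ g' : G, g' = g → ∀ u : EG, (mfderiv 𝓘(ℝ, EG) 𝓘(ℝ, EM)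
      (fun h : G => h • m) g' u : EM) =
      (mfderiv 𝓘(ℝ, EG) 𝓘(ℝ, EM) (fun h : G => h • m) g u : EM) := by
    rintro _ rfl u; rfl
  refine (tr1 _ (one_smul G m) _).symm.trans (Eq.trans ?_ (tr2 _ (mul_one g) _))
  exact h1.symm.trans ((congrArg (fun f => (mfderiv 𝓘(ℝ, EG) 𝓘(ℝ, EM) f 1 ξ : EM)) e).trans h2)

end NonholonomicSystem

/-! ### Infinitesimal generators and the momentum map -/

section PartialDerivatives

variable {E F V : Type*} [NormedAddCommGroup E] [NormedSpace ℝ E] [NormedAddCommGroup F]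
  [NormedSpace ℝ F] [NormedAddCommGroup V] [NormedSpace ℝ V]

theorem fderiv_inl_eq {f : E × F → V} {a : E} {b : F} (hf : DifferentiableAt ℝ f (a, b)) (u : E) :
    fderiv ℝ f (a, b) (u, 0) = fderiv ℝ (fun x => f (x, b)) a u := by
  have h := hf.hasFDerivAt.comp a (hasFDerivAt_prodMk_left (𝕜 := ℝ) a b)
  exact (DFunLike.congr_fun h.fderiv u).symm

theorem fderiv_inr_eq {f : E × F → V} {a : E} {b : F} (hf : DifferentiableAt ℝ f (a, b)) (u : F) :
    fderiv ℝ f (a, b) (0, u) = fderiv ℝ (fun x => f (a, x)) b u := by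
  have h := hf.hasFDerivAt.comp b (hasFDerivAt_prodMk_right (𝕜 := ℝ) a b)
  exact (DFunLike.congr_fun h.fderiv u).symm

end PartialDerivatives

section PullbackApply

variable {E : Type*} [NormedAddCommGroup E] [NormedSpace ℝ E]
  {H : Type*} [TopologicalSpace H] {I : ModelWithCorners ℝ E H}
  {E' : Type*} [NormedAddCommGroup E'] [NormedSpace ℝ E']
  {H' : Type*} [TopologicalSpace H'] {I' : ModelWithCorners ℝ E' H'}
  {P : Type*} [TopologicalSpace P] [ChartedSpace H P]
  {P' : Type*} [TopologicalSpace P'] [ChartedSpace H' P']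
  {V : Type*} [NormedAddCommGroup V] [NormedSpace ℝ V]

theorem Form.pullback_apply {k : ℕ} (f : P → P') (w : Form I' P' V k) (x : P)
    (v : Fin k → TangentSpace I x) :
    w.pullback I f x v = w (f x) (fun i => mfderiv I I' f x (v i)) := rfl

end PullbackApply

namespace NonholonomicSystem

variable {E : Type*} [NormedAddCommGroup E] [NormedSpace ℝ E] [FiniteDimensional ℝ E]
  {Q : Type*} [TopologicalSpace Q] [ChartedSpace E Q] [IsManifold 𝓘(ℝ, E) ∞ Q]
  {N : NonholonomicSystem E Q}
  {EM : Type*} [NormedAddCommGroup EM] [NormedSpace ℝ EM] [FiniteDimensional ℝ EM]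
  [ChartedSpace EM N.constraintManifold] [IsManifold 𝓘(ℝ, EM) ∞ N.constraintManifold]
  {EG : Type*} [NormedAddCommGroup EG] [NormedSpace ℝ EG] [FiniteDimensional ℝ EG]
  {G : Type*} [TopologicalSpace G] [ChartedSpace EG G] [Group G] [LieGroup 𝓘(ℝ, EG) ∞ G]
  [MulAction G Q] [ContMDiffSMul 𝓘(ℝ, EG) 𝓘(ℝ, E) ∞ G Q] [hG : N.IsSymmetry G]

variable (G) in
-- The generator is the tangent map of the joint action on the pair consisting of ξ at 1 and the
-- zero vector at m.
theorem contMDiff_generator (hM : N.IsEmbedded EM) (ξ : EG) :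
    ContMDiff 𝓘(ℝ, EM) 𝓘(ℝ, EM).tangent ∞ (fun m : N.constraintManifold =>
      (⟨m, N.generator EM EG G m ξ⟩ : TangentBundle 𝓘(ℝ, EM) N.constraintManifold)) := by
  intro m
  have h1 := contMDiffAt_partial_mfderiv (a := fun (g : G) (m : N.constraintManifold) => g • m)
    (I'' := 𝓘(ℝ, EM)) (x := m) (contMDiff_action hM)
    (g := fun _ : N.constraintManifold => (⟨1, ξ⟩ : TangentBundle 𝓘(ℝ, EG) G)) contMDiffAt_const
    (Bundle.contMDiff_zeroSection (n := ∞) ℝ (TangentSpace 𝓘(ℝ, EM) (M := N.constraintManifold)) m)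
  refine h1.congr_of_eventuallyEq (Filter.Eventually.of_forall fun m => ?_)
  have e : (N.generator EM EG G m ξ : EM) = (mfderiv 𝓘(ℝ, EG) 𝓘(ℝ, EM) (fun g : G => g • m) 1 ξ +
      mfderiv 𝓘(ℝ, EM) 𝓘(ℝ, EM) (fun m : N.constraintManifold => (1 : G) • m) m 0 : EM) := by
    refine (add_zero _).symm.trans (congrArg (fun u : EM => _ + u) ?_)
    exact (map_zero (mfderiv 𝓘(ℝ, EM) 𝓘(ℝ, EM)
      (fun m : N.constraintManifold => (1 : G) • m) m)).symm
  refine (congrArg (Bundle.TotalSpace.mk m) e).trans ?_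
  exact congrArg (fun m' => (⟨m', (mfderiv 𝓘(ℝ, EG) 𝓘(ℝ, EM) (fun g : G => g • m) 1 ξ +
      mfderiv 𝓘(ℝ, EM) 𝓘(ℝ, EM) (fun m : N.constraintManifold => (1 : G) • m) m 0 : EM)⟩ :
      TangentBundle 𝓘(ℝ, EM) N.constraintManifold)) (one_smul G m).symm

theorem momentum_apply (m : N.constraintManifold) (ξ : EG) :
    N.momentum EM EG G m ξ = N.thetaM EM m ![N.generator EM EG G m ξ] := by
  change N.thetaM EM m (fun _ => N.generator EM EG G m ξ) = _
  congr 1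
  ext i; fin_cases i; rfl

variable (EG G) in
theorem contMDiff_momentum (hM : N.IsEmbedded EM) :
    ContMDiff 𝓘(ℝ, EM) 𝓘(ℝ, EG →L[ℝ] ℝ) ∞ (N.momentum EM EG G) := by
  intro m
  refine contMDiffAt_clm_of_apply fun ξ => ?_
  have h1 := (contMDiffAt_tangentMap (v := ⟨m, N.generator EM EG G m ξ⟩) (contMDiff_tau hM m)).comp
    m (contMDiff_generator G hM ξ m)
  refine (contMDiffAt_pairing (b := N.tau) (p := fun m => m.1.2)
    (v := fun m => mfderiv 𝓘(ℝ, EM) 𝓘(ℝ, E) N.tau m (N.generator EM EG G m ξ))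
    (hM.contMDiff m) h1).congr_of_eventuallyEq (Filter.Eventually.of_forall fun m => ?_)
  exact (momentum_apply m ξ).trans (thetaM_apply hM m _)

variable (N EM EG G) in
/-- The differential of the momentum map. -/
def dMomentum (m : N.constraintManifold) : TangentSpace 𝓘(ℝ, EM) m →L[ℝ] (EG →L[ℝ] ℝ) :=
  mfderiv 𝓘(ℝ, EM) 𝓘(ℝ, EG →L[ℝ] ℝ) (N.momentum EM EG G) m

/-- `i_{ξ_M} Ω_M = d⟨J, ξ⟩`. -/
theorem omegaM_generator (hM : N.IsEmbedded EM) (m : N.constraintManifold) (ξ : EG)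
    (v : TangentSpace 𝓘(ℝ, EM) m) : N.omegaM EM m ![N.generator EM EG G m ξ, v] =
      N.dMomentum EM EG G m v ξ := by
  let γ := (extChartAt 𝓘(ℝ, EG) (1 : G)).symm
  let h₀ := extChartAt 𝓘(ℝ, EG) (1 : G) 1
  let ψ := (extChartAt 𝓘(ℝ, EM) m).symm
  let x₀ := extChartAt 𝓘(ℝ, EM) m m
  let η : EG := mfderiv 𝓘(ℝ, EG) 𝓘(ℝ, EG) (extChartAt 𝓘(ℝ, EG) (1 : G)) 1 ξ
  let ζ : EM := mfderiv 𝓘(ℝ, EM) 𝓘(ℝ, EM) (extChartAt 𝓘(ℝ, EM) m) m v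
  have hγ0 : γ h₀ = 1 := extChartAt_to_inv _
  have hψ0 : ψ x₀ = m := extChartAt_to_inv _
  let F : EG × EM → N.constraintManifold := fun p => γ p.1 • ψ p.2
  have hγ : ∀ h ∈ (extChartAt 𝓘(ℝ, EG) (1 : G)).target, ContMDiffAt 𝓘(ℝ, EG) 𝓘(ℝ, EG) ∞ γ h :=
    fun h hh => contMDiffAt_extChartAt_symm hh
  have hψ : ∀ x ∈ (extChartAt 𝓘(ℝ, EM) m).target, ContMDiffAt 𝓘(ℝ, EM) 𝓘(ℝ, EM) ∞ ψ x :=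
    fun h hh => contMDiffAt_extChartAt_symm hh
  have hh₀ : h₀ ∈ (extChartAt 𝓘(ℝ, EG) (1 : G)).target := mem_extChartAt_target _
  have hx₀ : x₀ ∈ (extChartAt 𝓘(ℝ, EM) m).target := mem_extChartAt_target _
  have hF : ∀ h ∈ (extChartAt 𝓘(ℝ, EG) (1 : G)).target, ∀ x ∈ (extChartAt 𝓘(ℝ, EM) m).target,
      ContMDiffAt 𝓘(ℝ, EG × EM) 𝓘(ℝ, EM) ∞ F (h, x) := fun h hh x hx =>
    (contMDiff_action hM _).comp (h, x)
      (((hγ h hh).comp (h, x) contDiff_fst.contMDiff.contMDiffAt).prodMk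
        ((hψ x hx).comp (h, x) contDiff_snd.contMDiff.contMDiffAt))
  have hFd : ∀ h ∈ (extChartAt 𝓘(ℝ, EG) (1 : G)).target, ∀ x ∈ (extChartAt 𝓘(ℝ, EM) m).target,
      MDifferentiableAt 𝓘(ℝ, EG × EM) 𝓘(ℝ, EM) F (h, x) := fun h hh x hx =>
    (hF h hh x hx).mdifferentiableAt (by simp)
  have hinl : ∀ h ∈ (extChartAt 𝓘(ℝ, EG) (1 : G)).target, ∀ x ∈ (extChartAt 𝓘(ℝ, EM) m).target,
      ∀ u : EG, (mfderiv 𝓘(ℝ, EG × EM) 𝓘(ℝ, EM) F (h, x) (u, 0) : EM) =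
        mfderiv 𝓘(ℝ, EG) 𝓘(ℝ, EM) (fun g : G => g • ψ x) (γ h)
          (mfderiv 𝓘(ℝ, EG) 𝓘(ℝ, EG) γ h u) := by
    intro h hh x hx u
    have e1 := mfderiv_comp_clm (f := fun h : EG => (h, x)) (x := h) (hFd h hh x hx)
      (hasFDerivAt_prodMk_left h x).differentiableAt.mdifferentiableAt u
    have e2 := mfderiv_comp_clm (f := γ) (g := fun g : G => g • ψ x) (x := h)
      ((contMDiff_smul_right hM (ψ x) _).mdifferentiableAt (by simp))
      ((hγ h hh).mdifferentiableAt (by simp)) u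
    rw [mfderiv_eq_fderiv, (hasFDerivAt_prodMk_left h x).fderiv] at e1
    exact e1.symm.trans e2
  have hinr : ∀ h ∈ (extChartAt 𝓘(ℝ, EG) (1 : G)).target, ∀ x ∈ (extChartAt 𝓘(ℝ, EM) m).target,
      ∀ u : EM, (mfderiv 𝓘(ℝ, EG × EM) 𝓘(ℝ, EM) F (h, x) (0, u) : EM) =
        mfderiv 𝓘(ℝ, EM) 𝓘(ℝ, EM) (fun m : N.constraintManifold => γ h • m) (ψ x)
          (mfderiv 𝓘(ℝ, EM) 𝓘(ℝ, EM) ψ x u) := by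
    intro h hh x hx u
    have e1 := mfderiv_comp_clm (f := fun x : EM => (h, x)) (x := x) (hFd h hh x hx)
      (hasFDerivAt_prodMk_right h x).differentiableAt.mdifferentiableAt u
    have e2 := mfderiv_comp_clm (f := ψ) (g := fun m : N.constraintManifold => γ h • m) (x := x)
      ((contMDiff_smul_left hM (γ h) _).mdifferentiableAt (by simp))
      ((hψ x hx).mdifferentiableAt (by simp)) u
    rw [mfderiv_eq_fderiv, (hasFDerivAt_prodMk_right h x).fderiv] at e1
    exact e1.symm.trans e2
  let ϑ := (N.thetaM EM).along F
  have hϑs : DifferentiableAt ℝ ϑ (h₀, x₀) :=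
    ((smooth_thetaM hM).along (hF h₀ hh₀ x₀ hx₀)).differentiableAt (by simp)
  have hϑd : ∀ a : EG × EM, DifferentiableAt ℝ (fun p => ϑ p ![a]) (h₀, x₀) := fun a =>
    (contDiffAt_alternating_apply (n := 1) (v := fun _ => ![a])
      (((smooth_thetaM hM).along (hF h₀ hh₀ x₀ hx₀)).of_le (by simp))
      fun i => contDiffAt_const).differentiableAt (by simp)
  have htarG : ∀ᶠ h in 𝓝 h₀, h ∈ (extChartAt 𝓘(ℝ, EG) (1 : G)).target :=
    (isOpen_extChartAt_target (I := 𝓘(ℝ, EG)) _).mem_nhds hh₀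
  have htarM : ∀ᶠ x in 𝓝 x₀, x ∈ (extChartAt 𝓘(ℝ, EM) m).target :=
    (isOpen_extChartAt_target (I := 𝓘(ℝ, EM)) _).mem_nhds hx₀
  have tr1 : ∀ (g : G) (m : N.constraintManifold), g = 1 → ∀ u : EG, N.thetaM EM (g • m)
      ![mfderiv 𝓘(ℝ, EG) 𝓘(ℝ, EM) (fun g : G => g • m) g u] = N.momentum EM EG G m u := by
    rintro _ m rfl u
    have tr : ∀ m' : N.constraintManifold, m' = m → ∀ w : EM,
        N.thetaM EM m' ![w] = N.thetaM EM m ![w] := by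
      rintro _ rfl w; rfl
    exact (tr _ (one_smul G m) _).trans (momentum_apply m u).symm
  have tr2 : ∀ (g : G), g = 1 → ∀ u : EG,
      (mfderiv 𝓘(ℝ, EG) 𝓘(ℝ, EM) (fun g : G => g • m) g u : EM) = N.generator EM EG G m u := by
    rintro _ rfl u; rfl
  have tr3 : ∀ m' : N.constraintManifold, m' = m → ∀ u : EG,
      ∀ g : G, (mfderiv 𝓘(ℝ, EG) 𝓘(ℝ, EM) (fun g : G => g • m') g u : EM) =
        mfderiv 𝓘(ℝ, EG) 𝓘(ℝ, EM) (fun g : G => g • m) g u := by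
    rintro _ rfl u g; rfl
  have tr4 : ∀ m' : N.constraintManifold, m' = m → ∀ a b : EM,
      N.omegaM EM m' ![a, b] = N.omegaM EM m ![a, b] := by
    rintro _ rfl a b; rfl
  have hTη : (mfderiv 𝓘(ℝ, EG) 𝓘(ℝ, EG) γ h₀ η : EG) = ξ :=
    mfderiv_chart_symm_self (I := 𝓘(ℝ, EG)) (x := (1 : G)) ξ
  have hTζ : (mfderiv 𝓘(ℝ, EM) 𝓘(ℝ, EM) ψ x₀ ζ : EM) = v :=
    mfderiv_chart_symm_self (I := 𝓘(ℝ, EM)) (x := m) v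
  -- By invariance of Θ_M this component is constant in the group variable, so its derivative drops
  -- out.
  have h1 : (fun h => ϑ (h, x₀) ![(0, ζ)]) =ᶠ[𝓝 h₀] fun _ => N.thetaM EM (ψ x₀)
      ![mfderiv 𝓘(ℝ, EM) 𝓘(ℝ, EM) ψ x₀ ζ] := by
    filter_upwards [htarG] with h hh
    have e1 : ϑ (h, x₀) ![(0, ζ)] = N.thetaM EM (γ h • ψ x₀)
        ![mfderiv 𝓘(ℝ, EM) 𝓘(ℝ, EM) (fun m : N.constraintManifold => γ h • m) (ψ x₀)
          (mfderiv 𝓘(ℝ, EM) 𝓘(ℝ, EM) ψ x₀ ζ)] := by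
      refine (Form.along_apply F (N.thetaM EM) (h, x₀) _).trans
        (congrArg (N.thetaM EM (γ h • ψ x₀)) ?_)
      ext i; fin_cases i
      exact hinr h hh x₀ hx₀ ζ
    have e2 := DFunLike.congr_fun (congrFun (thetaM_invariant (G := G) hM (γ h)) (ψ x₀))
      ![mfderiv 𝓘(ℝ, EM) 𝓘(ℝ, EM) ψ x₀ ζ]
    rw [Form.pullback_apply] at e2
    rw [e1, ← e2]
    congr 1
    ext i; fin_cases i; rfl
  -- At the identity the group component is the momentum by definition; its derivative in x is the
  -- surviving term.
  have h2 : (fun x => ϑ (h₀, x) ![(η, 0)]) =ᶠ[𝓝 x₀] fun x => N.momentum EM EG G (ψ x) ξ := by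
    filter_upwards [htarM] with x hx
    refine Eq.trans ?_ (tr1 (γ h₀) (ψ x) hγ0 ξ)
    refine (Form.along_apply F (N.thetaM EM) (h₀, x) _).trans
      (congrArg (N.thetaM EM (γ h₀ • ψ x)) ?_)
    ext i; fin_cases i
    exact (hinl h₀ hh₀ x hx η).trans (congrArg _ hTη)
  have hJ := (contMDiff_momentum EG G hM m).mdifferentiableAt (by simp)
  have h3 : fderiv ℝ (fun x => N.momentum EM EG G (ψ x) ξ) x₀ ζ =
      N.dMomentum EM EG G m v ξ := by
    have hψd := (hψ x₀ hx₀).mdifferentiableAt (by simp)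
    have hd : MDifferentiableAt 𝓘(ℝ, EM) 𝓘(ℝ, EG →L[ℝ] ℝ) (N.momentum EM EG G ∘ ψ) x₀ :=
      ((contMDiff_momentum EG G hM _).mdifferentiableAt (by simp)).comp x₀ hψd
    have e1 := mfderiv_comp_clm (f := ψ) (x := x₀) (g := N.momentum EM EG G)
      ((contMDiff_momentum EG G hM _).mdifferentiableAt (by simp)) hψd ζ
    rw [mfderiv_eq_fderiv] at e1
    have e2 := (hd.differentiableAt.hasFDerivAt.clm_apply (hasFDerivAt_const ξ x₀)).fderiv
    have e3 := DFunLike.congr_fun e2 ζ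
    have tr5 : ∀ m' : N.constraintManifold, m' = m → ∀ u : EM,
        N.dMomentum EM EG G m' u = N.dMomentum EM EG G m u := by
      rintro _ rfl u; rfl
    have e4 : (fderiv ℝ (N.momentum EM EG G ∘ ψ) x₀ ζ : EG →L[ℝ] ℝ) = N.dMomentum EM EG G m v :=
      e1.trans ((congrArg (N.dMomentum EM EG G (ψ x₀)) hTζ).trans (tr5 _ hψ0 v))
    refine e3.trans ?_
    refine Eq.trans ?_ (DFunLike.congr_fun e4 ξ)
    simp
  have h4 : (N.omegaM EM).along F (h₀, x₀) ![(η, 0), (0, ζ)] =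
      -extDeriv ϑ (h₀, x₀) ![(η, 0), (0, ζ)] := by
    rw [omegaM_eq hM, (smooth_thetaM hM).extDeriv_along (hF h₀ hh₀ x₀ hx₀)]
    rfl
  have hFm : F (h₀, x₀) = m := by
    simp only [F]
    rw [hγ0, hψ0, one_smul]
  have h5 : (N.omegaM EM).along F (h₀, x₀) ![(η, 0), (0, ζ)] =
      N.omegaM EM m ![N.generator EM EG G m ξ, v] := by
    refine Eq.trans ?_ (tr4 _ hFm _ _)
    refine (Form.along_apply F (N.omegaM EM) (h₀, x₀) _).trans
      (congrArg (N.omegaM EM (F (h₀, x₀))) ?_)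
    ext i; fin_cases i
    · refine (hinl h₀ hh₀ x₀ hx₀ η).trans ?_
      exact (tr3 _ hψ0 _ _).trans ((tr2 _ hγ0 _).trans (congrArg _ hTη))
    · have e1 := mfderiv_comp_clm (f := fun x : EM => (h₀, x)) (x := x₀) (hFd h₀ hh₀ x₀ hx₀)
        (hasFDerivAt_prodMk_right h₀ x₀).differentiableAt.mdifferentiableAt ζ
      rw [mfderiv_eq_fderiv (f := fun x : EM => (h₀, x)),
        (hasFDerivAt_prodMk_right h₀ x₀).fderiv] at e1
      have e2 : F ∘ (fun x : EM => (h₀, x)) = ψ := by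
        funext x
        simp only [F, Function.comp_apply]
        rw [hγ0, one_smul]
      rw [e2] at e1
      exact e1.symm.trans hTζ
  rw [← h5, h4, extDeriv_one_apply hϑs, fderiv_inl_eq (hϑd _), fderiv_inr_eq (hϑd _),
    h1.fderiv_eq, h2.fderiv_eq, h3]
  simp

end NonholonomicSystem

/-! ### Freeness and the orbit projection -/

namespace NonholonomicSystem

variable {E : Type*} [NormedAddCommGroup E] [NormedSpace ℝ E] [FiniteDimensional ℝ E]
  {Q : Type*} [TopologicalSpace Q] [ChartedSpace E Q] [IsManifold 𝓘(ℝ, E) ∞ Q]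
  {N : NonholonomicSystem E Q}
  {EM : Type*} [NormedAddCommGroup EM] [NormedSpace ℝ EM] [FiniteDimensional ℝ EM]
  [ChartedSpace EM N.constraintManifold] [IsManifold 𝓘(ℝ, EM) ∞ N.constraintManifold]
  {EG : Type*} [NormedAddCommGroup EG] [NormedSpace ℝ EG] [FiniteDimensional ℝ EG]
  {G : Type*} [TopologicalSpace G] [ChartedSpace EG G] [Group G] [LieGroup 𝓘(ℝ, EG) ∞ G]
  [MulAction G Q] [ContMDiffSMul 𝓘(ℝ, EG) 𝓘(ℝ, E) ∞ G Q] [hG : N.IsSymmetry G]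

/-- The infinitesimal generators of a free action vanish nowhere. -/
theorem generator_injective (hM : N.IsEmbedded EM) (hfree : ∀ (g : G) (q : Q), g • q = q → g = 1)
    (m : N.constraintManifold) : Function.Injective (N.generator EM EG G m) := by
  refine (injective_iff_map_eq_zero (N.generator EM EG G m)).2 fun ξ hξ => ?_
  have hm1 : IsManifold 𝓘(ℝ, EG) 1 G := IsManifold.of_le (n := ∞) (by simp)
  have hm2 : IsManifold 𝓘(ℝ, EM) 1 N.constraintManifold := IsManifold.of_le (n := ∞) (by simp)
  have hm3 : LieGroup 𝓘(ℝ, EG) (minSmoothness ℝ 3) G := by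
    refine LieGroup.of_le (n := ∞) ?_
    rw [minSmoothness_of_isRCLikeNormedField]
    exact WithTop.coe_le_coe.2 (le_top : (3 : ℕ∞) ≤ ⊤)
  have := FiniteDimensional.complete ℝ EG
  have hle : (1 : WithTop ℕ∞) ≤ minSmoothness ℝ 2 := by
    rw [minSmoothness_of_isRCLikeNormedField]
    exact one_le_two
  obtain ⟨γ, hγ0, hγ⟩ := exists_isMIntegralCurveAt_of_contMDiffAt_boundaryless (x₀ := (1 : G)) 0
    (((contMDiff_mulInvariantVectorField (I := 𝓘(ℝ, EG)) (G := G) ξ) 1).of_le hle)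
  -- Here γ is the integral curve through 1 of the left-invariant field of ξ. The velocity of γ(t) ·
  -- m is Tγ(t)(ξ_M(m)) = 0, so by uniqueness of integral curves it is constant; then γ(t) fixes
  -- τ(m), and freeness gives γ = 1 near 0.
  have hc : IsMIntegralCurveAt (fun t => γ t • m)
      (fun m : N.constraintManifold => (0 : TangentSpace 𝓘(ℝ, EM) m)) 0 := by
    filter_upwards [hγ] with t ht
    have h1 := ((contMDiff_smul_right (EG := EG) hM m (γ t)).mdifferentiableAt
      (by simp)).hasMFDerivAt.comp t ht
    refine h1.congr_mfderiv ?_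
    ext
    have h2 := mfderiv_smul_generator hM (γ t) m ξ
    rw [hξ] at h2
    have h3 := (map_zero (mfderiv 𝓘(ℝ, EM) 𝓘(ℝ, EM)
      (fun m : N.constraintManifold => γ t • m) m)).symm.trans h2
    change mfderiv 𝓘(ℝ, EG) 𝓘(ℝ, EM) (fun g : G => g • m) (γ t)
      ((1 : ℝ) • mulInvariantVectorField ξ (γ t)) = (1 : ℝ) • 0
    rw [one_smul, smul_zero]
    exact h3.symm
  have hc0 : IsMIntegralCurveAt (fun _ : ℝ => m)
      (fun m : N.constraintManifold => (0 : TangentSpace 𝓘(ℝ, EM) m)) 0 := by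
    refine Filter.Eventually.of_forall fun t => ?_
    refine (hasMFDerivAt_const m t).congr_mfderiv ?_
    ext
    exact (smul_zero _).symm
  have heq := isMIntegralCurveAt_eventuallyEq_of_contMDiffAt_boundaryless (t₀ := 0)
    (((Bundle.contMDiff_zeroSection (n := 1) ℝ
      (TangentSpace 𝓘(ℝ, EM) (M := N.constraintManifold))) _)) hc hc0 (by
      rw [hγ0, one_smul])
  have hγ1 : γ =ᶠ[𝓝 0] fun _ => 1 := by
    filter_upwards [heq] with t ht
    exact hfree _ (N.tau m) (congrArg N.tau ht)
  have h4 := hγ.self_of_nhds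
  have h5 := (hasMFDerivAt_const (I := 𝓘(ℝ, ℝ)) (I' := 𝓘(ℝ, EG)) (1 : G) (0 : ℝ)).congr_of_eventuallyEq hγ1
  have h6 := hasMFDerivAt_unique h4 h5
  have h7 : ((1 : ℝ) • mulInvariantVectorField (I := 𝓘(ℝ, EG)) ξ (γ 0) : EG) = 0 :=
    DFunLike.congr_fun h6 (1 : ℝ)
  rw [one_smul, hγ0] at h7
  refine Eq.trans ?_ h7
  have h8 : (fun g : G => 1 * g) = id := by funext g; exact one_mul g
  have h9 : mfderiv 𝓘(ℝ, EG) 𝓘(ℝ, EG) (fun g : G => 1 * g) 1 ξ = (ξ : EG) := by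
    rw [h8, mfderiv_id]
    rfl
  exact h9.symm

theorem rho_smul (g : G) (m : N.constraintManifold) : N.rho G (g • m) = N.rho G m :=
  Quotient.sound ⟨g, rfl⟩

theorem exists_smul_of_rho_eq {m m' : N.constraintManifold} (h : N.rho G m = N.rho G m') :
    ∃ g : G, m = g • m' := by
  obtain ⟨g, hg⟩ := Quotient.exact h
  exact ⟨g, hg.symm⟩

variable {ER : Type*} [NormedAddCommGroup ER] [NormedSpace ℝ ER]
  [ChartedSpace ER (N.OrbitSpace G)] [IsManifold 𝓘(ℝ, ER) ∞ (N.OrbitSpace G)]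

/-- The projection is constant on orbits. Of the relation between the vertical space and ker Tρ,
only this inclusion is needed. -/
theorem mfderiv_rho_generator (hM : N.IsEmbedded EM)
    (hrho : ContMDiff 𝓘(ℝ, EM) 𝓘(ℝ, ER) ∞ (N.rho G)) (m : N.constraintManifold) (ξ : EG) :
    mfderiv 𝓘(ℝ, EM) 𝓘(ℝ, ER) (N.rho G) m (N.generator EM EG G m ξ) = 0 := by
  have h1 := mfderiv_comp_clm (I := 𝓘(ℝ, EG)) (f := fun h : G => h • m) (g := N.rho G) (x := 1)
    ((hrho _).mdifferentiableAt (by simp))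
    ((contMDiff_smul_right hM m _).mdifferentiableAt (by simp)) ξ
  have e : N.rho G ∘ (fun h : G => h • m) = fun _ => N.rho G m := by
    funext h; exact rho_smul h m
  have tr : ∀ m' : N.constraintManifold, m' = m → ∀ u : EM,
      (mfderiv 𝓘(ℝ, EM) 𝓘(ℝ, ER) (N.rho G) m' u : ER) =
        mfderiv 𝓘(ℝ, EM) 𝓘(ℝ, ER) (N.rho G) m u := by
    rintro _ rfl u; rfl
  refine (tr _ (one_smul G m) _).symm.trans (h1.symm.trans ?_)
  rw [e, mfderiv_const]
  rfl

theorem mfderiv_rho_smul (hM : N.IsEmbedded EM)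
    (hrho : ContMDiff 𝓘(ℝ, EM) 𝓘(ℝ, ER) ∞ (N.rho G)) (g : G) (m : N.constraintManifold)
    (v : TangentSpace 𝓘(ℝ, EM) m) :
    (mfderiv 𝓘(ℝ, EM) 𝓘(ℝ, ER) (N.rho G) (g • m)
      (mfderiv 𝓘(ℝ, EM) 𝓘(ℝ, EM) (fun m : N.constraintManifold => g • m) m v) : ER) =
    mfderiv 𝓘(ℝ, EM) 𝓘(ℝ, ER) (N.rho G) m v := by
  have h1 := mfderiv_comp_clm (f := fun m : N.constraintManifold => g • m) (g := N.rho G)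
    ((hrho _).mdifferentiableAt (by simp))
    ((contMDiff_smul_left hM g m).mdifferentiableAt (by simp)) v
  have e : N.rho G ∘ (fun m : N.constraintManifold => g • m) = N.rho G := by
    funext h; exact rho_smul g h
  exact h1.symm.trans (congrArg (fun f => (mfderiv 𝓘(ℝ, EM) 𝓘(ℝ, ER) f m v : ER)) e)

end NonholonomicSystem

/-! ### Linear algebra of gauge transformations -/

section GaugeTransformations

variable {T : Type*} [AddCommGroup T] [Module ℝ T] [TopologicalSpace T]

theorem linearInverse_apply_apply {V V' : Type*} [AddCommGroup V] [Module ℝ V] [AddCommGroup V']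
    [Module ℝ V'] {f : V →ₗ[ℝ] V'} (h : Function.Bijective f) (v : V') :
    f (linearInverse f v) = v := by
  rw [linearInverse, dif_pos h]
  exact LinearEquiv.apply_symm_apply (LinearEquiv.ofBijective f h) v

theorem linearLeftInverse_apply_apply {V V' : Type*} [AddCommGroup V] [Module ℝ V]
    [AddCommGroup V'] [Module ℝ V'] {f : V →ₗ[ℝ] V'} (h : Function.Injective f) (v : V) :
    linearLeftInverse f (f v) = v := by
  have hk : LinearMap.ker f = ⊥ := LinearMap.ker_eq_bot.2 h
  rw [linearLeftInverse, dif_pos hk]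
  exact LinearMap.congr_fun (f.exists_leftInverse_of_injective hk).choose_spec v

variable [FiniteDimensional ℝ T] {F : Submodule ℝ T} {Ω B : T [⋀^Fin 2]→L[ℝ] ℝ}
  (hΩ : ∀ X ∈ F, (∀ Y ∈ F, Ω ![X, Y] = 0) → X = 0)

theorem flatOn_bijective (hΩ : ∀ X ∈ F, (∀ Y ∈ F, Ω ![X, Y] = 0) → X = 0) :
    Function.Bijective (flatOn F Ω) := by
  have hinj : Function.Injective (flatOn F Ω) := by
    refine (injective_iff_map_eq_zero (flatOn F Ω)).2 fun X hX => ?_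
    exact Subtype.ext (hΩ X X.2 fun Y hY => LinearMap.congr_fun hX ⟨Y, hY⟩)
  exact ⟨hinj, (LinearMap.injective_iff_surjective_of_finrank_eq_finrank
    Subspace.dual_finrank_eq.symm).1 hinj⟩

theorem sharpOfPair_mem (α : T →L[ℝ] ℝ) : sharpOfPair F Ω α ∈ F :=
  F.neg_mem (Subtype.prop _)

theorem sharpOfPair_spec (hΩ : ∀ X ∈ F, (∀ Y ∈ F, Ω ![X, Y] = 0) → X = 0) (α : T →L[ℝ] ℝ)
    {Y : T} (hY : Y ∈ F) : Ω ![sharpOfPair F Ω α, Y] = -α Y := by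
  have h := LinearMap.congr_fun (linearInverse_apply_apply (flatOn_bijective hΩ)
    (α.toLinearMap ∘ₗ F.subtype)) ⟨Y, hY⟩
  have h2 : flat Ω (sharpOfPair F Ω α) Y = -flat Ω
      ((linearInverse (flatOn F Ω) (α.toLinearMap ∘ₗ F.subtype) : F) : T) Y := by
    have : sharpOfPair F Ω α = -((linearInverse (flatOn F Ω)
      (α.toLinearMap ∘ₗ F.subtype) : F) : T) := rfl
    rw [this, map_neg]
    rfl
  exact h2.trans (congrArg Neg.neg h)

theorem eq_sharpOfPair (hΩ : ∀ X ∈ F, (∀ Y ∈ F, Ω ![X, Y] = 0) → X = 0) {α : T →L[ℝ] ℝ} {X : T}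
    (hX : X ∈ F) (h : ∀ Y ∈ F, Ω ![X, Y] = -α Y) : X = sharpOfPair F Ω α := by
  rw [← sub_eq_zero]
  refine hΩ _ (F.sub_mem hX (sharpOfPair_mem α)) fun Y hY => ?_
  have := DFunLike.congr_fun (map_sub (flat Ω) X (sharpOfPair F Ω α)) Y
  refine this.trans ?_
  change Ω ![X, Y] - Ω ![sharpOfPair F Ω α, Y] = 0
  rw [h Y hY, sharpOfPair_spec hΩ α hY, sub_self]

variable [IsTopologicalAddGroup T] [ContinuousSMul ℝ T]

theorem gaugeTransform_mem (α : T →L[ℝ] ℝ) : gaugeTransform (sharpOfPair F Ω) B α ∈ F :=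
  sharpOfPair_mem _

/-- Put β = (Id + B♭π♯)⁻¹α. Then Ω(π♯β, Y) = -β(Y) and B(π♯β, Y) = α(Y) - β(Y); the difference is
-α(Y). Gauging by B therefore amounts to replacing Ω by Ω - B on the same subspace. -/
theorem gaugeTransform_spec (hΩ : ∀ X ∈ F, (∀ Y ∈ F, Ω ![X, Y] = 0) → X = 0)
    (hg : Function.Bijective (gaugeEnd (sharpOfPair F Ω) B)) (α : T →L[ℝ] ℝ)
    {Y : T} (hY : Y ∈ F) : (Ω - B) ![gaugeTransform (sharpOfPair F Ω) B α, Y] = -α Y := by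
  have h := DFunLike.congr_fun (linearInverse_apply_apply hg α) Y
  have h2 := sharpOfPair_spec hΩ (linearInverse (gaugeEnd (sharpOfPair F Ω) B) α) hY
  change Ω ![gaugeTransform (sharpOfPair F Ω) B α, Y] -
    B ![gaugeTransform (sharpOfPair F Ω) B α, Y] = _
  change linearInverse (gaugeEnd (sharpOfPair F Ω) B) α Y +
    B ![gaugeTransform (sharpOfPair F Ω) B α, Y] = α Y at h
  change Ω ![gaugeTransform (sharpOfPair F Ω) B α, Y] = _ at h2
  rw [h2]
  linarith

/-- If (Ω - B)(X, ·) vanishes on F then X = π♯(-B♭X), so -B♭X lies in the kernel of Id + B♭π♯ and is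
zero; hence X = 0. -/
theorem sub_nondegenerate (hΩ : ∀ X ∈ F, (∀ Y ∈ F, Ω ![X, Y] = 0) → X = 0)
    (hg : Function.Bijective (gaugeEnd (sharpOfPair F Ω) B)) {X : T} (hX : X ∈ F)
    (h : ∀ Y ∈ F, (Ω - B) ![X, Y] = 0) : X = 0 := by
  have h1 : X = sharpOfPair F Ω (-flat B X) := by
    refine eq_sharpOfPair hΩ hX fun Y hY => ?_
    have h2 := h Y hY
    change Ω ![X, Y] - B ![X, Y] = 0 at h2
    change Ω ![X, Y] = -(-B ![X, Y])
    linarith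
  have h2 : gaugeEnd (sharpOfPair F Ω) B (-flat B X) = 0 := by
    change -flat B X + flat B (sharpOfPair F Ω (-flat B X)) = 0
    rw [← h1]
    exact neg_add_cancel _
  have h3 : -flat B X = 0 := hg.1 (h2.trans (map_zero _).symm)
  rw [h1, h3, map_zero]

theorem eq_gaugeTransform (hΩ : ∀ X ∈ F, (∀ Y ∈ F, Ω ![X, Y] = 0) → X = 0)
    (hg : Function.Bijective (gaugeEnd (sharpOfPair F Ω) B)) {α : T →L[ℝ] ℝ} {X : T}
    (hX : X ∈ F) (h : ∀ Y ∈ F, (Ω - B) ![X, Y] = -α Y) :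
    X = gaugeTransform (sharpOfPair F Ω) B α := by
  rw [← sub_eq_zero]
  refine sub_nondegenerate hΩ hg (F.sub_mem hX (gaugeTransform_mem α)) fun Y hY => ?_
  have := DFunLike.congr_fun (map_sub (flat (Ω - B)) X
    (gaugeTransform (sharpOfPair F Ω) B α)) Y
  refine this.trans ?_
  change (Ω - B) ![X, Y] - (Ω - B) ![gaugeTransform (sharpOfPair F Ω) B α, Y] = 0
  rw [h Y hY, gaugeTransform_spec hΩ hg α hY, sub_self]

end GaugeTransformations

/-! ### The gauged bivector field on the constraint manifold -/

namespace NonholonomicSystem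

variable {E : Type*} [NormedAddCommGroup E] [NormedSpace ℝ E] [FiniteDimensional ℝ E]
  {Q : Type*} [TopologicalSpace Q] [ChartedSpace E Q] [IsManifold 𝓘(ℝ, E) ∞ Q]
  {N : NonholonomicSystem E Q}
  {EM : Type*} [NormedAddCommGroup EM] [NormedSpace ℝ EM] [FiniteDimensional ℝ EM]
  [ChartedSpace EM N.constraintManifold] [IsManifold 𝓘(ℝ, EM) ∞ N.constraintManifold]

variable (N EM) in
/-- The 2-form `Ω_M - B`. -/
def gaugedForm (B : Form 𝓘(ℝ, EM) N.constraintManifold ℝ 2) :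
    Form 𝓘(ℝ, EM) N.constraintManifold ℝ 2 := fun m => N.omegaM EM m - B m

variable {B : Form 𝓘(ℝ, EM) N.constraintManifold ℝ 2}

instance (m : N.constraintManifold) : FiniteDimensional ℝ (TangentSpace 𝓘(ℝ, EM) m) :=
  inferInstanceAs (FiniteDimensional ℝ EM)

theorem piB_mem (m : N.constraintManifold) (α : TangentSpace 𝓘(ℝ, EM) m →L[ℝ] ℝ) :
    N.piB EM B m α ∈ N.distC EM m := gaugeTransform_mem α

theorem piB_spec (hM : N.IsEmbedded EM)
    (hgauge : ∀ m, Function.Bijective (gaugeEnd (N.piNH EM m) (B m))) (m : N.constraintManifold)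
    (α : TangentSpace 𝓘(ℝ, EM) m →L[ℝ] ℝ) {Y : TangentSpace 𝓘(ℝ, EM) m}
    (hY : Y ∈ N.distC EM m) : N.gaugedForm EM B m ![N.piB EM B m α, Y] = -α Y :=
  gaugeTransform_spec (fun _ hX h => omegaM_nondegenerate hM m hX h) (hgauge m) α hY

theorem gaugedForm_nondegenerate (hM : N.IsEmbedded EM)
    (hgauge : ∀ m, Function.Bijective (gaugeEnd (N.piNH EM m) (B m))) (m : N.constraintManifold)
    {X : TangentSpace 𝓘(ℝ, EM) m} (hX : X ∈ N.distC EM m)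
    (h : ∀ Y ∈ N.distC EM m, N.gaugedForm EM B m ![X, Y] = 0) : X = 0 :=
  sub_nondegenerate (fun _ hX h => omegaM_nondegenerate hM m hX h) (hgauge m) hX h

theorem eq_piB (hM : N.IsEmbedded EM)
    (hgauge : ∀ m, Function.Bijective (gaugeEnd (N.piNH EM m) (B m))) (m : N.constraintManifold)
    {α : TangentSpace 𝓘(ℝ, EM) m →L[ℝ] ℝ} {X : TangentSpace 𝓘(ℝ, EM) m}
    (hX : X ∈ N.distC EM m) (h : ∀ Y ∈ N.distC EM m, N.gaugedForm EM B m ![X, Y] = -α Y) :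
    X = N.piB EM B m α :=
  eq_gaugeTransform (fun _ hX h => omegaM_nondegenerate hM m hX h) (hgauge m) hX h

theorem piB_skew (hM : N.IsEmbedded EM)
    (hgauge : ∀ m, Function.Bijective (gaugeEnd (N.piNH EM m) (B m))) (m : N.constraintManifold)
    (α β : TangentSpace 𝓘(ℝ, EM) m →L[ℝ] ℝ) :
    β (N.piB EM B m α) = -α (N.piB EM B m β) := by
  have h1 := piB_spec hM hgauge m α (piB_mem (B := B) m β)
  have h2 := piB_spec hM hgauge m β (piB_mem (B := B) m α)
  rw [alternating_swap] at h1
  linarith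

theorem smooth_omegaM (hM : N.IsEmbedded EM) : (N.omegaM EM).Smooth := by
  rw [omegaM_eq hM]
  exact fun x₀ => ((smooth_thetaM hM).d x₀).neg

theorem smooth_gaugedForm (hM : N.IsEmbedded EM) (hB : B.Smooth) : (N.gaugedForm EM B).Smooth :=
  fun x₀ => (smooth_omegaM hM x₀).sub (hB x₀)

/-- Ω_M is exact, so only B contributes. -/
theorem extDeriv_gaugedForm (hM : N.IsEmbedded EM) (hB : B.Smooth) {x₀ : N.constraintManifold}
    {y : EM} (hy : y ∈ (extChartAt 𝓘(ℝ, EM) x₀).target) :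
    extDeriv ((N.gaugedForm EM B).inChart x₀) y = -B.d.inChart x₀ y := by
  have hθ := smooth_thetaM hM
  have h1 : (N.gaugedForm EM B).inChart x₀ =
      (-1 : ℝ) • ((N.thetaM EM).d.inChart x₀ + B.inChart x₀) := by
    unfold gaugedForm
    rw [omegaM_eq hM, neg_one_smul, neg_add, ← sub_eq_add_neg]
    rfl
  have h2 : extDeriv ((N.thetaM EM).d.inChart x₀) y = 0 := by
    refine (hθ.d.extDeriv_along (contMDiffAt_extChartAt_symm hy)).trans ?_
    ext v
    rw [Form.along_apply, hθ.d_d]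
    rfl
  have h3 : extDeriv (B.inChart x₀) y = B.d.inChart x₀ y :=
    hB.extDeriv_along (contMDiffAt_extChartAt_symm hy)
  rw [h1, extDeriv_smul, extDeriv_add ((hθ.d.contDiffAt hy).differentiableAt (by simp))
    ((hB.contDiffAt hy).differentiableAt (by simp)), h2, h3, zero_add, neg_one_smul]

variable {G : Type*} [TopologicalSpace G] [Group G] [MulAction G Q] [hG : N.IsSymmetry G]

theorem gaugedForm_invariant (hM : N.IsEmbedded EM) (hBinv : B.Invariant G) :
    (N.gaugedForm EM B).Invariant G := by
  intro g
  have h1 := omegaM_invariant (G := G) hM g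
  have h2 := hBinv g
  funext m
  have e1 := congrFun h1 m
  have e2 := congrFun h2 m
  exact congrArg₂ (fun a b => a - b) e1 e2

/-- C and Ω_M - B are invariant, and they determine π_B. -/
theorem piB_smul (hM : N.IsEmbedded EM) (hBinv : B.Invariant G)
    (hgauge : ∀ m, Function.Bijective (gaugeEnd (N.piNH EM m) (B m))) (g : G)
    (m : N.constraintManifold) (α : TangentSpace 𝓘(ℝ, EM) (g • m) →L[ℝ] ℝ) :
    N.piB EM B (g • m) α = mfderiv 𝓘(ℝ, EM) 𝓘(ℝ, EM) (fun m : N.constraintManifold => g • m) m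
      (N.piB EM B m (α ∘L
        mfderiv 𝓘(ℝ, EM) 𝓘(ℝ, EM) (fun m : N.constraintManifold => g • m) m)) := by
  refine (eq_piB hM hgauge (g • m) (distC_smul hM g (piB_mem m _)) fun Y hY => ?_).symm
  let Y' : EM := mfderiv 𝓘(ℝ, EM) 𝓘(ℝ, EM) (fun m : N.constraintManifold => g⁻¹ • m) (g • m) Y
  have tr : ∀ m' : N.constraintManifold, m' = m → ∀ u : EM, u ∈ N.distC EM m' →
      u ∈ N.distC EM m := by
    rintro _ rfl u h; exact h
  have tr2 : ∀ m' : N.constraintManifold, m' = m → ∀ u : EM, (mfderiv 𝓘(ℝ, EM) 𝓘(ℝ, EM)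
      (fun m : N.constraintManifold => g • m) m' u : EM) =
      mfderiv 𝓘(ℝ, EM) 𝓘(ℝ, EM) (fun m : N.constraintManifold => g • m) m u := by
    rintro _ rfl u; rfl
  have hY' : Y' ∈ N.distC EM m := tr _ (inv_smul_smul g m) _ (distC_smul hM g⁻¹ hY)
  have hY2 : mfderiv 𝓘(ℝ, EM) 𝓘(ℝ, EM) (fun m : N.constraintManifold => g • m) m Y' = Y := by
    refine (tr2 _ (inv_smul_smul g m) Y').symm.trans ?_
    refine (mfderiv_comp_clm (f := fun m : N.constraintManifold => g⁻¹ • m) (x := g • m)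
      (g := fun m : N.constraintManifold => g • m)
      ((contMDiff_smul_left hM g _).mdifferentiableAt (by simp))
      ((contMDiff_smul_left hM g⁻¹ _).mdifferentiableAt (by simp)) Y).symm.trans ?_
    have e : (fun m : N.constraintManifold => g • m) ∘
        (fun m : N.constraintManifold => g⁻¹ • m) = id := by
      funext m; exact smul_inv_smul g m
    rw [e, mfderiv_id]
    rfl
  have h1 := piB_spec hM hgauge m (α ∘L
        mfderiv 𝓘(ℝ, EM) 𝓘(ℝ, EM) (fun m : N.constraintManifold => g • m) m) hY'
  rw [← gaugedForm_invariant hM hBinv g, Form.pullback_apply] at h1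
  have h2 : (α ∘L mfderiv 𝓘(ℝ, EM) 𝓘(ℝ, EM) (fun m : N.constraintManifold => g • m) m) Y' = α Y :=
    congrArg α hY2
  rw [h2] at h1
  refine Eq.trans (congrArg (N.gaugedForm EM B (g • m)) ?_) h1
  ext i; fin_cases i
  · rfl
  · exact hY2.symm

end NonholonomicSystem

/-! ### Projections and connection in charts -/

namespace NonholonomicSystem

variable {E : Type*} [NormedAddCommGroup E] [NormedSpace ℝ E] [FiniteDimensional ℝ E]
  {Q : Type*} [TopologicalSpace Q] [ChartedSpace E Q] [IsManifold 𝓘(ℝ, E) ∞ Q]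
  {N : NonholonomicSystem E Q}
  {EM : Type*} [NormedAddCommGroup EM] [NormedSpace ℝ EM] [FiniteDimensional ℝ EM]
  [ChartedSpace EM N.constraintManifold] [IsManifold 𝓘(ℝ, EM) ∞ N.constraintManifold]
  {EG : Type*} [NormedAddCommGroup EG] [NormedSpace ℝ EG] [FiniteDimensional ℝ EG]
  {G : Type*} [TopologicalSpace G] [ChartedSpace EG G] [Group G] [LieGroup 𝓘(ℝ, EG) ∞ G]
  [MulAction G Q] [ContMDiffSMul 𝓘(ℝ, EG) 𝓘(ℝ, E) ∞ G Q] [hG : N.IsSymmetry G]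

variable (N EM) in
/-- The inverse of the chart of the constraint manifold at `x₀`. -/
abbrev chartInv (x₀ : N.constraintManifold) : EM → N.constraintManifold :=
  (extChartAt 𝓘(ℝ, EM) x₀).symm

variable (N EM) in
/-- The tangent map of the inverse of a chart of the constraint manifold. -/
def tangentInv (x₀ : N.constraintManifold) (z : EM) :
    EM →L[ℝ] TangentSpace 𝓘(ℝ, EM) (N.chartInv EM x₀ z) :=
  mfderiv 𝓘(ℝ, EM) 𝓘(ℝ, EM) (N.chartInv EM x₀) z

variable {x₀ : N.constraintManifold} {y : EM}

theorem eventually_target (hy : y ∈ (extChartAt 𝓘(ℝ, EM) x₀).target) :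
    ∀ᶠ z in 𝓝 y, z ∈ (extChartAt 𝓘(ℝ, EM) x₀).target :=
  (isOpen_extChartAt_target (I := 𝓘(ℝ, EM)) x₀).mem_nhds hy

theorem tangentInv_injective (hy : y ∈ (extChartAt 𝓘(ℝ, EM) x₀).target) :
    Function.Injective (N.tangentInv EM x₀ y) := fun a b h => by
  have h1 := mfderiv_extChartAt_symm_apply (I := 𝓘(ℝ, EM)) hy a
  have h2 := mfderiv_extChartAt_symm_apply (I := 𝓘(ℝ, EM)) hy b
  exact h1.symm.trans ((congrArg _ h).trans h2)

theorem tangentInv_surjective (hy : y ∈ (extChartAt 𝓘(ℝ, EM) x₀).target) :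
    Function.Surjective (N.tangentInv EM x₀ y) := fun v =>
  ⟨_, mfderiv_symm_extChartAt_apply (I := 𝓘(ℝ, EM)) hy v⟩

/-- In a chart, `C` is the kernel of a smooth family of linear maps. -/
theorem exists_kernel_distC (hM : N.IsEmbedded EM) (hy : y ∈ (extChartAt 𝓘(ℝ, EM) x₀).target) :
    ∃ K : EM → EM →L[ℝ] E, ContDiffAt ℝ ∞ K y ∧
      ∀ᶠ z in 𝓝 y, ∀ u, K z u = 0 ↔ N.tangentInv EM x₀ z u ∈ N.distC EM (N.chartInv EM x₀ z) := by
  let ψ := N.chartInv EM x₀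
  let q₀ := N.tau (ψ y)
  let χ := (extChartAt 𝓘(ℝ, E) q₀).symm
  let κ : EM → E := extChartAt 𝓘(ℝ, E) q₀ ∘ (N.tau ∘ ψ)
  have hτψ : ContMDiffAt 𝓘(ℝ, EM) 𝓘(ℝ, E) ∞ (N.tau ∘ ψ) y :=
    (contMDiff_tau hM _).comp y (contMDiffAt_extChartAt_symm hy)
  have hκ : ContDiffAt ℝ ∞ κ y :=
    ((contMDiffAt_extChartAt_of_mem (mem_extChartAt_source (I := 𝓘(ℝ, E)) q₀)).comp y
      hτψ).contDiffAt
  have hL : ContDiffAt ℝ ∞ (fderiv ℝ κ) y := hκ.fderiv_right (by simp)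
  have hκy : κ y ∈ (extChartAt 𝓘(ℝ, E) q₀).target := mem_extChartAt_target q₀
  obtain ⟨r, Fr, hFr, hfr⟩ := N.regular_D.exists_frame hκy
  obtain ⟨l, hl, hlF⟩ := exists_smooth_leftInverse hFr hfr.self_of_nhds.1
  -- Tτ followed by the projection complementary to Fr ∘ l, whose kernel is D.
  refine ⟨fun z => fderiv ℝ κ z - Fr (κ z) ∘L l (κ z) ∘L fderiv ℝ κ z, ?_, ?_⟩
  · exact hL.sub ((ContDiffAt.comp y hFr hκ).clm_comp ((ContDiffAt.comp y hl hκ).clm_comp hL))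
  · have hs : ∀ᶠ z in 𝓝 y, N.tau (ψ z) ∈ (extChartAt 𝓘(ℝ, E) q₀).source :=
      hτψ.continuousAt.preimage_mem_nhds
        ((isOpen_extChartAt_source q₀).mem_nhds (mem_extChartAt_source q₀))
    filter_upwards [hs, eventually_target hy, hκ.continuousAt.eventually hfr,
      hκ.continuousAt.eventually hlF] with z hz hzt hzF hzl u
    have hτψz : ContMDiffAt 𝓘(ℝ, EM) 𝓘(ℝ, E) ∞ (N.tau ∘ ψ) z :=
      (contMDiff_tau hM _).comp z (contMDiffAt_extChartAt_symm hzt)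
    have hκz : MDifferentiableAt 𝓘(ℝ, EM) 𝓘(ℝ, E) κ z :=
      ((contMDiffAt_extChartAt_of_mem (I := 𝓘(ℝ, E)) hz).comp z hτψz).mdifferentiableAt (by simp)
    have hκzt : κ z ∈ (extChartAt 𝓘(ℝ, E) q₀).target := (extChartAt 𝓘(ℝ, E) q₀).map_source hz
    have e1 : (mfderiv 𝓘(ℝ, EM) 𝓘(ℝ, E) N.tau (ψ z) (N.tangentInv EM x₀ z u) : E) =
        mfderiv 𝓘(ℝ, E) 𝓘(ℝ, E) χ (κ z) (fderiv ℝ κ z u) := by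
      refine (mfderiv_comp_clm (f := ψ) ((contMDiff_tau hM _).mdifferentiableAt (by simp))
        ((contMDiffAt_extChartAt_symm hzt).mdifferentiableAt (by simp)) u).symm.trans ?_
      rw [(extChartAt_eventually_symm (I := 𝓘(ℝ, E)) hτψz.continuousAt hz).mfderiv_eq]
      refine (mfderiv_comp_clm (f := κ) (g := χ)
        ((contMDiffAt_extChartAt_symm hκzt).mdifferentiableAt (by simp)) hκz u).trans ?_
      rw [mfderiv_eq_fderiv]
      rfl
    have tr : ∀ q q' : Q, q = q' → ∀ u : E, (u ∈ N.D q ↔ u ∈ N.D q') := by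
      rintro q _ rfl u; rfl
    have e2 : N.tangentInv EM x₀ z u ∈ N.distC EM (ψ z) ↔
        fderiv ℝ κ z u ∈ Set.range (Fr (κ z)) := by
      rw [hzF.2]
      refine Iff.trans ?_ (tr _ _ ((extChartAt 𝓘(ℝ, E) q₀).left_inv hz).symm _)
      exact Iff.of_eq (congrArg (fun u : E => u ∈ N.D (N.tau (ψ z))) e1)
    rw [e2]
    change fderiv ℝ κ z u - Fr (κ z) (l (κ z) (fderiv ℝ κ z u)) = 0 ↔ _
    rw [sub_eq_zero]
    constructor
    · exact fun h => ⟨_, h.symm⟩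
    · rintro ⟨c, hc⟩
      rw [← hc, hzl]

variable (W : N.VerticalComplement EM EG G)

theorem projW_eq_iff (m : N.constraintManifold) (v p : TangentSpace 𝓘(ℝ, EM) m) :
    W.projW m v = p ↔ p ∈ W.dist m ∧ v - p ∈ N.distC EM m := by
  have h : W.projW m v = Submodule.projection _ _ (W.isCompl m).symm v := rfl
  rw [h]
  constructor
  · rintro rfl
    refine ⟨Submodule.projection_apply_mem _ _, ?_⟩
    rw [← Submodule.projection_apply_eq_zero_iff (W.isCompl m).symm, map_sub, sub_eq_zero]
    exact (Submodule.projection_apply_of_mem_left _ (Submodule.projection_apply_mem _ _)).symm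
  · rintro ⟨hp, hv⟩
    have h1 := (Submodule.projection_apply_eq_zero_iff (W.isCompl m).symm).2 hv
    rw [map_sub, sub_eq_zero] at h1
    rw [h1]
    exact Submodule.projection_apply_of_mem_left _ hp

theorem projC_apply (m : N.constraintManifold) (v : TangentSpace 𝓘(ℝ, EM) m) :
    W.projC m v = v - W.projW m v := by
  have h := Submodule.projection_add_projection_eq_self (W.isCompl m) v
  exact eq_sub_of_add_eq h

/-- In a chart, `P_W` is smooth. -/
theorem exists_projW (hM : N.IsEmbedded EM) (hy : y ∈ (extChartAt 𝓘(ℝ, EM) x₀).target) :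
    ∃ P : EM → EM →L[ℝ] EM, ContDiffAt ℝ ∞ P y ∧ ∀ᶠ z in 𝓝 y, ∀ u,
      N.tangentInv EM x₀ z (P z u) = W.projW (N.chartInv EM x₀ z) (N.tangentInv EM x₀ z u) := by
  obtain ⟨K, hK, hKC⟩ := exists_kernel_distC hM hy
  obtain ⟨r, w, hw, hwW⟩ := W.regular.exists_frame hy
  -- C ∩ W = 0 says that the equation of C is injective on the frame of W. A vector and its
  -- W-component have the same image under K, so P_W = w n K for a left inverse n of K w.
  have hinj : Function.Injective (K y ∘L w y) := by
    refine (injective_iff_map_eq_zero (K y ∘L w y)).2 fun c hc => ?_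
    refine (injective_iff_map_eq_zero (w y)).1 hwW.self_of_nhds.1 c ?_
    have h1 := (hKC.self_of_nhds (w y c)).1 hc
    have h2 := (hwW.self_of_nhds.2 (w y c)).1 ⟨c, rfl⟩
    have h3 := (Submodule.disjoint_def.1 (W.isCompl _).disjoint) _ h1 h2
    exact tangentInv_injective hy (h3.trans (map_zero _).symm)
  obtain ⟨n, hn, hnK⟩ := exists_smooth_leftInverse (hK.clm_comp hw) hinj
  refine ⟨fun z => w z ∘L n z ∘L K z, hw.clm_comp (hn.clm_comp hK), ?_⟩
  filter_upwards [hKC, hwW, hnK, eventually_target hy] with z h1 h2 h3 hz u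
  obtain ⟨p, hp⟩ := tangentInv_surjective hz
    (W.projW (N.chartInv EM x₀ z) (N.tangentInv EM x₀ z u))
  obtain ⟨hp1, hp2⟩ := (projW_eq_iff W _ _ _).1 hp.symm
  obtain ⟨c, rfl⟩ := (h2.2 p).2 hp1
  rw [← map_sub] at hp2
  have h4 := (h1 _).2 hp2
  rw [map_sub, sub_eq_zero] at h4
  have h5 : n z (K z u) = c := by rw [h4]; exact h3 c
  change N.tangentInv EM x₀ z (w z (n z (K z u))) = _
  rw [h5, hp]

/-- In a chart, the infinitesimal generators are smooth. -/
theorem exists_generator (hM : N.IsEmbedded EM) (hfree : ∀ (g : G) (q : Q), g • q = q → g = 1)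
    (hy : y ∈ (extChartAt 𝓘(ℝ, EM) x₀).target) :
    ∃ g : EM → EM →L[ℝ] EG, ContDiffAt ℝ ∞ g y ∧ ∀ᶠ z in 𝓝 y, ∀ u ξ,
      N.tangentInv EM x₀ z u = N.generator EM EG G (N.chartInv EM x₀ z) ξ → g z u = ξ := by
  let gen : EM → EG →L[ℝ] EM := fun z =>
    (mfderiv 𝓘(ℝ, EM) 𝓘(ℝ, EM) (extChartAt 𝓘(ℝ, EM) x₀) (N.chartInv EM x₀ z)) ∘L
      N.generator EM EG G (N.chartInv EM x₀ z)
  have hgen : ContDiffAt ℝ ∞ gen y := by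
    refine contDiffAt_clm_of_apply fun ξ => ?_
    refine (contMDiffAt_mfderiv_snd (v := fun z => (⟨N.chartInv EM x₀ z,
      N.generator EM EG G (N.chartInv EM x₀ z) ξ⟩ : TangentBundle 𝓘(ℝ, EM) N.constraintManifold))
      (contMDiffAt_extChartAt_of_mem ((extChartAt 𝓘(ℝ, EM) x₀).map_target hy)) ?_).contDiffAt
    exact (contMDiff_generator G hM ξ _).comp y (contMDiffAt_extChartAt_symm hy)
  have hinj : Function.Injective (gen y) := by
    refine Function.Injective.comp (g := mfderiv 𝓘(ℝ, EM) 𝓘(ℝ, EM) (extChartAt 𝓘(ℝ, EM) x₀)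
      (N.chartInv EM x₀ y)) (fun a b h => ?_) (generator_injective hM hfree _)
    have h1 := mfderiv_symm_extChartAt_apply (I := 𝓘(ℝ, EM)) hy a
    have h2 := mfderiv_symm_extChartAt_apply (I := 𝓘(ℝ, EM)) hy b
    exact h1.symm.trans ((congrArg _ h).trans h2)
  obtain ⟨g, hg, hgg⟩ := exists_smooth_leftInverse hgen hinj
  refine ⟨g, hg, ?_⟩
  filter_upwards [hgg, eventually_target hy] with z h1 hz u ξ hu
  rw [← h1 ξ]
  refine congrArg (g z) ?_
  exact (mfderiv_extChartAt_symm_apply (I := 𝓘(ℝ, EM)) hz u).symm.trans (congrArg _ hu)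

/-- P_W(v) is vertical and the generator map is injective for a free action, so on P_W(v) the chosen
left inverse does not depend on choices. -/
theorem generator_connection (hM : N.IsEmbedded EM)
    (hfree : ∀ (g : G) (q : Q), g • q = q → g = 1) (m : N.constraintManifold)
    (v : TangentSpace 𝓘(ℝ, EM) m) :
    N.generator EM EG G m (W.connection m ![v]) = W.projW m v := by
  obtain ⟨ξ, hξ⟩ := W.vertical m ((projW_eq_iff W m v _).1 rfl).1
  have h1 : W.connection m ![v] =
      linearLeftInverse (N.generator EM EG G m).toLinearMap (W.projW m v) := rfl
  rw [h1, ← hξ]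
  refine congrArg (N.generator EM EG G m) ?_
  exact linearLeftInverse_apply_apply (f := (N.generator EM EG G m).toLinearMap)
    (generator_injective hM hfree m) ξ

theorem connection_eq_zero (m : N.constraintManifold)
    {v : TangentSpace 𝓘(ℝ, EM) m} (hv : v ∈ N.distC EM m) : W.connection m ![v] = 0 := by
  have h1 : W.connection m ![v] =
      linearLeftInverse (N.generator EM EG G m).toLinearMap (W.projW m v) := rfl
  have h2 : W.projW m v = 0 :=
    (projW_eq_iff W m v 0).2 ⟨Submodule.zero_mem _, by rwa [sub_zero]⟩
  rw [h1, h2, map_zero]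

theorem inChart_one_apply {V : Type*} [NormedAddCommGroup V] [NormedSpace ℝ V]
    (w : Form 𝓘(ℝ, EM) N.constraintManifold V 1) (z : EM) (v : Fin 1 → EM) :
    w.inChart x₀ z v = w (N.chartInv EM x₀ z) ![N.tangentInv EM x₀ z (v 0)] := by
  change w (N.chartInv EM x₀ z) (fun i => N.tangentInv EM x₀ z (v i)) = _
  congr 1
  ext i; fin_cases i; rfl

theorem smooth_connection (hM : N.IsEmbedded EM)
    (hfree : ∀ (g : G) (q : Q), g • q = q → g = 1) : W.connection.Smooth := by
  refine Form.smooth_of_apply fun x₀ y hy v => ?_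
  obtain ⟨P, hP, hPW⟩ := exists_projW W hM hy
  obtain ⟨g, hg, hgg⟩ := exists_generator (EG := EG) hM hfree hy
  have h : ContDiffAt ℝ ∞ (fun z => g z (P z (v 0))) y :=
    hg.clm_apply (hP.clm_apply contDiffAt_const)
  refine h.congr_of_eventuallyEq ?_
  filter_upwards [hPW, hgg] with z h1 h2
  rw [inChart_one_apply]
  refine (h2 _ _ ?_).symm
  rw [generator_connection W hM hfree, h1]

end NonholonomicSystem

/-! ### The Jacobi identity for the gauged bivector field -/

namespace NonholonomicSystem

variable {E : Type*} [NormedAddCommGroup E] [NormedSpace ℝ E] [FiniteDimensional ℝ E]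
  {Q : Type*} [TopologicalSpace Q] [ChartedSpace E Q] [IsManifold 𝓘(ℝ, E) ∞ Q]
  {N : NonholonomicSystem E Q}
  {EM : Type*} [NormedAddCommGroup EM] [NormedSpace ℝ EM] [FiniteDimensional ℝ EM]
  [ChartedSpace EM N.constraintManifold] [IsManifold 𝓘(ℝ, EM) ∞ N.constraintManifold]
  {EG : Type*} [NormedAddCommGroup EG] [NormedSpace ℝ EG] [FiniteDimensional ℝ EG]
  {G : Type*} [TopologicalSpace G] [ChartedSpace EG G] [Group G] [LieGroup 𝓘(ℝ, EG) ∞ G]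
  [MulAction G Q] [ContMDiffSMul 𝓘(ℝ, EG) 𝓘(ℝ, E) ∞ G Q] [hG : N.IsSymmetry G]
  {x₀ : N.constraintManifold} {y : EM}

section InChart

variable {V : Type*} [NormedAddCommGroup V] [NormedSpace ℝ V]

theorem inChart_two_apply (w : Form 𝓘(ℝ, EM) N.constraintManifold V 2) (z a b : EM) :
    w.inChart x₀ z ![a, b] =
      w (N.chartInv EM x₀ z) ![N.tangentInv EM x₀ z a, N.tangentInv EM x₀ z b] := by
  change w (N.chartInv EM x₀ z) (fun i => N.tangentInv EM x₀ z (![a, b] i)) = _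
  congr 1
  ext i; fin_cases i <;> rfl

theorem inChart_three_apply (w : Form 𝓘(ℝ, EM) N.constraintManifold V 3) (z a b c : EM) :
    w.inChart x₀ z ![a, b, c] = w (N.chartInv EM x₀ z)
      ![N.tangentInv EM x₀ z a, N.tangentInv EM x₀ z b, N.tangentInv EM x₀ z c] := by
  change w (N.chartInv EM x₀ z) (fun i => N.tangentInv EM x₀ z (![a, b, c] i)) = _
  congr 1
  ext i; fin_cases i <;> rfl

theorem contDiffAt_alternating_two {X F : Type*} [NormedAddCommGroup X] [NormedSpace ℝ X]
    [NormedAddCommGroup F] [NormedSpace ℝ F] [FiniteDimensional ℝ V]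
    {θ : X → F [⋀^Fin 2]→L[ℝ] V} {a b : X → F} {x : X} (hθ : ContDiffAt ℝ ∞ θ x)
    (ha : ContDiffAt ℝ ∞ a x) (hb : ContDiffAt ℝ ∞ b x) :
    ContDiffAt ℝ ∞ (fun z => θ z ![a z, b z]) x :=
  contDiffAt_alternating_apply (v := fun z => ![a z, b z]) hθ fun i => by
    fin_cases i
    · exact ha
    · exact hb

end InChart

variable (W : N.VerticalComplement EM EG G)

theorem dJK_apply (m : N.constraintManifold) (X Y Z : TangentSpace 𝓘(ℝ, EM) m) :
    W.dJK m ![X, Y, Z] =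
      N.dMomentum EM EG G m Z (W.connection.d m ![W.projC m X, W.projC m Y]) +
      N.dMomentum EM EG G m X (W.connection.d m ![W.projC m Y, W.projC m Z]) +
      N.dMomentum EM EG G m Y (W.connection.d m ![W.projC m Z, W.projC m X]) := by
  have h : ∀ X Y : TangentSpace 𝓘(ℝ, EM) m, W.curvature m ![X, Y] =
      W.connection.d m ![W.projC m X, W.projC m Y] := fun X Y => by
    change W.connection.d m (fun i => W.projC m (![X, Y] i)) = _
    congr 1
    ext i; fin_cases i <;> rfl
  rw [← h, ← h, ← h]
  exact cyclicWedge_apply _ _ X Y Z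

theorem dMomentum_tangentInv (hM : N.IsEmbedded EM)
    (hy : y ∈ (extChartAt 𝓘(ℝ, EM) x₀).target) (u : EM) :
    N.dMomentum EM EG G (N.chartInv EM x₀ y) (N.tangentInv EM x₀ y u) =
      fderiv ℝ (N.momentum EM EG G ∘ N.chartInv EM x₀) y u := by
  have h := mfderiv_comp_clm (f := N.chartInv EM x₀) (g := N.momentum EM EG G) (x := y)
    ((contMDiff_momentum EG G hM _).mdifferentiableAt (by simp))
    ((contMDiffAt_extChartAt_symm hy).mdifferentiableAt (by simp)) u
  rw [mfderiv_eq_fderiv] at h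
  exact h.symm

theorem smooth_dJK (hM : N.IsEmbedded EM)
    (hfree : ∀ (g : G) (q : Q), g • q = q → g = 1) : W.dJK.Smooth := by
  refine Form.smooth_of_apply fun x₀ y hy v => ?_
  obtain ⟨a, b, c, rfl⟩ : ∃ a b c, v = ![a, b, c] :=
    ⟨v 0, v 1, v 2, by ext i; fin_cases i <;> rfl⟩
  obtain ⟨P, hP, hPW⟩ := exists_projW W hM hy
  have hA := ((smooth_connection W hM hfree).d).contDiffAt hy
  have hJ : ContDiffAt ℝ ∞ (fderiv ℝ (N.momentum EM EG G ∘ N.chartInv EM x₀)) y :=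
    ((contMDiff_momentum EG G hM _).comp y
      (contMDiffAt_extChartAt_symm hy)).contDiffAt.fderiv_right (by simp)
  have hR : ∀ a : EM, ContDiffAt ℝ ∞ (fun z => a - P z a) y := fun a =>
    contDiffAt_const.sub (hP.clm_apply contDiffAt_const)
  have hterm : ∀ a b c : EM, ContDiffAt ℝ ∞ (fun z =>
      fderiv ℝ (N.momentum EM EG G ∘ N.chartInv EM x₀) z c
        (W.connection.d.inChart x₀ z ![a - P z a, b - P z b])) y := fun a b c =>
    (hJ.clm_apply contDiffAt_const).clm_apply (contDiffAt_alternating_two hA (hR a) (hR b))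
  refine (((hterm a b c).add (hterm b c a)).add (hterm c a b)).congr_of_eventuallyEq ?_
  filter_upwards [hPW, eventually_target hy] with z h1 hz
  have hC : ∀ a : EM, N.tangentInv EM x₀ z (a - P z a) =
      W.projC (N.chartInv EM x₀ z) (N.tangentInv EM x₀ z a) := fun a => by
    rw [map_sub, h1, projC_apply]
  have hk : ∀ a b : EM, W.connection.d.inChart x₀ z ![a - P z a, b - P z b] =
      W.connection.d (N.chartInv EM x₀ z) ![W.projC _ (N.tangentInv EM x₀ z a),
        W.projC _ (N.tangentInv EM x₀ z b)] := fun a b => by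
    rw [← hC, ← hC]
    exact inChart_two_apply W.connection.d z _ _
  rw [inChart_three_apply, dJK_apply]
  simp only [hk, ← dMomentum_tangentInv hM hz]

/-- In a chart, `π_B` is smooth. -/
theorem exists_piB (W : N.VerticalComplement EM EG G) (hM : N.IsEmbedded EM)
    {B : Form 𝓘(ℝ, EM) N.constraintManifold ℝ 2} (hB : B.Smooth)
    (hgauge : ∀ m, Function.Bijective (gaugeEnd (N.piNH EM m) (B m)))
    (hy : y ∈ (extChartAt 𝓘(ℝ, EM) x₀).target) :
    ∃ S : EM → (EM →L[ℝ] ℝ) →L[ℝ] EM, ContDiffAt ℝ ∞ S y ∧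
      ∀ᶠ z in 𝓝 y, ∀ α : TangentSpace 𝓘(ℝ, EM) (N.chartInv EM x₀ z) →L[ℝ] ℝ,
        N.tangentInv EM x₀ z (S z (α ∘L N.tangentInv EM x₀ z)) =
          N.piB EM B (N.chartInv EM x₀ z) α := by
  obtain ⟨P, hP, hPW⟩ := exists_projW W hM hy
  have hθ := (smooth_gaugedForm hM hB).contDiffAt hy
  let R : EM → EM →L[ℝ] EM := fun z => ContinuousLinearMap.id ℝ EM - P z
  have hR : ContDiffAt ℝ ∞ R y := contDiffAt_const.sub hP
  let b : EM → EM →L[ℝ] EM →L[ℝ] ℝ := fun z =>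
    LinearMap.toContinuousLinearMap (flat ((N.gaugedForm EM B).inChart x₀ z))
  -- To avoid inverting a form on a moving subspace, C is imposed by P u = 0 and both arguments of
  -- Ω_M - B are projected to C by R. Nondegeneracy on C makes w(z) injective; with a smooth left
  -- inverse μ the field is α ↦ -μ(α ∘ R, 0).
  let w : EM → EM →L[ℝ] (EM →L[ℝ] ℝ) × EM := fun z => ((b z).bilinearComp (R z) (R z)).prod (P z)
  have hw1 : ∀ z u v, (w z u).1 v = (N.gaugedForm EM B).inChart x₀ z ![R z u, R z v] :=
    fun z u v => rfl
  have hw : ContDiffAt ℝ ∞ w y := by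
    refine contDiffAt_clm_of_apply fun u => ?_
    refine ContDiffAt.prodMk (contDiffAt_clm_of_apply fun v => ?_) (hP.clm_apply contDiffAt_const)
    exact contDiffAt_alternating_two hθ (hR.clm_apply contDiffAt_const)
      (hR.clm_apply contDiffAt_const)
  have hRC : ∀ᶠ z in 𝓝 y, ∀ u, (N.tangentInv EM x₀ z u ∈ N.distC EM (N.chartInv EM x₀ z) →
      P z u = 0) ∧ N.tangentInv EM x₀ z (R z u) ∈ N.distC EM (N.chartInv EM x₀ z) := by
    filter_upwards [hPW, eventually_target hy] with z h1 hz u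
    constructor
    · intro hu
      refine tangentInv_injective hz ((h1 u).trans (Eq.trans ?_ (map_zero _).symm))
      exact (projW_eq_iff W _ _ _).2 ⟨Submodule.zero_mem _, by rwa [sub_zero]⟩
    · change N.tangentInv EM x₀ z (u - P z u) ∈ _
      rw [map_sub, h1]
      exact ((projW_eq_iff W _ _ _).1 rfl).2
  have hinj : Function.Injective (w y) := by
    refine (injective_iff_map_eq_zero (w y)).2 fun u hu => ?_
    have h2 : P y u = 0 := congrArg Prod.snd hu
    have hRu : R y u = u := by
      change u - P y u = u
      rw [h2, sub_zero]
    have hC := (hRC.self_of_nhds u).2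
    rw [hRu] at hC
    refine tangentInv_injective hy (Eq.trans ?_ (map_zero _).symm)
    refine gaugedForm_nondegenerate hM hgauge _ hC fun Y hY => ?_
    obtain ⟨v, rfl⟩ := tangentInv_surjective hy Y
    have hRv : R y v = v := by
      change v - P y v = v
      rw [(hRC.self_of_nhds v).1 hY, sub_zero]
    have h3 : (w y u).1 v = 0 := by rw [hu]; rfl
    rw [hw1, hRu, hRv, inChart_two_apply] at h3
    exact h3
  obtain ⟨μ, hμ, hμw⟩ := exists_smooth_leftInverse hw hinj
  refine ⟨fun z => -(μ z ∘L ContinuousLinearMap.inl ℝ (EM →L[ℝ] ℝ) EM ∘L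
    (ContinuousLinearMap.compL ℝ EM EM ℝ).flip (R z)), ?_, ?_⟩
  · refine (hμ.clm_comp (contDiffAt_const.clm_comp ?_)).neg
    exact contDiffAt_clm_of_apply fun a => (contDiffAt_const (c := a)).clm_comp hR
  · filter_upwards [hRC, hμw, eventually_target hy] with z h1 h2 hz α
    obtain ⟨u, hu⟩ := tangentInv_surjective hz (N.piB EM B (N.chartInv EM x₀ z) α)
    have hC : N.tangentInv EM x₀ z u ∈ N.distC EM (N.chartInv EM x₀ z) := by
      rw [hu]; exact piB_mem _ _
    have hPu := (h1 u).1 hC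
    have hwu : w z u = -((α ∘L N.tangentInv EM x₀ z) ∘L R z, (0 : EM)) := by
      refine Prod.ext ?_ (hPu.trans neg_zero.symm)
      ext v
      have hRu : R z u = u := by
        change u - P z u = u
        rw [hPu, sub_zero]
      rw [hw1, hRu, inChart_two_apply, hu]
      exact piB_spec hM hgauge _ α (h1 v).2
    rw [← hu]
    refine congrArg (N.tangentInv EM x₀ z) ?_
    have h3 := h2 u
    rw [hwu, map_neg] at h3
    exact h3

end NonholonomicSystem

namespace NonholonomicSystem

variable {E : Type*} [NormedAddCommGroup E] [NormedSpace ℝ E] [FiniteDimensional ℝ E]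
  {Q : Type*} [TopologicalSpace Q] [ChartedSpace E Q] [IsManifold 𝓘(ℝ, E) ∞ Q]
  {N : NonholonomicSystem E Q}
  {EM : Type*} [NormedAddCommGroup EM] [NormedSpace ℝ EM] [FiniteDimensional ℝ EM]
  [ChartedSpace EM N.constraintManifold] [IsManifold 𝓘(ℝ, EM) ∞ N.constraintManifold]
  {EG : Type*} [NormedAddCommGroup EG] [NormedSpace ℝ EG] [FiniteDimensional ℝ EG]
  {G : Type*} [TopologicalSpace G] [ChartedSpace EG G] [Group G] [LieGroup 𝓘(ℝ, EG) ∞ G]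
  [MulAction G Q] [ContMDiffSMul 𝓘(ℝ, EG) 𝓘(ℝ, E) ∞ G Q] [hG : N.IsSymmetry G]
  {x₀ : N.constraintManifold} {y : EM}

theorem exists_comp_tangentInv (hy : y ∈ (extChartAt 𝓘(ℝ, EM) x₀).target) (a : EM →L[ℝ] ℝ) :
    ∃ α : TangentSpace 𝓘(ℝ, EM) (N.chartInv EM x₀ y) →L[ℝ] ℝ,
      α ∘L N.tangentInv EM x₀ y = a := by
  refine ⟨a ∘L (mfderiv 𝓘(ℝ, EM) 𝓘(ℝ, EM) (extChartAt 𝓘(ℝ, EM) x₀) (N.chartInv EM x₀ y)), ?_⟩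
  ext u
  exact congrArg a (mfderiv_extChartAt_symm_apply (I := 𝓘(ℝ, EM)) hy u)

theorem alternating_neg {T V : Type*} [AddCommGroup T] [Module ℝ T] [TopologicalSpace T]
    [AddCommGroup V] [Module ℝ V] [TopologicalSpace V] {k : ℕ} (w : T [⋀^Fin k]→L[ℝ] V)
    (v : Fin k → T) : w (fun i => -v i) = (-1 : ℝ) ^ k • w v := by
  have h := w.toMultilinearMap.map_smul_univ (fun _ => (-1 : ℝ)) v
  simp only [neg_one_smul, Finset.prod_const, Finset.card_univ, Fintype.card_fin] at h
  exact h

theorem alternating_neg_two {T V : Type*} [AddCommGroup T] [Module ℝ T] [TopologicalSpace T]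
    [AddCommGroup V] [Module ℝ V] [TopologicalSpace V] (w : T [⋀^Fin 2]→L[ℝ] V)
    (a b : T) : w ![-a, -b] = w ![a, b] := by
  have h := alternating_neg w ![a, b]
  have e : (fun i => -(![a, b] : Fin 2 → T) i) = ![-a, -b] := by
    ext i; fin_cases i <;> rfl
  rw [e] at h
  simpa using h

theorem alternating_neg_three {T V : Type*} [AddCommGroup T] [Module ℝ T] [TopologicalSpace T]
    [AddCommGroup V] [Module ℝ V] [TopologicalSpace V] (w : T [⋀^Fin 3]→L[ℝ] V)
    (a b c : T) : w ![-a, -b, -c] = -w ![a, b, c] := by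
  have h := alternating_neg w ![a, b, c]
  have e : (fun i => -(![a, b, c] : Fin 3 → T) i) = ![-a, -b, -c] := by
    ext i; fin_cases i <;> rfl
  rw [e] at h
  rw [h, (by norm_num : (-1 : ℝ) ^ 3 = -1), neg_one_smul]

/-- This is `jacobi_core` with S = C, θ = Ω_M - B, A = A_W and `l` the pairing with dJ. The vector
`w` of the decomposition is P_W(v): the df_i kill it because it is vertical, B because it lies in W,
and Ω_M contracts it to the differential of a component of the momentum map. -/
theorem jacobi_piB (W : N.VerticalComplement EM EG G) (hM : N.IsEmbedded EM)
    (hfree : ∀ (g : G) (q : Q), g • q = q → g = 1)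
    {B : Form 𝓘(ℝ, EM) N.constraintManifold ℝ 2} (hB : B.Smooth)
    (hBW : ∀ m, ∀ Z ∈ W.dist m, flat (B m) Z = 0)
    (hgauge : ∀ m, Function.Bijective (gaugeEnd (N.piNH EM m) (B m)))
    (hy : y ∈ (extChartAt 𝓘(ℝ, EM) x₀).target)
    {S : EM → (EM →L[ℝ] ℝ) →L[ℝ] EM} (hS : ContDiffAt ℝ ∞ S y)
    (hSB : ∀ᶠ z in 𝓝 y, ∀ α : TangentSpace 𝓘(ℝ, EM) (N.chartInv EM x₀ z) →L[ℝ] ℝ,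
        N.tangentInv EM x₀ z (S z (α ∘L N.tangentInv EM x₀ z)) =
          N.piB EM B (N.chartInv EM x₀ z) α)
    {f : Fin 3 → EM → ℝ} (hf : ∀ i, ContDiffAt ℝ ∞ (f i) y)
    (hfV : ∀ i u ξ, N.tangentInv EM x₀ y u = N.generator EM EG G (N.chartInv EM x₀ y) ξ →
      fderiv ℝ (f i) y u = 0) :
    fderiv ℝ (fun z => fderiv ℝ (f 2) z (S z (fderiv ℝ (f 1) z))) y (S y (fderiv ℝ (f 0) y)) +
      fderiv ℝ (fun z => fderiv ℝ (f 0) z (S z (fderiv ℝ (f 2) z))) y (S y (fderiv ℝ (f 1) y)) +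
      fderiv ℝ (fun z => fderiv ℝ (f 1) z (S z (fderiv ℝ (f 0) z))) y (S y (fderiv ℝ (f 2) y)) =
    (B.d (N.chartInv EM x₀ y) + W.dJK (N.chartInv EM x₀ y))
      ![N.tangentInv EM x₀ y (S y (fderiv ℝ (f 0) y)),
        N.tangentInv EM x₀ y (S y (fderiv ℝ (f 1) y)),
        N.tangentInv EM x₀ y (S y (fderiv ℝ (f 2) y))] := by
  let θ := (N.gaugedForm EM B).inChart x₀
  let A := W.connection.inChart x₀
  have hθ := (smooth_gaugedForm hM hB).contDiffAt hy
  have hA := (smooth_connection W hM hfree).contDiffAt hy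
  let D : EM → Submodule ℝ EM := fun z =>
    (N.distC EM (N.chartInv EM x₀ z)).comap (N.tangentInv EM x₀ z).toLinearMap
  let X : Fin 3 → EM → EM := fun i z => -S z (fderiv ℝ (f i) z)
  have hdf : ∀ i, ContDiffAt ℝ ∞ (fderiv ℝ (f i)) y := fun i => (hf i).fderiv_right (by simp)
  have hX : ∀ i, DifferentiableAt ℝ (X i) y := fun i =>
    ((hS.clm_apply (hdf i)).differentiableAt (by simp)).neg
  have hSz : ∀ᶠ z in 𝓝 y, ∀ a : EM →L[ℝ] ℝ, S z a ∈ D z ∧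
      ∀ v ∈ D z, θ z ![S z a, v] = -a v := by
    filter_upwards [hSB, eventually_target hy] with z h1 hz a
    obtain ⟨α, rfl⟩ := exists_comp_tangentInv hz a
    have h2 := h1 α
    constructor
    · change N.tangentInv EM x₀ z _ ∈ N.distC EM _
      rw [h2]
      exact piB_mem _ _
    · intro v hv
      have h3 := piB_spec hM hgauge _ α hv
      rw [← h2] at h3
      exact (inChart_two_apply (N.gaugedForm EM B) z _ _).trans h3
  have hneg : ∀ z (u v : EM), θ z ![-u, v] = -θ z ![u, v] := fun z u v =>
    DFunLike.congr_fun (map_neg (flat (θ z)) u) v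
  have hXS : ∀ᶠ z in 𝓝 y, ∀ i, X i z ∈ D z := by
    filter_upwards [hSz] with z h i
    exact (D z).neg_mem (h _).1
  have hXf : ∀ᶠ z in 𝓝 y, ∀ i, ∀ v ∈ D z, θ z ![X i z, v] = fderiv ℝ (f i) z v := by
    filter_upwards [hSz] with z h i v hv
    rw [hneg, (h _).2 v hv, neg_neg]
  have hAD : ∀ᶠ z in 𝓝 y, ∀ v ∈ D z, A z ![v] = 0 := by
    refine Filter.Eventually.of_forall fun z v hv => ?_
    exact (inChart_one_apply W.connection z ![v]).trans (connection_eq_zero W _ hv)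
  let l : EM → EG → ℝ := fun v a =>
    N.dMomentum EM EG G (N.chartInv EM x₀ y) (N.tangentInv EM x₀ y v) a
  have hdec : ∀ v, ∃ w, v - w ∈ D y ∧ (∀ i, fderiv ℝ (f i) y w = 0) ∧
      ∀ c ∈ D y, θ y ![w, c] = l c (A y ![v]) := by
    intro v
    obtain ⟨w, hw⟩ := tangentInv_surjective hy
      (W.projW (N.chartInv EM x₀ y) (N.tangentInv EM x₀ y v))
    have hAv : A y ![v] = W.connection (N.chartInv EM x₀ y) ![N.tangentInv EM x₀ y v] :=
      inChart_one_apply W.connection y ![v]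
    have hgen := (generator_connection W hM hfree _ (N.tangentInv EM x₀ y v)).trans hw.symm
    rw [← hAv] at hgen
    obtain ⟨h1, h2⟩ := (projW_eq_iff W _ _ _).1 hw.symm
    refine ⟨w, ?_, fun i => hfV i w _ hgen.symm, fun c hc => ?_⟩
    · change N.tangentInv EM x₀ y (v - w) ∈ N.distC EM _
      rw [map_sub]
      exact h2
    · refine (inChart_two_apply (N.gaugedForm EM B) y w c).trans ?_
      change N.omegaM EM _ ![N.tangentInv EM x₀ y w, N.tangentInv EM x₀ y c] -
        flat (B _) (N.tangentInv EM x₀ y w) (N.tangentInv EM x₀ y c) = _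
      rw [hBW _ _ h1, ← hgen, omegaM_generator hM]
      exact sub_zero _
  have key := jacobi_core (θ := θ) (A := A) (X := X) (f := f) (S := D) (l := l)
    (hθ.differentiableAt (by simp)) (hA.differentiableAt (by simp)) hX
    (fun i => (hf i).of_le (WithTop.coe_le_coe.2 (le_top : (2 : ℕ∞) ≤ ⊤))) hXS hXf hAD
    (fun v a => map_neg _ a) hdec
  have hterm : ∀ i j k, fderiv ℝ (fun z => -fderiv ℝ (f j) z (X i z)) y (X k y) =
      -fderiv ℝ (fun z => fderiv ℝ (f j) z (S z (fderiv ℝ (f i) z))) y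
        (S y (fderiv ℝ (f k) y)) := by
    intro i j k
    simp only [X, map_neg, neg_neg]
  rw [hterm, hterm, hterm] at key
  have hdθ : extDeriv θ y = -B.d.inChart x₀ y := extDeriv_gaugedForm hM hB hy
  have hdA : extDeriv A y = W.connection.d.inChart x₀ y :=
    (smooth_connection W hM hfree).extDeriv_along (contMDiffAt_extChartAt_symm hy)
  have hC : ∀ i, W.projC (N.chartInv EM x₀ y) (N.tangentInv EM x₀ y (S y (fderiv ℝ (f i) y))) =
      N.tangentInv EM x₀ y (S y (fderiv ℝ (f i) y)) := by
    intro i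
    have h : W.projW (N.chartInv EM x₀ y) (N.tangentInv EM x₀ y (S y (fderiv ℝ (f i) y))) = 0 := by
      refine (projW_eq_iff W _ _ _).2 ⟨Submodule.zero_mem _, ?_⟩
      rw [sub_zero]
      exact (hSz.self_of_nhds _).1
    rw [projC_apply, h, sub_zero]
  -- Sign count for X_i = -π_B(df_i): the curvature takes two of these vectors and keeps its sign,
  -- `l` takes one and changes it, and dθ = -dB takes three, which cancels its own sign.
  have hk : ∀ i j, extDeriv A y ![X i y, X j y] = W.connection.d (N.chartInv EM x₀ y)
      ![N.tangentInv EM x₀ y (S y (fderiv ℝ (f i) y)),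
        N.tangentInv EM x₀ y (S y (fderiv ℝ (f j) y))] := by
    intro i j
    rw [hdA]
    refine (alternating_neg_two _ _ _).trans ?_
    exact inChart_two_apply W.connection.d y _ _
  have hl : ∀ i a, l (X i y) a = -N.dMomentum EM EG G (N.chartInv EM x₀ y)
      (N.tangentInv EM x₀ y (S y (fderiv ℝ (f i) y))) a := by
    intro i a
    simp only [l, X, map_neg]
    rfl
  have hB3 : extDeriv θ y ![X 0 y, X 1 y, X 2 y] = B.d (N.chartInv EM x₀ y)
      ![N.tangentInv EM x₀ y (S y (fderiv ℝ (f 0) y)),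
        N.tangentInv EM x₀ y (S y (fderiv ℝ (f 1) y)),
        N.tangentInv EM x₀ y (S y (fderiv ℝ (f 2) y))] := by
    rw [hdθ]
    have h1 := alternating_neg_three (B.d.inChart x₀ y) (S y (fderiv ℝ (f 0) y))
      (S y (fderiv ℝ (f 1) y)) (S y (fderiv ℝ (f 2) y))
    have h2 := inChart_three_apply (x₀ := x₀) B.d y (S y (fderiv ℝ (f 0) y))
      (S y (fderiv ℝ (f 1) y)) (S y (fderiv ℝ (f 2) y))
    exact (congrArg Neg.neg (h1.trans (congrArg Neg.neg h2))).trans (neg_neg _)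
  have hJ := dJK_apply (W := W) (N.chartInv EM x₀ y)
    (N.tangentInv EM x₀ y (S y (fderiv ℝ (f 0) y)))
    (N.tangentInv EM x₀ y (S y (fderiv ℝ (f 1) y)))
    (N.tangentInv EM x₀ y (S y (fderiv ℝ (f 2) y)))
  rw [hC, hC, hC] at hJ
  rw [hB3, hl, hl, hl, hk, hk, hk] at key
  have combine : ∀ a b c p d₁ d₂ d₃ j : ℝ, - -a - -b - -c = p - (-d₁ + -d₂ + -d₃) →
      j = d₁ + d₂ + d₃ → a + b + c = p + j := by
    intros; linarith
  exact combine _ _ _ _ _ _ _ _ key hJ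

end NonholonomicSystem

/-! ### Bivector fields in charts -/

section SharpFields

variable {E : Type*} [NormedAddCommGroup E] [NormedSpace ℝ E] [FiniteDimensional ℝ E]
  {P : Type*} [TopologicalSpace P] [ChartedSpace E P] [IsManifold 𝓘(ℝ, E) ∞ P]
  {π : SharpField 𝓘(ℝ, E) P} {x₀ : P} {y : E}

namespace SharpField

/-- The image of a map `π♯ : T* → T` under a linear map `L`, i.e. `L ∘ π♯ ∘ L^*`. -/
def _root_.Nonholonomic.sharpMap {T : Type*} [AddCommGroup T] [Module ℝ T] [TopologicalSpace T]
    (L : T →L[ℝ] E) (p : (T →L[ℝ] ℝ) →ₗ[ℝ] T) : (E →L[ℝ] ℝ) →ₗ[ℝ] E :=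
  L.toLinearMap ∘ₗ p ∘ₗ
    { toFun := fun a => a ∘L L
      map_add' := fun a b => ContinuousLinearMap.add_comp a b L
      map_smul' := fun c a => ContinuousLinearMap.smul_comp c a L }

/-- The local representative of a bivector field in the chart at `x₀`. -/
def inChart (π : SharpField 𝓘(ℝ, E) P) (x₀ : P) (y : E) : (E →L[ℝ] ℝ) →L[ℝ] E :=
  LinearMap.toContinuousLinearMap (sharpMap (mfderiv 𝓘(ℝ, E) 𝓘(ℝ, E) (extChartAt 𝓘(ℝ, E) x₀)
    ((extChartAt 𝓘(ℝ, E) x₀).symm y)) (π ((extChartAt 𝓘(ℝ, E) x₀).symm y)))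

theorem inChart_apply (a : E →L[ℝ] ℝ) :
    π.inChart x₀ y a = mfderiv 𝓘(ℝ, E) 𝓘(ℝ, E) (extChartAt 𝓘(ℝ, E) x₀)
      ((extChartAt 𝓘(ℝ, E) x₀).symm y)
      (π ((extChartAt 𝓘(ℝ, E) x₀).symm y) (a ∘L mfderiv 𝓘(ℝ, E) 𝓘(ℝ, E)
        (extChartAt 𝓘(ℝ, E) x₀) ((extChartAt 𝓘(ℝ, E) x₀).symm y))) := rfl

theorem mfderiv_symm_inChart (hy : y ∈ (extChartAt 𝓘(ℝ, E) x₀).target)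
    (α : TangentSpace 𝓘(ℝ, E) ((extChartAt 𝓘(ℝ, E) x₀).symm y) →L[ℝ] ℝ) :
    mfderiv 𝓘(ℝ, E) 𝓘(ℝ, E) (extChartAt 𝓘(ℝ, E) x₀).symm y
      (π.inChart x₀ y (α ∘L mfderiv 𝓘(ℝ, E) 𝓘(ℝ, E) (extChartAt 𝓘(ℝ, E) x₀).symm y)) =
    π ((extChartAt 𝓘(ℝ, E) x₀).symm y) α := by
  rw [inChart_apply]
  refine (mfderiv_symm_extChartAt_apply hy _).trans (congrArg (π _) ?_)
  ext v
  exact congrArg α (mfderiv_symm_extChartAt_apply hy v)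

theorem inChart_eq (hy : y ∈ (extChartAt 𝓘(ℝ, E) x₀).target) {S : (E →L[ℝ] ℝ) →L[ℝ] E}
    (hS : ∀ α : TangentSpace 𝓘(ℝ, E) ((extChartAt 𝓘(ℝ, E) x₀).symm y) →L[ℝ] ℝ,
      mfderiv 𝓘(ℝ, E) 𝓘(ℝ, E) (extChartAt 𝓘(ℝ, E) x₀).symm y
        (S (α ∘L mfderiv 𝓘(ℝ, E) 𝓘(ℝ, E) (extChartAt 𝓘(ℝ, E) x₀).symm y)) =
      π ((extChartAt 𝓘(ℝ, E) x₀).symm y) α) : π.inChart x₀ y = S := by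
  ext a
  rw [inChart_apply, ← hS]
  refine (mfderiv_extChartAt_symm_apply hy _).trans (congrArg S ?_)
  ext v
  exact congrArg a (mfderiv_extChartAt_symm_apply hy v)

theorem inChart_skew (h : ∀ (x : P) (α β : TangentSpace 𝓘(ℝ, E) x →L[ℝ] ℝ),
      β (π x α) = -α (π x β)) (a b : E →L[ℝ] ℝ) :
    b (π.inChart x₀ y a) = -a (π.inChart x₀ y b) :=
  h _ (a ∘L mfderiv 𝓘(ℝ, E) 𝓘(ℝ, E) (extChartAt 𝓘(ℝ, E) x₀) ((extChartAt 𝓘(ℝ, E) x₀).symm y))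
    (b ∘L mfderiv 𝓘(ℝ, E) 𝓘(ℝ, E) (extChartAt 𝓘(ℝ, E) x₀) ((extChartAt 𝓘(ℝ, E) x₀).symm y))

/-- A bivector field is smooth if its local representatives are. -/
def Smooth (π : SharpField 𝓘(ℝ, E) P) : Prop :=
  ∀ x₀ : P, ContDiffOn ℝ ∞ (π.inChart x₀) (extChartAt 𝓘(ℝ, E) x₀).target

theorem Smooth.contDiffAt (h : π.Smooth) (hy : y ∈ (extChartAt 𝓘(ℝ, E) x₀).target) :
    ContDiffAt ℝ ∞ (π.inChart x₀) y :=
  (h x₀).contDiffAt ((isOpen_extChartAt_target (I := 𝓘(ℝ, E)) x₀).mem_nhds hy)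

theorem diff_comp_mfderiv_symm (hy : y ∈ (extChartAt 𝓘(ℝ, E) x₀).target) {f : P → ℝ}
    (hf : MDifferentiableAt 𝓘(ℝ, E) 𝓘(ℝ, ℝ) f ((extChartAt 𝓘(ℝ, E) x₀).symm y)) (v : E) :
    diff 𝓘(ℝ, E) f ((extChartAt 𝓘(ℝ, E) x₀).symm y)
      (mfderiv 𝓘(ℝ, E) 𝓘(ℝ, E) (extChartAt 𝓘(ℝ, E) x₀).symm y v) =
    fderiv ℝ (f ∘ (extChartAt 𝓘(ℝ, E) x₀).symm) y v := by
  rw [← mfderiv_eq_fderiv]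
  exact (mfderiv_comp_clm hf
    ((contMDiffAt_extChartAt_symm hy).mdifferentiableAt (by simp)) v).symm

theorem bracket_symm (hy : y ∈ (extChartAt 𝓘(ℝ, E) x₀).target) {f g : P → ℝ}
    (hf : MDifferentiableAt 𝓘(ℝ, E) 𝓘(ℝ, ℝ) f ((extChartAt 𝓘(ℝ, E) x₀).symm y))
    (hg : MDifferentiableAt 𝓘(ℝ, E) 𝓘(ℝ, ℝ) g ((extChartAt 𝓘(ℝ, E) x₀).symm y)) :
    π.bracket f g ((extChartAt 𝓘(ℝ, E) x₀).symm y) =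
      fderiv ℝ (g ∘ (extChartAt 𝓘(ℝ, E) x₀).symm) y
        (π.inChart x₀ y (fderiv ℝ (f ∘ (extChartAt 𝓘(ℝ, E) x₀).symm) y)) := by
  unfold bracket
  rw [← mfderiv_symm_inChart hy]
  refine (diff_comp_mfderiv_symm hy hg _).trans ?_
  congr 2
  ext v
  exact diff_comp_mfderiv_symm hy hf v

theorem Smooth.contMDiffAt_bracket (h : π.Smooth) {f g : P → ℝ} {x : P}
    (hf : ContMDiffAt 𝓘(ℝ, E) 𝓘(ℝ, ℝ) ∞ f x) (hg : ContMDiffAt 𝓘(ℝ, E) 𝓘(ℝ, ℝ) ∞ g x) :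
    ContMDiffAt 𝓘(ℝ, E) 𝓘(ℝ, ℝ) ∞ (π.bracket f g) x := by
  have hx := mem_extChartAt_target (I := 𝓘(ℝ, E)) x
  have hxs := extChartAt_to_inv (I := 𝓘(ℝ, E)) x
  have comp : ∀ {f : P → ℝ}, ContMDiffAt 𝓘(ℝ, E) 𝓘(ℝ, ℝ) ∞ f x →
      ContDiffAt ℝ ∞ (f ∘ (extChartAt 𝓘(ℝ, E) x).symm) (extChartAt 𝓘(ℝ, E) x x) := by
    intro f hf
    refine (ContMDiffAt.comp (extChartAt 𝓘(ℝ, E) x x) ?_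
      (contMDiffAt_extChartAt_symm hx)).contDiffAt
    rwa [hxs]
  have h1 := (comp hg).fderiv_right (m := ∞) (by simp)
  have h2 := (comp hf).fderiv_right (m := ∞) (by simp)
  have h3 := h1.clm_apply ((h.contDiffAt hx).clm_apply h2)
  refine ((h3.contMDiffAt.comp x
    (contMDiffAt_extChartAt_of_mem (mem_extChartAt_source x)))).congr_of_eventuallyEq ?_
  filter_upwards [hf.eventually_mdifferentiableAt (by simp),
    hg.eventually_mdifferentiableAt (by simp), extChartAt_source_mem_nhds (I := 𝓘(ℝ, E)) x]
    with z hz1 hz2 hz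
  have hzi := (extChartAt 𝓘(ℝ, E) x).left_inv hz
  have := bracket_symm (π := π) ((extChartAt 𝓘(ℝ, E) x).map_source hz)
    (f := f) (g := g) (by rwa [hzi]) (by rwa [hzi])
  rw [hzi] at this
  exact this

end SharpField

end SharpFields

/-! ### Reduction of bivector fields along a submersion -/

section Reduction

variable {E : Type*} [NormedAddCommGroup E] [NormedSpace ℝ E] [FiniteDimensional ℝ E]
  {P : Type*} [TopologicalSpace P] [ChartedSpace E P] [IsManifold 𝓘(ℝ, E) ∞ P]
  {E' : Type*} [NormedAddCommGroup E'] [NormedSpace ℝ E'] [FiniteDimensional ℝ E']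
  {P' : Type*} [TopologicalSpace P'] [ChartedSpace E' P'] [IsManifold 𝓘(ℝ, E') ∞ P']
  {ρ : P → P'} {x₀ : P} {p₀ : P'} {z : E} {x : E'}
  {π : SharpField 𝓘(ℝ, E) P} {π' : SharpField 𝓘(ℝ, E') P'}

variable (E E') in
/-- The local representative of a map. -/
def chartMap (ρ : P → P') (x₀ : P) (p₀ : P') : E → E' :=
  extChartAt 𝓘(ℝ, E') p₀ ∘ ρ ∘ (extChartAt 𝓘(ℝ, E) x₀).symm

theorem contDiffAt_chartMap (hρ : ContMDiff 𝓘(ℝ, E) 𝓘(ℝ, E') ∞ ρ)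
    (hz : z ∈ (extChartAt 𝓘(ℝ, E) x₀).target)
    (hp : ρ ((extChartAt 𝓘(ℝ, E) x₀).symm z) ∈ (extChartAt 𝓘(ℝ, E') p₀).source) :
    ContDiffAt ℝ ∞ (chartMap E E' ρ x₀ p₀) z :=
  ((contMDiffAt_extChartAt_of_mem hp).comp z
    ((hρ _).comp z (contMDiffAt_extChartAt_symm hz))).contDiffAt

theorem fderiv_chartMap (hρ : ContMDiff 𝓘(ℝ, E) 𝓘(ℝ, E') ∞ ρ)
    (hz : z ∈ (extChartAt 𝓘(ℝ, E) x₀).target)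
    (hp : ρ ((extChartAt 𝓘(ℝ, E) x₀).symm z) ∈ (extChartAt 𝓘(ℝ, E') p₀).source) (u : E) :
    fderiv ℝ (chartMap E E' ρ x₀ p₀) z u =
      mfderiv 𝓘(ℝ, E') 𝓘(ℝ, E') (extChartAt 𝓘(ℝ, E') p₀) (ρ ((extChartAt 𝓘(ℝ, E) x₀).symm z))
        (mfderiv 𝓘(ℝ, E) 𝓘(ℝ, E') ρ ((extChartAt 𝓘(ℝ, E) x₀).symm z)
          (mfderiv 𝓘(ℝ, E) 𝓘(ℝ, E) (extChartAt 𝓘(ℝ, E) x₀).symm z u)) := by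
  have h1 := (contMDiffAt_extChartAt_symm (I := 𝓘(ℝ, E)) hz).mdifferentiableAt (by simp)
  have h2 := (hρ ((extChartAt 𝓘(ℝ, E) x₀).symm z)).mdifferentiableAt (by simp)
  have h3 := (contMDiffAt_extChartAt_of_mem (I := 𝓘(ℝ, E')) hp).mdifferentiableAt (by simp)
  rw [← mfderiv_eq_fderiv]
  refine (mfderiv_comp_clm (f := ρ ∘ (extChartAt 𝓘(ℝ, E) x₀).symm)
    (g := extChartAt 𝓘(ℝ, E') p₀) h3 (h2.comp z h1) u).trans ?_
  exact congrArg _ (mfderiv_comp_clm h2 h1 u)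

theorem SharpField.inChart_chartMap (hρ : ContMDiff 𝓘(ℝ, E) 𝓘(ℝ, E') ∞ ρ)
    (hred : IsReducedBivector ρ π π') (hz : z ∈ (extChartAt 𝓘(ℝ, E) x₀).target)
    (hp : ρ ((extChartAt 𝓘(ℝ, E) x₀).symm z) ∈ (extChartAt 𝓘(ℝ, E') p₀).source)
    (a : E' →L[ℝ] ℝ) :
    π'.inChart p₀ (chartMap E E' ρ x₀ p₀ z) a =
      fderiv ℝ (chartMap E E' ρ x₀ p₀) z
        (π.inChart x₀ z (a ∘L fderiv ℝ (chartMap E E' ρ x₀ p₀) z)) := by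
  have tr : ∀ p p' : P', p' = p → ((mfderiv 𝓘(ℝ, E') 𝓘(ℝ, E') (extChartAt 𝓘(ℝ, E') p₀) p'
        (π' p' (a ∘L mfderiv 𝓘(ℝ, E') 𝓘(ℝ, E') (extChartAt 𝓘(ℝ, E') p₀) p')) : E')) =
      mfderiv 𝓘(ℝ, E') 𝓘(ℝ, E') (extChartAt 𝓘(ℝ, E') p₀) p
        (π' p (a ∘L mfderiv 𝓘(ℝ, E') 𝓘(ℝ, E') (extChartAt 𝓘(ℝ, E') p₀) p)) := by
    rintro p _ rfl; rfl
  refine (tr _ _ ((extChartAt 𝓘(ℝ, E') p₀).left_inv hp)).trans ?_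
  rw [fderiv_chartMap hρ hz hp, hred, ← SharpField.mfderiv_symm_inChart hz]
  refine congrArg (fun b : E →L[ℝ] ℝ => (mfderiv 𝓘(ℝ, E') 𝓘(ℝ, E') (extChartAt 𝓘(ℝ, E') p₀)
    (ρ ((extChartAt 𝓘(ℝ, E) x₀).symm z)) (mfderiv 𝓘(ℝ, E) 𝓘(ℝ, E') ρ
      ((extChartAt 𝓘(ℝ, E) x₀).symm z) (mfderiv 𝓘(ℝ, E) 𝓘(ℝ, E) (extChartAt 𝓘(ℝ, E) x₀).symm z
        (π.inChart x₀ z b))) : E')) ?_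
  ext u
  exact congrArg a (fderiv_chartMap hρ hz hp u).symm

/-- In charts, a submersion has local sections. -/
theorem exists_chart_section (hρ : Manifold.IsSubmersion 𝓘(ℝ, E) 𝓘(ℝ, E') ∞ ρ)
    (hx : x ∈ (extChartAt 𝓘(ℝ, E') p₀).target)
    (hx₀ : ρ x₀ = (extChartAt 𝓘(ℝ, E') p₀).symm x) :
    ∃ s : E' → E, s x = extChartAt 𝓘(ℝ, E) x₀ x₀ ∧ ∀ᶠ x' in 𝓝 x, ContDiffAt ℝ ∞ s x' ∧
      s x' ∈ (extChartAt 𝓘(ℝ, E) x₀).target ∧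
      ρ ((extChartAt 𝓘(ℝ, E) x₀).symm (s x')) = (extChartAt 𝓘(ℝ, E') p₀).symm x' ∧
      chartMap E E' ρ x₀ p₀ (s x') = x' := by
  obtain ⟨t, ht, hts⟩ := exists_local_section hρ x₀
  rw [hx₀] at ht hts
  have hc := (contMDiffAt_extChartAt_symm (I := 𝓘(ℝ, E')) hx).continuousAt
  have htc : ContinuousAt (t ∘ (extChartAt 𝓘(ℝ, E') p₀).symm) x :=
    ContinuousAt.comp hts.self_of_nhds.1.continuousAt hc
  have htx : (t ∘ (extChartAt 𝓘(ℝ, E') p₀).symm) x ∈ (extChartAt 𝓘(ℝ, E) x₀).source := by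
    change t _ ∈ _
    rw [ht]
    exact mem_extChartAt_source x₀
  refine ⟨extChartAt 𝓘(ℝ, E) x₀ ∘ t ∘ (extChartAt 𝓘(ℝ, E') p₀).symm, congrArg _ ht, ?_⟩
  filter_upwards [hc.eventually hts, htc.preimage_mem_nhds
    ((isOpen_extChartAt_source (I := 𝓘(ℝ, E)) x₀).mem_nhds htx),
    (isOpen_extChartAt_target (I := 𝓘(ℝ, E')) p₀).mem_nhds hx] with x' h1 h2 h3
  have h4 : (extChartAt 𝓘(ℝ, E) x₀).symm (extChartAt 𝓘(ℝ, E) x₀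
      (t ((extChartAt 𝓘(ℝ, E') p₀).symm x'))) = t ((extChartAt 𝓘(ℝ, E') p₀).symm x') :=
    (extChartAt 𝓘(ℝ, E) x₀).left_inv h2
  have h5 : ρ ((extChartAt 𝓘(ℝ, E) x₀).symm (extChartAt 𝓘(ℝ, E) x₀
      (t ((extChartAt 𝓘(ℝ, E') p₀).symm x')))) = (extChartAt 𝓘(ℝ, E') p₀).symm x' := by
    rw [h4, h1.2]
  refine ⟨?_, (extChartAt 𝓘(ℝ, E) x₀).map_source h2, h5, ?_⟩
  · exact ((contMDiffAt_extChartAt_of_mem h2).comp x'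
      (h1.1.comp x' (contMDiffAt_extChartAt_symm h3))).contDiffAt
  · change extChartAt 𝓘(ℝ, E') p₀ (ρ ((extChartAt 𝓘(ℝ, E) x₀).symm (extChartAt 𝓘(ℝ, E) x₀
      (t ((extChartAt 𝓘(ℝ, E') p₀).symm x'))))) = x'
    rw [h5]
    exact (extChartAt 𝓘(ℝ, E') p₀).right_inv h3

/-- Along a local section s the reduced field is Tρ ∘ π(s) ∘ Tρ^*, a composite of smooth families.
-/
theorem SharpField.Smooth.reduced (hρ : Manifold.IsSubmersion 𝓘(ℝ, E) 𝓘(ℝ, E') ∞ ρ)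
    (hsurj : Function.Surjective ρ) (hπ : π.Smooth) (hred : IsReducedBivector ρ π π') :
    π'.Smooth := by
  intro p₀ x hx
  obtain ⟨x₀, hx₀⟩ := hsurj ((extChartAt 𝓘(ℝ, E') p₀).symm x)
  obtain ⟨s, hsx, hs⟩ := exists_chart_section hρ hx hx₀
  obtain ⟨h1, h2, h3, h4⟩ := hs.self_of_nhds
  have hp : ρ ((extChartAt 𝓘(ℝ, E) x₀).symm (s x)) ∈ (extChartAt 𝓘(ℝ, E') p₀).source := by
    rw [h3]
    exact (extChartAt 𝓘(ℝ, E') p₀).map_target hx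
  have hr : ContDiffAt ℝ ∞ (fun x' => fderiv ℝ (chartMap E E' ρ x₀ p₀) (s x')) x :=
    ((contDiffAt_chartMap hρ.contMDiff h2 hp).fderiv_right (m := ∞) (by simp)).comp x h1
  have hS : ContDiffAt ℝ ∞ (fun x' => π.inChart x₀ (s x')) x := (hπ.contDiffAt h2).comp x h1
  refine (contDiffAt_clm_of_apply fun a => ?_).contDiffWithinAt
  refine (hr.clm_apply (hS.clm_apply
    ((contDiffAt_const (c := a)).clm_comp hr))).congr_of_eventuallyEq ?_
  filter_upwards [hs, (isOpen_extChartAt_target (I := 𝓘(ℝ, E')) p₀).mem_nhds hx]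
    with x' ⟨g1, g2, g3, g4⟩ g5
  have hp' : ρ ((extChartAt 𝓘(ℝ, E) x₀).symm (s x')) ∈ (extChartAt 𝓘(ℝ, E') p₀).source := by
    rw [g3]
    exact (extChartAt 𝓘(ℝ, E') p₀).map_target g5
  have := SharpField.inChart_chartMap hρ.contMDiff hred g2 hp' a
  rwa [g4] at this

end Reduction

/-- The sum `{f₀, {f₁, f₂}} + {f₁, {f₂, f₀}} + {f₂, {f₀, f₁}}` for the bracket
`{f, g}(z) = dg(S_z(df))` on a vector space. -/
def cyclicBracket {E : Type*} [NormedAddCommGroup E] [NormedSpace ℝ E]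
    (S : E → (E →L[ℝ] ℝ) →L[ℝ] E) (f : Fin 3 → E → ℝ) (y : E) : ℝ :=
  fderiv ℝ (fun z => fderiv ℝ (f 2) z (S z (fderiv ℝ (f 1) z))) y (S y (fderiv ℝ (f 0) y)) +
    fderiv ℝ (fun z => fderiv ℝ (f 0) z (S z (fderiv ℝ (f 2) z))) y (S y (fderiv ℝ (f 1) y)) +
    fderiv ℝ (fun z => fderiv ℝ (f 1) z (S z (fderiv ℝ (f 0) z))) y (S y (fderiv ℝ (f 2) y))

section Reduction

variable {E : Type*} [NormedAddCommGroup E] [NormedSpace ℝ E] [FiniteDimensional ℝ E]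
  {P : Type*} [TopologicalSpace P] [ChartedSpace E P] [IsManifold 𝓘(ℝ, E) ∞ P]
  {E' : Type*} [NormedAddCommGroup E'] [NormedSpace ℝ E'] [FiniteDimensional ℝ E']
  {P' : Type*} [TopologicalSpace P'] [ChartedSpace E' P'] [IsManifold 𝓘(ℝ, E') ∞ P']
  {ρ : P → P'} {x₀ : P} {p₀ : P'} {z : E} {x : E'}
  {π : SharpField 𝓘(ℝ, E) P} {π' : SharpField 𝓘(ℝ, E') P'}

/-- The bracket of pulled back functions is the pulled back bracket on a whole neighbourhood, so it
can be differentiated again by the chain rule and iterated brackets correspond too. -/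
theorem cyclicBracket_reduced (hρ : Manifold.IsSubmersion 𝓘(ℝ, E) 𝓘(ℝ, E') ∞ ρ)
    (hπ' : π'.Smooth) (hred : IsReducedBivector ρ π π')
    (hx : x ∈ (extChartAt 𝓘(ℝ, E') p₀).target)
    (hx₀ : ρ x₀ = (extChartAt 𝓘(ℝ, E') p₀).symm x) {F : Fin 3 → E' → ℝ}
    (hF : ∀ i, ContDiffAt ℝ ∞ (F i) x) :
    cyclicBracket (π'.inChart p₀) F x =
      cyclicBracket (π.inChart x₀) (fun i => F i ∘ chartMap E E' ρ x₀ p₀)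
        (extChartAt 𝓘(ℝ, E) x₀ x₀) := by
  let y := extChartAt 𝓘(ℝ, E) x₀ x₀
  let r := chartMap E E' ρ x₀ p₀
  have hy : y ∈ (extChartAt 𝓘(ℝ, E) x₀).target := mem_extChartAt_target x₀
  have hρy : ρ ((extChartAt 𝓘(ℝ, E) x₀).symm y) = (extChartAt 𝓘(ℝ, E') p₀).symm x :=
    (congrArg ρ (extChartAt_to_inv x₀)).trans hx₀
  have hp : ρ ((extChartAt 𝓘(ℝ, E) x₀).symm y) ∈ (extChartAt 𝓘(ℝ, E') p₀).source := by
    rw [hρy]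
    exact (extChartAt 𝓘(ℝ, E') p₀).map_target hx
  have hry : r y = x := (congrArg _ hρy).trans ((extChartAt 𝓘(ℝ, E') p₀).right_inv hx)
  have hr : ContDiffAt ℝ ∞ r y := contDiffAt_chartMap hρ.contMDiff hy hp
  have hev : ∀ᶠ z in 𝓝 y, z ∈ (extChartAt 𝓘(ℝ, E) x₀).target ∧
      ρ ((extChartAt 𝓘(ℝ, E) x₀).symm z) ∈ (extChartAt 𝓘(ℝ, E') p₀).source := by
    have hc : ContinuousAt (ρ ∘ (extChartAt 𝓘(ℝ, E) x₀).symm) y :=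
      (hρ.contMDiff _).continuousAt.comp (contMDiffAt_extChartAt_symm hy).continuousAt
    filter_upwards [(isOpen_extChartAt_target (I := 𝓘(ℝ, E)) x₀).mem_nhds hy,
      hc.preimage_mem_nhds ((isOpen_extChartAt_source (I := 𝓘(ℝ, E')) p₀).mem_nhds hp)]
      with z h1 h2 using ⟨h1, h2⟩
  have hFd : ∀ᶠ x' in 𝓝 (r y), ∀ i, DifferentiableAt ℝ (F i) x' := by
    rw [hry]
    refine Filter.eventually_all.2 fun i => ?_
    exact (((hF i).of_le (by simp : (1 : WithTop ℕ∞) ≤ ∞)).eventually (by simp)).mono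
      fun x' h => h.differentiableAt (by simp)
  have hfd : ∀ᶠ z in 𝓝 y, ∀ i, fderiv ℝ (F i ∘ r) z = fderiv ℝ (F i) (r z) ∘L fderiv ℝ r z := by
    filter_upwards [hr.continuousAt.eventually hFd, hev] with z h1 h2 i
    exact fderiv_comp z (h1 i)
      ((contDiffAt_chartMap hρ.contMDiff h2.1 h2.2).differentiableAt (by simp))
  have hbr : ∀ i j, (fun z => fderiv ℝ (F j ∘ r) z (π.inChart x₀ z (fderiv ℝ (F i ∘ r) z)))
      =ᶠ[𝓝 y] (fun x' => fderiv ℝ (F j) x' (π'.inChart p₀ x' (fderiv ℝ (F i) x'))) ∘ r := by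
    intro i j
    filter_upwards [hfd, hev] with z h1 h2
    rw [h1, h1]
    exact congrArg (fderiv ℝ (F j) (r z))
      (SharpField.inChart_chartMap hρ.contMDiff hred h2.1 h2.2 _).symm
  have hd : ∀ i j, DifferentiableAt ℝ
      (fun x' => fderiv ℝ (F j) x' (π'.inChart p₀ x' (fderiv ℝ (F i) x'))) (r y) := by
    intro i j
    rw [hry]
    have h1 := (hF j).fderiv_right (m := ∞) (by simp)
    have h2 := (hF i).fderiv_right (m := ∞) (by simp)
    exact (h1.clm_apply ((hπ'.contDiffAt hx).clm_apply h2)).differentiableAt (by simp)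
  have hterm : ∀ i j k,
      fderiv ℝ (fun z => fderiv ℝ (F j ∘ r) z (π.inChart x₀ z (fderiv ℝ (F i ∘ r) z))) y
        (π.inChart x₀ y (fderiv ℝ (F k ∘ r) y)) =
      fderiv ℝ (fun x' => fderiv ℝ (F j) x' (π'.inChart p₀ x' (fderiv ℝ (F i) x'))) x
        (π'.inChart p₀ x (fderiv ℝ (F k) x)) := by
    intro i j k
    rw [(hbr i j).fderiv_eq, fderiv_comp y (hd i j) (hr.differentiableAt (by simp)),
      hfd.self_of_nhds, ← hry]
    exact congrArg _ (SharpField.inChart_chartMap hρ.contMDiff hred hy hp _).symm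
  unfold cyclicBracket
  rw [← hterm, ← hterm, ← hterm]

variable {w : Form 𝓘(ℝ, E) P ℝ 3} {φ : Form 𝓘(ℝ, E') P' ℝ 3}

/-- Pulled back functions have differentials that kill ker Tρ, so `hjac` is needed only for
functions of this kind. Both sides of it are then expressed downstairs. -/
theorem cyclicBracket_eq_of_submersion (hρ : Manifold.IsSubmersion 𝓘(ℝ, E) 𝓘(ℝ, E') ∞ ρ)
    (hsurj : Function.Surjective ρ) (hπ' : π'.Smooth) (hred : IsReducedBivector ρ π π')
    (hφ : φ.pullback 𝓘(ℝ, E) ρ = fun m => -w m)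
    (hjac : ∀ x₀ : P, ∀ y ∈ (extChartAt 𝓘(ℝ, E) x₀).target, ∀ f : Fin 3 → E → ℝ,
      (∀ i, ContDiffAt ℝ ∞ (f i) y) →
      (∀ i u, mfderiv 𝓘(ℝ, E) 𝓘(ℝ, E') ρ ((extChartAt 𝓘(ℝ, E) x₀).symm y)
        (mfderiv 𝓘(ℝ, E) 𝓘(ℝ, E) (extChartAt 𝓘(ℝ, E) x₀).symm y u) = 0 →
          fderiv ℝ (f i) y u = 0) →
      cyclicBracket (π.inChart x₀) f y = w.inChart x₀ y
        ![π.inChart x₀ y (fderiv ℝ (f 0) y), π.inChart x₀ y (fderiv ℝ (f 1) y),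
          π.inChart x₀ y (fderiv ℝ (f 2) y)])
    (hx : x ∈ (extChartAt 𝓘(ℝ, E') p₀).target) {F : Fin 3 → E' → ℝ}
    (hF : ∀ i, ContDiffAt ℝ ∞ (F i) x) :
    cyclicBracket (π'.inChart p₀) F x = -φ.inChart p₀ x
      ![π'.inChart p₀ x (fderiv ℝ (F 0) x), π'.inChart p₀ x (fderiv ℝ (F 1) x),
        π'.inChart p₀ x (fderiv ℝ (F 2) x)] := by
  obtain ⟨x₀, hx₀⟩ := hsurj ((extChartAt 𝓘(ℝ, E') p₀).symm x)
  rw [cyclicBracket_reduced hρ hπ' hred hx hx₀ hF]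
  let y := extChartAt 𝓘(ℝ, E) x₀ x₀
  let r := chartMap E E' ρ x₀ p₀
  have hy : y ∈ (extChartAt 𝓘(ℝ, E) x₀).target := mem_extChartAt_target x₀
  have hρy : ρ ((extChartAt 𝓘(ℝ, E) x₀).symm y) = (extChartAt 𝓘(ℝ, E') p₀).symm x :=
    (congrArg ρ (extChartAt_to_inv x₀)).trans hx₀
  have hp : ρ ((extChartAt 𝓘(ℝ, E) x₀).symm y) ∈ (extChartAt 𝓘(ℝ, E') p₀).source := by
    rw [hρy]
    exact (extChartAt 𝓘(ℝ, E') p₀).map_target hx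
  have hry : r y = x := (congrArg _ hρy).trans ((extChartAt 𝓘(ℝ, E') p₀).right_inv hx)
  have hr : ContDiffAt ℝ ∞ r y := contDiffAt_chartMap hρ.contMDiff hy hp
  have hfd : ∀ i, fderiv ℝ (F i ∘ r) y = fderiv ℝ (F i) x ∘L fderiv ℝ r y := by
    intro i
    rw [← hry]
    refine fderiv_comp y ?_ (hr.differentiableAt (by simp))
    rw [hry]
    exact (hF i).differentiableAt (by simp)
  refine (hjac x₀ y hy (fun i => F i ∘ r) (fun i => ?_) fun i u hu => ?_).trans ?_
  · refine ContDiffAt.comp y ?_ hr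
    rw [hry]
    exact hF i
  · rw [hfd]
    refine (congrArg (fderiv ℝ (F i) x) ?_).trans (map_zero (fderiv ℝ (F i) x))
    exact (fderiv_chartMap hρ.contMDiff hy hp u).trans ((congrArg _ hu).trans (map_zero _))
  · have hQ : ∀ i, (π'.inChart p₀ x (fderiv ℝ (F i) x) : E') =
        fderiv ℝ r y (π.inChart x₀ y (fderiv ℝ (F i ∘ r) y)) := by
      intro i
      rw [hfd, ← hry]
      exact SharpField.inChart_chartMap hρ.contMDiff hred hy hp _
    have hT : ∀ u : E, (mfderiv 𝓘(ℝ, E') 𝓘(ℝ, E') (extChartAt 𝓘(ℝ, E') p₀).symm x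
        (fderiv ℝ r y u) : E') = mfderiv 𝓘(ℝ, E) 𝓘(ℝ, E') ρ ((extChartAt 𝓘(ℝ, E) x₀).symm y)
          (mfderiv 𝓘(ℝ, E) 𝓘(ℝ, E) (extChartAt 𝓘(ℝ, E) x₀).symm y u) := by
      intro u
      have tr : ∀ p : P', p = (extChartAt 𝓘(ℝ, E') p₀).symm x → ∀ v : E',
          (mfderiv 𝓘(ℝ, E') 𝓘(ℝ, E') (extChartAt 𝓘(ℝ, E') p₀).symm x
            (mfderiv 𝓘(ℝ, E') 𝓘(ℝ, E') (extChartAt 𝓘(ℝ, E') p₀) p v) : E') = v := by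
        rintro p rfl v
        exact mfderiv_symm_extChartAt_apply hx v
      rw [fderiv_chartMap hρ.contMDiff hy hp]
      exact tr _ hρy _
    have h1 : ∀ u : Fin 3 → E, φ.inChart p₀ x (fun i => fderiv ℝ r y (u i)) =
        -w.inChart x₀ y u := by
      intro u
      have tr : ∀ p : P', p = (extChartAt 𝓘(ℝ, E') p₀).symm x → ∀ v : Fin 3 → E',
          φ p v = φ ((extChartAt 𝓘(ℝ, E') p₀).symm x) v := by
        rintro p rfl v; rfl
      refine Eq.trans ?_ (DFunLike.congr_fun (congrFun hφ ((extChartAt 𝓘(ℝ, E) x₀).symm y))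
        (fun i => mfderiv 𝓘(ℝ, E) 𝓘(ℝ, E) (extChartAt 𝓘(ℝ, E) x₀).symm y (u i)))
      refine Eq.trans ?_ (tr _ hρy _).symm
      exact congrArg (φ ((extChartAt 𝓘(ℝ, E') p₀).symm x)) (funext fun i => hT (u i))
    have h2 := h1 ![π.inChart x₀ y (fderiv ℝ (F 0 ∘ r) y), π.inChart x₀ y (fderiv ℝ (F 1 ∘ r) y),
      π.inChart x₀ y (fderiv ℝ (F 2 ∘ r) y)]
    have h3 : ![π'.inChart p₀ x (fderiv ℝ (F 0) x), π'.inChart p₀ x (fderiv ℝ (F 1) x),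
        π'.inChart p₀ x (fderiv ℝ (F 2) x)] = fun i => fderiv ℝ r y
          (![π.inChart x₀ y (fderiv ℝ (F 0 ∘ r) y), π.inChart x₀ y (fderiv ℝ (F 1 ∘ r) y),
            π.inChart x₀ y (fderiv ℝ (F 2 ∘ r) y)] i) := by
      funext i
      fin_cases i
      exacts [hQ 0, hQ 1, hQ 2]
    rw [h3, h2, neg_neg]

end Reduction

/-! ### Integrability from a twisted Jacobi identity -/

section

set_option maxSynthPendingDepth 3

section Linear

variable {E : Type*} [NormedAddCommGroup E] [NormedSpace ℝ E] [FiniteDimensional ℝ E]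
  {F : Type*} [NormedAddCommGroup F] [NormedSpace ℝ F] [FiniteDimensional ℝ F]

/-- Packages the structure functions, given by a formula linear in each slot, as a continuous family
of operators; in finite dimension continuity may be tested on fixed arguments. -/
theorem exists_continuous_trilinear {g : E → F → F → E → ℝ}
    (h1 : ∀ x b w, IsLinearMap ℝ fun a => g x a b w)
    (h2 : ∀ x a w, IsLinearMap ℝ fun b => g x a b w)
    (h3 : ∀ x a b, IsLinearMap ℝ fun w => g x a b w)
    (hg : ∀ a b w, Continuous fun x => g x a b w) :
    ∃ Γ : E → F →L[ℝ] F →L[ℝ] E →L[ℝ] ℝ, Continuous Γ ∧ ∀ x a b w, Γ x a b w = g x a b w := by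
  let Γ₁ : E → F → F → E →L[ℝ] ℝ := fun x a b =>
    LinearMap.toContinuousLinearMap (IsLinearMap.mk' _ (h3 x a b))
  let Γ₂ : E → F → F →L[ℝ] E →L[ℝ] ℝ := fun x a => LinearMap.toContinuousLinearMap
    { toFun := Γ₁ x a
      map_add' := fun b b' => ContinuousLinearMap.ext fun w => (h2 x a w).map_add b b'
      map_smul' := fun c b => ContinuousLinearMap.ext fun w => (h2 x a w).map_smul c b }
  let Γ : E → F →L[ℝ] F →L[ℝ] E →L[ℝ] ℝ := fun x => LinearMap.toContinuousLinearMap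
    { toFun := Γ₂ x
      map_add' := fun a a' => ContinuousLinearMap.ext fun b => ContinuousLinearMap.ext fun w =>
        (h1 x b w).map_add a a'
      map_smul' := fun c a => ContinuousLinearMap.ext fun b => ContinuousLinearMap.ext fun w =>
        (h1 x b w).map_smul c a }
  refine ⟨Γ, ?_, fun x a b w => rfl⟩
  refine contDiff_zero (𝕜 := ℝ).1 (contDiff_iff_contDiffAt.2 fun x => ?_)
  refine contDiffAt_clm_of_apply fun a => contDiffAt_clm_of_apply fun b =>
    contDiffAt_clm_of_apply fun w => ?_
  exact (contDiff_zero (𝕜 := ℝ).2 (hg a b w)).contDiffAt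

/-- Local representatives are smooth only on the target of a chart, while the flow construction acts
on all continuous curves in the model space; a cutoff bridges the two. -/
theorem exists_contDiff_eventuallyEq {V : Type*} [NormedAddCommGroup V] [NormedSpace ℝ V]
    {q : E → V} {U : Set E} (hU : IsOpen U)
    (hq : ContDiffOn ℝ ∞ q U) {y : E} (hy : y ∈ U) : ∃ q' : E → V, ContDiff ℝ ∞ q' ∧
      q' =ᶠ[𝓝 y] q := by
  obtain ⟨ε, hε, hεU⟩ := Metric.nhds_basis_closedBall.mem_iff.1 (hU.mem_nhds hy)
  let β : ContDiffBump y := ⟨ε / 2, ε, by positivity, by linarith⟩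
  refine ⟨fun x => β x • q x, contDiff_iff_contDiffAt.2 fun x => ?_, ?_⟩
  · by_cases hx : x ∈ U
    · exact β.contDiff.contDiffAt.smul (hq.contDiffAt (hU.mem_nhds hx))
    · have hx' : x ∉ tsupport β := fun h => hx (hεU (by rwa [β.tsupport_eq] at h))
      refine (contDiffAt_const (c := (0 : V))).congr_of_eventuallyEq ?_
      filter_upwards [notMem_tsupport_iff_eventuallyEq.1 hx'] with z hz
      simp [hz]
  · filter_upwards [β.eventuallyEq_one] with z hz
    simp [hz]

theorem alternating_cycle {T V : Type*} [AddCommGroup T] [Module ℝ T] [TopologicalSpace T]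
    [AddCommGroup V] [Module ℝ V] [TopologicalSpace V] (w : T [⋀^Fin 3]→L[ℝ] V)
    (a b c : T) : w ![a, b, c] = w ![b, c, a] := by
  have h1 := w.toAlternatingMap.map_swap ![a, b, c] (i := 0) (j := 1) (by simp)
  have h2 := w.toAlternatingMap.map_swap ![b, a, c] (i := 1) (j := 2) (by simp)
  have e1 : (![a, b, c] ∘ Equiv.swap 0 1 : Fin 3 → T) = ![b, a, c] := by
    ext i; fin_cases i <;> rfl
  have e2 : (![b, a, c] ∘ Equiv.swap 1 2 : Fin 3 → T) = ![b, c, a] := by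
    ext i; fin_cases i <;> rfl
  rw [e1] at h1
  rw [e2] at h2
  exact (neg_eq_iff_eq_neg.1 h1.symm).trans h2.symm

theorem alternating_isLinear {T : Type*} [AddCommGroup T] [Module ℝ T] [TopologicalSpace T]
    (w : T [⋀^Fin 3]→L[ℝ] ℝ) (b c : T) : IsLinearMap ℝ fun a => w ![a, b, c] :=
  ⟨fun a a' => w.toAlternatingMap.map_vecCons_add ![b, c] a a',
    fun r a => w.toAlternatingMap.map_vecCons_smul ![b, c] r a⟩

/-- The image of a smooth skew `Q : E → Hom(E*, E)` whose cyclic bracket is given by a 3-form has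
integral manifolds. -/
theorem exists_integral_ball_of_cyclicBracket {U : Set E} (hU : IsOpen U)
    {Q : E → (E →L[ℝ] ℝ) →L[ℝ] E} (hQ : ContDiffOn ℝ ∞ Q U)
    (hskew : ∀ x (a b : E →L[ℝ] ℝ), b (Q x a) = -a (Q x b))
    {φ : E → E [⋀^Fin 3]→L[ℝ] ℝ} (hφ : ContDiffOn ℝ ∞ φ U)
    (hj : ∀ x ∈ U, ∀ F : Fin 3 → E → ℝ, (∀ i, ContDiffAt ℝ ∞ (F i) x) →
      cyclicBracket Q F x = -φ x ![Q x (fderiv ℝ (F 0) x), Q x (fderiv ℝ (F 1) x),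
        Q x (fderiv ℝ (F 2) x)]) {y : E} (hy : y ∈ U) :
    ∃ (k : ℕ) (ε : ℝ) (j : EuclideanSpace ℝ (Fin k) → E), 0 < ε ∧ j 0 = y ∧
      ContDiffOn ℝ ∞ j (Metric.ball 0 ε) ∧ Set.InjOn j (Metric.ball 0 ε) ∧
      ∀ t ∈ Metric.ball (0 : EuclideanSpace ℝ (Fin k)) ε, j t ∈ U ∧
        Function.Injective (fderiv ℝ j t) ∧
        LinearMap.range (fderiv ℝ j t).toLinearMap = LinearMap.range (Q (j t)).toLinearMap := by
  obtain ⟨Q', hQ', hQQ⟩ := exists_contDiff_eventuallyEq hU hQ hy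
  obtain ⟨φ', hφ', hφφ⟩ := exists_contDiff_eventuallyEq hU hφ hy
  have hdQ' : Continuous (fderiv ℝ Q') := hQ'.continuous_fderiv (by simp)
  -- For linear functions a, b, c the hypothesis reads c(DQ(Qa)b) + a(DQ(Qb)c) + b(DQ(Qc)a) = -φ(Qa,
  -- Qb, Qc). Skewness makes the second term -c(DQ(Qb)a), so c(DQ(Qa)b - DQ(Qb)a) = Γ(a, b)(Qc) =
  -- -c(QΓ(a, b)) with this Γ. That is the involutivity relation of `exists_integral_ball`.
  obtain ⟨Γ, hΓ, hΓe⟩ := exists_continuous_trilinear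
    (g := fun x (a b : E →L[ℝ] ℝ) w => -b (fderiv ℝ Q' x w a) - φ' x ![w, Q' x a, Q' x b])
    (fun x b w => ⟨fun a a' => by
        rw [alternating_cycle, alternating_cycle (φ' x) w (Q' x a),
          alternating_cycle (φ' x) w (Q' x a'), map_add, map_add, map_add,
          (alternating_isLinear (φ' x) _ _).map_add]
        ring, fun r a => by
        rw [alternating_cycle, alternating_cycle (φ' x) w (Q' x a), map_smul, map_smul, map_smul,
          (alternating_isLinear (φ' x) _ _).map_smul]
        simp only [smul_eq_mul]
        ring⟩)
    (fun x a w => ⟨fun b b' => by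
        rw [← alternating_cycle, ← alternating_cycle (φ' x) _ w (Q' x a),
          ← alternating_cycle (φ' x) _ w (Q' x a), map_add,
          (alternating_isLinear (φ' x) _ _).map_add, add_apply]
        ring, fun r b => by
        rw [← alternating_cycle, ← alternating_cycle (φ' x) _ w (Q' x a), map_smul,
          (alternating_isLinear (φ' x) _ _).map_smul, smul_apply]
        simp only [smul_eq_mul]
        ring⟩)
    (fun x a b => ⟨fun w w' => by
        rw [map_add, add_apply, map_add, (alternating_isLinear (φ' x) _ _).map_add]
        ring, fun r w => by
        rw [map_smul, smul_apply, map_smul, (alternating_isLinear (φ' x) _ _).map_smul]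
        simp only [smul_eq_mul]
        ring⟩)
    (fun a b w => by
      have h1 : Continuous fun x => φ' x ![w, Q' x a, Q' x b] := by
        refine ContDiff.continuous (𝕜 := ℝ) (n := ∞) (contDiff_iff_contDiffAt.2 fun x => ?_)
        refine contDiffAt_alternating_apply hφ'.contDiffAt fun i => ?_
        fin_cases i
        · exact contDiffAt_const
        · exact (hQ'.clm_apply contDiff_const).contDiffAt
        · exact (hQ'.clm_apply contDiff_const).contDiffAt
      have h2 : Continuous fun x => b (fderiv ℝ Q' x w a) :=
        b.continuous.comp ((hdQ'.clm_apply continuous_const).clm_apply continuous_const)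
      exact h2.neg.sub h1)
  have hev : ∀ᶠ x in 𝓝 y, x ∈ U ∧ Q' =ᶠ[𝓝 x] Q ∧ φ' x = φ x := by
    filter_upwards [hU.mem_nhds hy, hQQ.eventuallyEq_nhds, hφφ] with x h1 h2 h3
      using ⟨h1, h2, h3⟩
  -- On U' the cut-off field agrees with Q to first order, so the relation needs checking only
  -- there.
  obtain ⟨U', hU'e, hU', hyU'⟩ := mem_nhds_iff.1 hev
  obtain ⟨k, ε, j, hε, hj0, hjs, hji, hjt⟩ := exists_integral_ball hQ' hΓ hU' (fun x hx a b => by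
    obtain ⟨hxU, hxQ, hxφ⟩ := hU'e hx
    have hQd : DifferentiableAt ℝ Q x :=
      (hQ.contDiffAt (hU.mem_nhds hxU)).differentiableAt (by simp)
    rw [hxQ.fderiv_eq, hxQ.eq_of_nhds]
    have hd : ∀ (a b : E →L[ℝ] ℝ) (u : E),
        fderiv ℝ (fun z => fderiv ℝ (b : E → ℝ) z (Q z (fderiv ℝ (a : E → ℝ) z))) x u =
          b (fderiv ℝ Q x u a) := by
      intro a b u
      simp only [ContinuousLinearMap.fderiv]
      have h1 := b.hasFDerivAt.comp x (hQd.hasFDerivAt.clm_apply (hasFDerivAt_const a x))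
      have h2 := DFunLike.congr_fun h1.fderiv u
      refine h2.trans ?_
      simp
    have hds : ∀ (a b : E →L[ℝ] ℝ) (u : E), b (fderiv ℝ Q x u a) = -a (fderiv ℝ Q x u b) := by
      intro a b u
      rw [← hd, ← hd]
      simp only [ContinuousLinearMap.fderiv]
      rw [funext fun z => hskew z a b]
      simp
    refine SeparatingDual.eq_iff_forall_dual_eq (R := ℝ).2 fun c => ?_
    have h1 := hj x hxU ![a, b, c] (fun i => by
      fin_cases i
      exacts [a.contDiff.contDiffAt, b.contDiff.contDiffAt, c.contDiff.contDiffAt])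
    have h2 : cyclicBracket Q ![a, b, c] x = c (fderiv ℝ Q x (Q x a) b) +
        a (fderiv ℝ Q x (Q x b) c) + b (fderiv ℝ Q x (Q x c) a) := by
      rw [← hd, ← hd, ← hd]
      unfold cyclicBracket
      simp
    have h3 : φ x ![Q x (fderiv ℝ (![(a : E → ℝ), b, c] 0) x),
        Q x (fderiv ℝ (![(a : E → ℝ), b, c] 1) x), Q x (fderiv ℝ (![(a : E → ℝ), b, c] 2) x)] =
        φ x ![Q x c, Q x a, Q x b] := by
      rw [← alternating_cycle]
      simp
    rw [h2, h3, hds c a] at h1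
    have h4 := hΓe x a b (Q x c)
    rw [hxQ.fderiv_eq, hxQ.eq_of_nhds, hxφ] at h4
    rw [map_add, hskew x _ c, h4]
    linarith) hyU'
  refine ⟨k, ε, j, hε, hj0, hjs, hji, fun t ht => ?_⟩
  obtain ⟨h1, h2, h3⟩ := hjt t ht
  refine ⟨(hU'e h1).1, h2, h3.trans ?_⟩
  rw [(hU'e h1).2.1.eq_of_nhds]

end Linear

end

/-! ### Descent of forms and bivector fields -/

/-- By antisymmetry the form vanishes as soon as any argument lies in ker L, so the arguments can be
exchanged one slot at a time. -/
theorem alternating_eq_of_horizontal {T T' V : Type*} [AddCommGroup T] [Module ℝ T]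
    [TopologicalSpace T] [AddCommGroup T'] [Module ℝ T'] [AddCommGroup V] [Module ℝ V]
    [TopologicalSpace V] {k : ℕ} (w : T [⋀^Fin (k + 1)]→L[ℝ] V) (L : T →ₗ[ℝ] T')
    (hw : ∀ v, L (v 0) = 0 → w v = 0) {u v : Fin (k + 1) → T} (h : ∀ i, L (u i) = L (v i)) :
    w u = w v := by
  have hw' : ∀ i v, L (v i) = 0 → w v = 0 := by
    intro i v hv
    by_cases hi : i = 0
    · exact hw v (hi ▸ hv)
    · have h1 := w.toAlternatingMap.map_swap v hi
      have h2 := hw (v ∘ Equiv.swap i 0) (by simpa using hv)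
      exact neg_eq_zero.1 (h1.symm.trans h2)
  have key : ∀ s : Finset (Fin (k + 1)), w (s.piecewise u v) = w v := by
    intro s
    induction s using Finset.induction_on with
    | empty => simp
    | insert i s hi ih =>
      rw [Finset.piecewise_insert, ← ih, ← sub_eq_zero]
      have h1 := w.toAlternatingMap.map_update_sub (s.piecewise u v) i (u i) (v i)
      have h2 : Function.update (s.piecewise u v) i (v i) = s.piecewise u v := by
        rw [Function.update_eq_self_iff]
        simp [hi]
      rw [h2] at h1
      refine h1.symm.trans (hw' i _ ?_)
      rw [Function.update_self, map_sub, h, sub_self]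
  have := key Finset.univ
  rwa [Finset.piecewise_univ] at this

section Reduction

variable {E : Type*} [NormedAddCommGroup E] [NormedSpace ℝ E] [FiniteDimensional ℝ E]
  {P : Type*} [TopologicalSpace P] [ChartedSpace E P] [IsManifold 𝓘(ℝ, E) ∞ P]
  {E' : Type*} [NormedAddCommGroup E'] [NormedSpace ℝ E'] [FiniteDimensional ℝ E']
  {P' : Type*} [TopologicalSpace P'] [ChartedSpace E' P'] [IsManifold 𝓘(ℝ, E') ∞ P']
  {ρ : P → P'} {π : SharpField 𝓘(ℝ, E) P} {k : ℕ} {w : Form 𝓘(ℝ, E) P ℝ (k + 1)}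
  {φ : Form 𝓘(ℝ, E') P' ℝ (k + 1)}

theorem exists_reducedBivector (hsurj : Function.Surjective ρ)
    (h : ∀ m m', ρ m = ρ m' →
      (sharpMap (E := E') (mfderiv 𝓘(ℝ, E) 𝓘(ℝ, E') ρ m) (π m)) =
        sharpMap (E := E') (mfderiv 𝓘(ℝ, E) 𝓘(ℝ, E') ρ m') (π m')) :
    ∃ π' : SharpField 𝓘(ℝ, E') P', ∀ π'', IsReducedBivector ρ π π'' ↔ π'' = π' := by
  let F : P → ((E' →L[ℝ] ℝ) →ₗ[ℝ] E') := fun m =>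
    sharpMap (E := E') (mfderiv 𝓘(ℝ, E) 𝓘(ℝ, E') ρ m) (π m)
  have hF : F.FactorsThrough ρ := fun m m' hm => h m m' hm
  -- The default value 0 never occurs, ρ being surjective.
  let f : P' → ((E' →L[ℝ] ℝ) →ₗ[ℝ] E') := Function.extend ρ F 0
  have hf : ∀ m, f (ρ m) = F m := fun m => hF.extend_apply 0 m
  have h1 : IsReducedBivector ρ π (fun p => f p : SharpField 𝓘(ℝ, E') P') := fun m α =>
    DFunLike.congr_fun (hf m) α
  refine ⟨fun p => f p, fun π'' => ⟨fun h2 => ?_, ?_⟩⟩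
  · funext p
    obtain ⟨m, rfl⟩ := hsurj p
    ext α
    exact (h2 m α).trans (h1 m α).symm
  · rintro rfl
    exact h1

/-- At ρ(m) the form is w(m) evaluated on lifts by a right inverse of Tρ. Horizontality makes the
choice of lifts immaterial; the maps `L`, in practice tangent maps of group elements, do the same
for the choice of m in its fibre. -/
theorem exists_reducedForm (hsurj : Function.Surjective ρ)
    (hT : ∀ m, Function.Surjective (mfderiv 𝓘(ℝ, E) 𝓘(ℝ, E') ρ m))
    (hw : ∀ m (v : Fin (k + 1) → TangentSpace 𝓘(ℝ, E) m),
      mfderiv 𝓘(ℝ, E) 𝓘(ℝ, E') ρ m (v 0) = 0 → w m v = 0)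
    (h : ∀ m m', ρ m = ρ m' → ∃ L : E → E,
      (∀ v : E, (mfderiv 𝓘(ℝ, E) 𝓘(ℝ, E') ρ m (L v) : E') = mfderiv 𝓘(ℝ, E) 𝓘(ℝ, E') ρ m' v) ∧
      ∀ v : Fin (k + 1) → E, w m (fun i => L (v i)) = w m' v) :
    ∃ φ : Form 𝓘(ℝ, E') P' ℝ (k + 1), ∀ φ', Form.pullback 𝓘(ℝ, E) ρ φ' = w ↔ φ' = φ := by
  have hR : ∀ m, ∃ R : E' →L[ℝ] E, ∀ v : E',
      (mfderiv 𝓘(ℝ, E) 𝓘(ℝ, E') ρ m (R v) : E') = v := by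
    intro m
    let T : E →ₗ[ℝ] E' := (mfderiv 𝓘(ℝ, E) 𝓘(ℝ, E') ρ m).toLinearMap
    obtain ⟨R, hR⟩ := T.exists_rightInverse_of_surjective (LinearMap.range_eq_top.2 (hT m))
    exact ⟨LinearMap.toContinuousLinearMap R, fun v => LinearMap.congr_fun hR v⟩
  choose R hR using hR
  have hww : ∀ m (u v : Fin (k + 1) → E), (∀ i, (mfderiv 𝓘(ℝ, E) 𝓘(ℝ, E') ρ m (u i) : E') =
      mfderiv 𝓘(ℝ, E) 𝓘(ℝ, E') ρ m (v i)) → w m u = w m v := fun m u v huv =>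
    alternating_eq_of_horizontal (w m) (mfderiv 𝓘(ℝ, E) 𝓘(ℝ, E') ρ m).toLinearMap (hw m) huv
  let F : P → E' [⋀^Fin (k + 1)]→L[ℝ] ℝ := fun m =>
    ContinuousAlternatingMap.compContinuousLinearMap (M := E) (w m) (R m)
  have hF : F.FactorsThrough ρ := by
    intro m m' hm
    obtain ⟨L, hL, hLw⟩ := h m m' hm
    ext v
    refine Eq.trans ?_ (hLw fun i => R m' (v i))
    exact hww m _ _ fun i => (hR m _).trans ((hL _).trans (hR m' _)).symm
  let f : P' → E' [⋀^Fin (k + 1)]→L[ℝ] ℝ := Function.extend ρ F 0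
  have hf : ∀ m, f (ρ m) = F m := fun m => hF.extend_apply 0 m
  let φ : Form 𝓘(ℝ, E') P' ℝ (k + 1) := fun p => f p
  have h1 : Form.pullback 𝓘(ℝ, E) ρ φ = w := by
    funext m
    ext v
    refine (DFunLike.congr_fun (hf m)
      (fun i => mfderiv 𝓘(ℝ, E) 𝓘(ℝ, E') ρ m (v i))).trans ?_
    exact hww m _ _ fun i => hR m _
  refine ⟨φ, fun φ' => ⟨fun h2 => ?_, ?_⟩⟩
  · funext p
    obtain ⟨m, rfl⟩ := hsurj p
    ext v
    choose u hu using fun i => hT m (v i)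
    have h3 := DFunLike.congr_fun (congrFun (h2.trans h1.symm) m) u
    obtain rfl : (fun i => mfderiv 𝓘(ℝ, E) 𝓘(ℝ, E') ρ m (u i)) = v := funext hu
    exact h3
  · rintro rfl
    exact h1

/-- A local section exhibits φ as the pullback of w by a smooth map, from which φ inherits
smoothness and closedness. -/
theorem inChart_eventuallyEq_of_pullback (hρ : Manifold.IsSubmersion 𝓘(ℝ, E) 𝓘(ℝ, E') ∞ ρ)
    (hsurj : Function.Surjective ρ) (hφ : Form.pullback 𝓘(ℝ, E) ρ φ = w) {p₀ : P'} {x : E'}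
    (hx : x ∈ (extChartAt 𝓘(ℝ, E') p₀).target) : ∃ f : E' → P,
    ContMDiffAt 𝓘(ℝ, E') 𝓘(ℝ, E) ∞ f x ∧ φ.inChart p₀ =ᶠ[𝓝 x] w.along f := by
  obtain ⟨x₀, hx₀⟩ := hsurj ((extChartAt 𝓘(ℝ, E') p₀).symm x)
  obtain ⟨s, hsx, hs⟩ := exists_chart_section hρ hx hx₀
  refine ⟨(extChartAt 𝓘(ℝ, E) x₀).symm ∘ s,
    (contMDiffAt_extChartAt_symm hs.self_of_nhds.2.1).comp x
      hs.self_of_nhds.1.contMDiffAt, ?_⟩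
  filter_upwards [hs.eventually_nhds] with x' hx'
  obtain ⟨h1, h2, h3, h4⟩ := hx'.self_of_nhds
  have h5 : (extChartAt 𝓘(ℝ, E') p₀).symm =ᶠ[𝓝 x'] ρ ∘ (extChartAt 𝓘(ℝ, E) x₀).symm ∘ s :=
    hx'.mono fun z hz => hz.2.2.1.symm
  rw [← hφ]
  refine (Form.along_congr φ h5).trans (Form.along_comp φ
    ((hρ.contMDiff _).mdifferentiableAt (by simp)) ?_)
  exact ((contMDiffAt_extChartAt_symm h2).comp x' h1.contMDiffAt).mdifferentiableAt (by simp)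

theorem Form.Smooth.of_pullback (hw : w.Smooth)
    (hρ : Manifold.IsSubmersion 𝓘(ℝ, E) 𝓘(ℝ, E') ∞ ρ)
    (hsurj : Function.Surjective ρ) (hφ : Form.pullback 𝓘(ℝ, E) ρ φ = w) : φ.Smooth := by
  intro p₀ x hx
  obtain ⟨f, hf, hfφ⟩ := inChart_eventuallyEq_of_pullback hρ hsurj hφ hx
  exact ((hw.along hf).congr_of_eventuallyEq hfφ).contDiffWithinAt

theorem Form.Closed.of_pullback (hw : w.Smooth) (hwc : w.Closed)
    (hρ : Manifold.IsSubmersion 𝓘(ℝ, E) 𝓘(ℝ, E') ∞ ρ)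
    (hsurj : Function.Surjective ρ) (hφ : Form.pullback 𝓘(ℝ, E) ρ φ = w) : φ.Closed := by
  intro p
  obtain ⟨f, hf, hfφ⟩ := inChart_eventuallyEq_of_pullback hρ hsurj hφ
    (mem_extChartAt_target (I := 𝓘(ℝ, E')) p)
  have h : extDeriv (φ.inChart p) (extChartAt 𝓘(ℝ, E') p p) = 0 := by
    rw [hfφ.extDeriv_eq, hw.extDeriv_along hf]
    unfold Form.along
    rw [hwc]
    rfl
  rw [Form.d, h]
  rfl

theorem Form.Closed.add {w w' : Form 𝓘(ℝ, E) P ℝ k} (hw : w.Smooth) (hw' : w'.Smooth)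
    (hc : w.Closed) (hc' : w'.Closed) :
    Form.Closed (I := 𝓘(ℝ, E)) (fun m => w m + w' m) := by
  intro x
  have hx := mem_extChartAt_target (I := 𝓘(ℝ, E)) x
  have h0 : ∀ {w : Form 𝓘(ℝ, E) P ℝ k}, w.Smooth → w.Closed →
      extDeriv (w.inChart x) (extChartAt 𝓘(ℝ, E) x x) = 0 := by
    intro w hw hc
    refine (hw.extDeriv_along (contMDiffAt_extChartAt_symm hx)).trans ?_
    unfold Form.along
    rw [hc]
    rfl
  have h1 : Form.inChart (I := 𝓘(ℝ, E)) (fun m => w m + w' m) x = w.inChart x + w'.inChart x := rfl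
  have h : extDeriv (Form.inChart (I := 𝓘(ℝ, E)) (fun m => w m + w' m) x)
      (extChartAt 𝓘(ℝ, E) x x) = 0 := by
    rw [h1, extDeriv_add ((hw.contDiffAt hx).differentiableAt (by simp))
      ((hw'.contDiffAt hx).differentiableAt (by simp)), h0 hw hc, h0 hw' hc', add_zero]
  rw [Form.d, h]
  rfl

theorem Form.Closed.neg {w : Form 𝓘(ℝ, E) P ℝ k} (hw : w.Smooth)
    (hc : w.Closed) : Form.Closed (I := 𝓘(ℝ, E)) (fun m => -w m) := by
  intro x
  have hx := mem_extChartAt_target (I := 𝓘(ℝ, E)) x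
  have h1 : Form.inChart (I := 𝓘(ℝ, E)) (fun m => -w m) x = (-1 : ℝ) • w.inChart x := by
    rw [neg_one_smul]
    rfl
  have h : extDeriv (Form.inChart (I := 𝓘(ℝ, E)) (fun m => -w m) x)
      (extChartAt 𝓘(ℝ, E) x x) = 0 := by
    rw [h1, extDeriv_smul]
    refine smul_eq_zero_of_right _ ((hw.extDeriv_along (contMDiffAt_extChartAt_symm hx)).trans ?_)
    unfold Form.along
    rw [hc]
    rfl
  rw [Form.d, h]
  rfl

end Reduction

/-! ### From chart identities to twisted Poisson structures and integral manifolds -/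

section TwistedPoisson

variable {E : Type*} [NormedAddCommGroup E] [NormedSpace ℝ E] [FiniteDimensional ℝ E]
  {P : Type*} [TopologicalSpace P] [ChartedSpace E P] [IsManifold 𝓘(ℝ, E) ∞ P]
  {π : SharpField 𝓘(ℝ, E) P} {φ : Form 𝓘(ℝ, E) P ℝ 3}

namespace SharpField

theorem Smooth.jacobiator_symm (hπ : π.Smooth) {x₀ : P} {y : E}
    (hy : y ∈ (extChartAt 𝓘(ℝ, E) x₀).target) {f g h : P → ℝ}
    (hf : ContMDiff 𝓘(ℝ, E) 𝓘(ℝ, ℝ) ∞ f) (hg : ContMDiff 𝓘(ℝ, E) 𝓘(ℝ, ℝ) ∞ g)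
    (hh : ContMDiff 𝓘(ℝ, E) 𝓘(ℝ, ℝ) ∞ h) :
    π.jacobiator f g h ((extChartAt 𝓘(ℝ, E) x₀).symm y) =
      cyclicBracket (π.inChart x₀)
        (fun i => (![f, g, h] : Fin 3 → P → ℝ) i ∘ (extChartAt 𝓘(ℝ, E) x₀).symm) y := by
  have hd : ∀ {f : P → ℝ}, ContMDiff 𝓘(ℝ, E) 𝓘(ℝ, ℝ) ∞ f → ∀ x,
      MDifferentiableAt 𝓘(ℝ, E) 𝓘(ℝ, ℝ) f x := fun hf x => (hf x).mdifferentiableAt (by simp)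
  have hterm : ∀ {f g h : P → ℝ}, ContMDiff 𝓘(ℝ, E) 𝓘(ℝ, ℝ) ∞ f →
      ContMDiff 𝓘(ℝ, E) 𝓘(ℝ, ℝ) ∞ g → ContMDiff 𝓘(ℝ, E) 𝓘(ℝ, ℝ) ∞ h →
      π.bracket f (π.bracket g h) ((extChartAt 𝓘(ℝ, E) x₀).symm y) =
        fderiv ℝ (fun z => fderiv ℝ (h ∘ (extChartAt 𝓘(ℝ, E) x₀).symm) z
          (π.inChart x₀ z (fderiv ℝ (g ∘ (extChartAt 𝓘(ℝ, E) x₀).symm) z))) y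
          (π.inChart x₀ y (fderiv ℝ (f ∘ (extChartAt 𝓘(ℝ, E) x₀).symm) y)) := by
    intro f g h hf hg hh
    rw [bracket_symm hy (hd hf _)
      ((hπ.contMDiffAt_bracket (hg _) (hh _)).mdifferentiableAt (by simp))]
    have e : π.bracket g h ∘ (extChartAt 𝓘(ℝ, E) x₀).symm =ᶠ[𝓝 y]
        fun z => fderiv ℝ (h ∘ (extChartAt 𝓘(ℝ, E) x₀).symm) z
          (π.inChart x₀ z (fderiv ℝ (g ∘ (extChartAt 𝓘(ℝ, E) x₀).symm) z)) := by
      filter_upwards [(isOpen_extChartAt_target (I := 𝓘(ℝ, E)) x₀).mem_nhds hy] with z hz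
      exact bracket_symm hz (hd hg _) (hd hh _)
    rw [e.fderiv_eq]
  unfold jacobiator
  rw [hterm hf hg hh, hterm hg hh hf, hterm hh hf hg]
  rfl

/-- A smooth skew field is twisted Poisson if its brackets of functions of a chart are. -/
theorem isTwistedPoisson_of_chart (hskew : ∀ (x : P) (α β : TangentSpace 𝓘(ℝ, E) x →L[ℝ] ℝ),
      β (π x α) = -α (π x β)) (hπ : π.Smooth) (hφ : φ.Smooth) (hφc : φ.Closed)
    (hj : ∀ x₀ : P, ∀ x ∈ (extChartAt 𝓘(ℝ, E) x₀).target, ∀ F : Fin 3 → E → ℝ,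
      (∀ i, ContDiffAt ℝ ∞ (F i) x) →
      cyclicBracket (π.inChart x₀) F x = -φ.inChart x₀ x ![π.inChart x₀ x (fderiv ℝ (F 0) x),
        π.inChart x₀ x (fderiv ℝ (F 1) x), π.inChart x₀ x (fderiv ℝ (F 2) x)]) :
    π.IsTwistedPoisson φ := by
  refine ⟨⟨hskew, fun f g hf hg x => hπ.contMDiffAt_bracket (hf x) (hg x)⟩, hφ, hφc, ?_⟩
  intro f g h hf hg hh x
  have hy := mem_extChartAt_target (I := 𝓘(ℝ, E)) x
  have hfgh : ∀ i, ContMDiff 𝓘(ℝ, E) 𝓘(ℝ, ℝ) ∞ ((![f, g, h] : Fin 3 → P → ℝ) i) := by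
    intro i
    fin_cases i
    exacts [hf, hg, hh]
  have h1 := hπ.jacobiator_symm hy hf hg hh
  rw [hj x _ hy _ fun i => ((hfgh i _).comp _ (contMDiffAt_extChartAt_symm hy)).contDiffAt] at h1
  have h2 : ∀ f : P → ℝ, ContMDiff 𝓘(ℝ, E) 𝓘(ℝ, ℝ) ∞ f →
      (mfderiv 𝓘(ℝ, E) 𝓘(ℝ, E) (extChartAt 𝓘(ℝ, E) x).symm (extChartAt 𝓘(ℝ, E) x x)
        (π.inChart x (extChartAt 𝓘(ℝ, E) x x)
          (fderiv ℝ (f ∘ (extChartAt 𝓘(ℝ, E) x).symm) (extChartAt 𝓘(ℝ, E) x x))) : E) =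
      π ((extChartAt 𝓘(ℝ, E) x).symm (extChartAt 𝓘(ℝ, E) x x))
        (diff 𝓘(ℝ, E) f ((extChartAt 𝓘(ℝ, E) x).symm (extChartAt 𝓘(ℝ, E) x x))) := by
    intro f hf
    rw [← mfderiv_symm_inChart hy]
    congr 2
    ext v
    exact (diff_comp_mfderiv_symm hy ((hf _).mdifferentiableAt (by simp)) v).symm
  have h3 : φ.inChart x (extChartAt 𝓘(ℝ, E) x x)
      ![π.inChart x (extChartAt 𝓘(ℝ, E) x x)
          (fderiv ℝ (f ∘ (extChartAt 𝓘(ℝ, E) x).symm) (extChartAt 𝓘(ℝ, E) x x)),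
        π.inChart x (extChartAt 𝓘(ℝ, E) x x)
          (fderiv ℝ (g ∘ (extChartAt 𝓘(ℝ, E) x).symm) (extChartAt 𝓘(ℝ, E) x x)),
        π.inChart x (extChartAt 𝓘(ℝ, E) x x)
          (fderiv ℝ (h ∘ (extChartAt 𝓘(ℝ, E) x).symm) (extChartAt 𝓘(ℝ, E) x x))] =
      φ ((extChartAt 𝓘(ℝ, E) x).symm (extChartAt 𝓘(ℝ, E) x x))
        ![π _ (diff 𝓘(ℝ, E) f _), π _ (diff 𝓘(ℝ, E) g _), π _ (diff 𝓘(ℝ, E) h _)] := by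
    refine congrArg (φ ((extChartAt 𝓘(ℝ, E) x).symm (extChartAt 𝓘(ℝ, E) x x)))
      (funext fun i => ?_)
    fin_cases i
    exacts [h2 f hf, h2 g hg, h2 h hh]
  have h4 := h1.trans (congrArg Neg.neg h3)
  rwa [extChartAt_to_inv] at h4

/-- The characteristic distribution of a twisted Poisson structure is integrable. -/
theorem isIntegrable_charDistribution
    (hskew : ∀ (x : P) (α β : TangentSpace 𝓘(ℝ, E) x →L[ℝ] ℝ), β (π x α) = -α (π x β))
    (hπ : π.Smooth) (hφ : φ.Smooth)
    (hj : ∀ x₀ : P, ∀ x ∈ (extChartAt 𝓘(ℝ, E) x₀).target, ∀ F : Fin 3 → E → ℝ,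
      (∀ i, ContDiffAt ℝ ∞ (F i) x) →
      cyclicBracket (π.inChart x₀) F x = -φ.inChart x₀ x ![π.inChart x₀ x (fderiv ℝ (F 0) x),
        π.inChart x₀ x (fderiv ℝ (F 1) x), π.inChart x₀ x (fderiv ℝ (F 2) x)]) :
    IsIntegrable 𝓘(ℝ, E) π.charDistribution := by
  intro x₀
  obtain ⟨k, ε, j, hε, hj0, hjs, hji, hjt⟩ := exists_integral_ball_of_cyclicBracket
    (isOpen_extChartAt_target (I := 𝓘(ℝ, E)) x₀) (hπ x₀) (fun x a b => inChart_skew hskew a b)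
    (hφ x₀) (hj x₀) (mem_extChartAt_target (I := 𝓘(ℝ, E)) x₀)
  have hsymm : ∀ t ∈ Metric.ball (0 : EuclideanSpace ℝ (Fin k)) ε, ∀ v,
      (mfderiv 𝓘(ℝ, EuclideanSpace ℝ (Fin k)) 𝓘(ℝ, E) ((extChartAt 𝓘(ℝ, E) x₀).symm ∘ j) t v : E) =
      mfderiv 𝓘(ℝ, E) 𝓘(ℝ, E) (extChartAt 𝓘(ℝ, E) x₀).symm (j t) (fderiv ℝ j t v) := by
    intro t ht v
    have h1 := ((hjs.contDiffAt (Metric.isOpen_ball.mem_nhds ht)).differentiableAt (by simp))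
    refine (mfderiv_comp_clm ((contMDiffAt_extChartAt_symm (hjt t ht).1).mdifferentiableAt
      (by simp)) h1.mdifferentiableAt v).trans ?_
    rw [mfderiv_eq_fderiv]
    rfl
  refine ⟨k, ε, (extChartAt 𝓘(ℝ, E) x₀).symm ∘ j, hε, ?_, fun t ht => ?_, ?_, fun t ht => ?_⟩
  · exact (congrArg _ hj0).trans (extChartAt_to_inv x₀)
  · exact ((contMDiffAt_extChartAt_symm (hjt t ht).1).comp t
      (hjs.contDiffAt (Metric.isOpen_ball.mem_nhds ht)).contMDiffAt).contMDiffWithinAt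
  · exact fun s hs t ht hst => hji hs ht
      ((extChartAt 𝓘(ℝ, E) x₀).symm.injOn (hjt s hs).1 (hjt t ht).1 hst)
  · obtain ⟨h1, h2, h3⟩ := hjt t ht
    constructor
    · intro u v huv
      have h4 := ((hsymm t ht u).symm.trans huv).trans (hsymm t ht v)
      have h5 := congrArg (fun w : E => (mfderiv 𝓘(ℝ, E) 𝓘(ℝ, E) (extChartAt 𝓘(ℝ, E) x₀)
        ((extChartAt 𝓘(ℝ, E) x₀).symm (j t)) w : E)) h4
      exact h2 (((mfderiv_extChartAt_symm_apply h1 _).symm.trans h5).trans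
        (mfderiv_extChartAt_symm_apply h1 _))
    · refine Submodule.ext fun w => ⟨?_, ?_⟩
      · rintro ⟨v, rfl⟩
        have h4 : fderiv ℝ j t v ∈ LinearMap.range (π.inChart x₀ (j t)).toLinearMap := by
          rw [← h3]
          exact ⟨v, rfl⟩
        obtain ⟨a, ha⟩ := h4
        refine ⟨a ∘L mfderiv 𝓘(ℝ, E) 𝓘(ℝ, E) (extChartAt 𝓘(ℝ, E) x₀)
          ((extChartAt 𝓘(ℝ, E) x₀).symm (j t)), ?_⟩
        refine Eq.trans ?_ (hsymm t ht v).symm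
        rw [← ha]
        exact (mfderiv_symm_extChartAt_apply h1 _).symm
      · rintro ⟨α, rfl⟩
        have h4 : π.inChart x₀ (j t) (α ∘L mfderiv 𝓘(ℝ, E) 𝓘(ℝ, E)
            (extChartAt 𝓘(ℝ, E) x₀).symm (j t)) ∈ LinearMap.range (fderiv ℝ j t).toLinearMap := by
          rw [h3]
          exact ⟨_, rfl⟩
        obtain ⟨v, hv⟩ := h4
        refine ⟨v, (hsymm t ht v).trans ?_⟩
        refine Eq.trans ?_ (mfderiv_symm_inChart h1 α)
        exact congrArg (mfderiv 𝓘(ℝ, E) 𝓘(ℝ, E) (extChartAt 𝓘(ℝ, E) x₀).symm (j t)) hv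

end SharpField

end TwistedPoisson

/-! ### The reduced bivector field and the reduced 3-form -/

namespace NonholonomicSystem

variable {E : Type*} [NormedAddCommGroup E] [NormedSpace ℝ E] [FiniteDimensional ℝ E]
  {Q : Type*} [TopologicalSpace Q] [ChartedSpace E Q] [IsManifold 𝓘(ℝ, E) ∞ Q]
  {N : NonholonomicSystem E Q}
  {EM : Type*} [NormedAddCommGroup EM] [NormedSpace ℝ EM] [FiniteDimensional ℝ EM]
  [ChartedSpace EM N.constraintManifold] [IsManifold 𝓘(ℝ, EM) ∞ N.constraintManifold]
  {EG : Type*} [NormedAddCommGroup EG] [NormedSpace ℝ EG] [FiniteDimensional ℝ EG]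
  {G : Type*} [TopologicalSpace G] [ChartedSpace EG G] [Group G] [LieGroup 𝓘(ℝ, EG) ∞ G]
  [MulAction G Q] [ContMDiffSMul 𝓘(ℝ, EG) 𝓘(ℝ, E) ∞ G Q] [hG : N.IsSymmetry G]
  {ER : Type*} [NormedAddCommGroup ER] [NormedSpace ℝ ER] [FiniteDimensional ℝ ER]
  [ChartedSpace ER (N.OrbitSpace G)] [IsManifold 𝓘(ℝ, ER) ∞ (N.OrbitSpace G)]
  {B : Form 𝓘(ℝ, EM) N.constraintManifold ℝ 2}

theorem smooth_piB (W : N.VerticalComplement EM EG G) (hM : N.IsEmbedded EM) (hB : B.Smooth)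
    (hgauge : ∀ m, Function.Bijective (gaugeEnd (N.piNH EM m) (B m))) :
    (N.piB EM B).Smooth := by
  intro x₀ y hy
  obtain ⟨S, hS, hSB⟩ := exists_piB W hM hB hgauge hy
  refine (hS.congr_of_eventuallyEq ?_).contDiffWithinAt
  filter_upwards [hSB, eventually_target hy] with z h1 h2
  exact SharpField.inChart_eq h2 h1

theorem surjective_rho : Function.Surjective (N.rho G) := Quotient.mk_surjective

/-- Points of one fibre differ by a group element, and equivariance of π_B together with ρ(g · m) =
ρ(m) makes Tρ ∘ π_B ∘ Tρ^* agree at both. -/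
theorem exists_reduced_piB (hM : N.IsEmbedded EM)
    (hrho : ContMDiff 𝓘(ℝ, EM) 𝓘(ℝ, ER) ∞ (N.rho G)) (hBinv : B.Invariant G)
    (hgauge : ∀ m, Function.Bijective (gaugeEnd (N.piNH EM m) (B m))) :
    ∃ π' : SharpField 𝓘(ℝ, ER) (N.OrbitSpace G),
      ∀ π'', IsReducedBivector (N.rho G) (N.piB EM B) π'' ↔ π'' = π' := by
  refine exists_reducedBivector surjective_rho fun m m' h => ?_
  obtain ⟨g, rfl⟩ := exists_smul_of_rho_eq h
  ext α
  have h1 := piB_smul hM hBinv hgauge g m' (α ∘L mfderiv 𝓘(ℝ, EM) 𝓘(ℝ, ER) (N.rho G) (g • m'))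
  refine (congrArg (fun v : EM => (mfderiv 𝓘(ℝ, EM) 𝓘(ℝ, ER) (N.rho G) (g • m') v : ER))
    h1).trans ?_
  refine (mfderiv_rho_smul hM hrho g m' _).trans ?_
  refine congrArg (fun a : EM →L[ℝ] ℝ => (mfderiv 𝓘(ℝ, EM) 𝓘(ℝ, ER) (N.rho G) m'
    (N.piB EM B m' a) : ER)) ?_
  ext v
  exact congrArg α (mfderiv_rho_smul hM hrho g m' v)

theorem exists_reduced_basic {k : ℕ} {w : Form 𝓘(ℝ, EM) N.constraintManifold ℝ (k + 1)}
    (hM : N.IsEmbedded EM) (hrho : Manifold.IsSubmersion 𝓘(ℝ, EM) 𝓘(ℝ, ER) ∞ (N.rho G))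
    (hw : Form.Basic 𝓘(ℝ, ER) G (N.rho G) w) :
    ∃ φ : Form 𝓘(ℝ, ER) (N.OrbitSpace G) ℝ (k + 1),
      ∀ φ', Form.pullback 𝓘(ℝ, EM) (N.rho G) φ' = (fun m => -w m) ↔ φ' = φ := by
  refine exists_reducedForm surjective_rho (mfderiv_surjective_of_isSubmersion hrho)
    (fun m v hv => neg_eq_zero.2 (hw.2 m v hv)) fun m m' h => ?_
  obtain ⟨g, rfl⟩ := exists_smul_of_rho_eq h
  refine ⟨fun v => mfderiv 𝓘(ℝ, EM) 𝓘(ℝ, EM) (fun m : N.constraintManifold => g • m) m' v,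
    fun v => mfderiv_rho_smul hM hrho.contMDiff g m' v, fun v => ?_⟩
  exact congrArg Neg.neg (DFunLike.congr_fun (congrFun (hw.1 g) m') v)

/-- Generators lie in ker Tρ, so differentials that kill this kernel satisfy the verticality
hypothesis of `jacobi_piB`. -/
theorem cyclicBracket_piB (W : N.VerticalComplement EM EG G) (hM : N.IsEmbedded EM)
    (hfree : ∀ (g : G) (q : Q), g • q = q → g = 1)
    (hrho : ContMDiff 𝓘(ℝ, EM) 𝓘(ℝ, ER) ∞ (N.rho G)) (hB : B.Smooth)
    (hBW : ∀ m, ∀ Z ∈ W.dist m, flat (B m) Z = 0)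
    (hgauge : ∀ m, Function.Bijective (gaugeEnd (N.piNH EM m) (B m)))
    {x₀ : N.constraintManifold} {y : EM} (hy : y ∈ (extChartAt 𝓘(ℝ, EM) x₀).target)
    {f : Fin 3 → EM → ℝ} (hf : ∀ i, ContDiffAt ℝ ∞ (f i) y)
    (hfρ : ∀ i u, mfderiv 𝓘(ℝ, EM) 𝓘(ℝ, ER) (N.rho G) ((extChartAt 𝓘(ℝ, EM) x₀).symm y)
        (mfderiv 𝓘(ℝ, EM) 𝓘(ℝ, EM) (extChartAt 𝓘(ℝ, EM) x₀).symm y u) = 0 →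
          fderiv ℝ (f i) y u = 0) :
    cyclicBracket ((N.piB EM B).inChart x₀) f y =
      Form.inChart (I := 𝓘(ℝ, EM)) (fun m => B.d m + W.dJK m) x₀ y
        ![(N.piB EM B).inChart x₀ y (fderiv ℝ (f 0) y),
          (N.piB EM B).inChart x₀ y (fderiv ℝ (f 1) y),
          (N.piB EM B).inChart x₀ y (fderiv ℝ (f 2) y)] := by
  have hS := (smooth_piB W hM hB hgauge).contDiffAt hy
  refine (jacobi_piB W hM hfree hB hBW hgauge hy hS ?_ hf fun i u ξ hu => hfρ i u ?_).trans
    (inChart_three_apply (x₀ := x₀) (fun m => B.d m + W.dJK m) y _ _ _).symm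
  · filter_upwards [eventually_target hy] with z hz α
    exact SharpField.mfderiv_symm_inChart hz α
  · exact (congrArg (fun v : EM => (mfderiv 𝓘(ℝ, EM) 𝓘(ℝ, ER) (N.rho G)
      ((extChartAt 𝓘(ℝ, EM) x₀).symm y) v : ER)) hu).trans (mfderiv_rho_generator hM hrho _ ξ)

end NonholonomicSystem

end Nonholonomic

end

theorem mainTheorem4
    -- the configuration manifold `Q`
    {E : Type*} [NormedAddCommGroup E] [NormedSpace ℝ E] [FiniteDimensional ℝ E]
    {Q : Type*} [TopologicalSpace Q] [T2Space Q] [SecondCountableTopology Q]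
    [ChartedSpace E Q] [IsManifold 𝓘(ℝ, E) ∞ Q]
    -- the Lie group `G`, acting smoothly, freely and properly on `Q`
    {EG : Type*} [NormedAddCommGroup EG] [NormedSpace ℝ EG] [FiniteDimensional ℝ EG]
    {G : Type*} [TopologicalSpace G] [ChartedSpace EG G] [Group G] [LieGroup 𝓘(ℝ, EG) ∞ G]
    [MulAction G Q] [ContMDiffSMul 𝓘(ℝ, EG) 𝓘(ℝ, E) ∞ G Q] [ProperSMul G Q]
    (hfree : ∀ (g : G) (q : Q), g • q = q → g = 1)
    -- the nonholonomic system, with symmetry group `G`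
    (N : NonholonomicSystem E Q) [N.IsSymmetry G]
    -- `M = Leg(D)` with its structure of embedded submanifold of `T*Q`
    {EM : Type*} [NormedAddCommGroup EM] [NormedSpace ℝ EM] [FiniteDimensional ℝ EM]
    [ChartedSpace EM N.constraintManifold] [IsManifold 𝓘(ℝ, EM) ∞ N.constraintManifold]
    (hM : Manifold.IsSmoothEmbedding 𝓘(ℝ, EM) (𝓘(ℝ, E).prod 𝓘(ℝ, E →L[ℝ] ℝ)) ∞
      (Subtype.val : N.constraintManifold → CotangentBundle E Q))
    -- `M/G` with its quotient manifold structure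
    {ER : Type*} [NormedAddCommGroup ER] [NormedSpace ℝ ER] [FiniteDimensional ℝ ER]
    [ChartedSpace ER (N.OrbitSpace G)] [IsManifold 𝓘(ℝ, ER) ∞ (N.OrbitSpace G)]
    (hrho : Manifold.IsSubmersion 𝓘(ℝ, EM) 𝓘(ℝ, ER) ∞ (N.rho G))
    -- the dimension assumption, and a `G`-invariant vertical complement `W` of `C`
    (hdim : ∀ m, N.distC EM m ⊔ N.distV EM EG G m = ⊤)
    (W : N.VerticalComplement EM EG G)
    (hclosed : W.dJK.Closed)
    -- the `G`-invariant 2-form `B`, with `i_Z B = 0` for `Z ∈ W`, defining a gauge transformation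
    (B : Form 𝓘(ℝ, EM) N.constraintManifold ℝ 2) (hB : B.Smooth) (hBinv : B.Invariant G)
    (hBW : ∀ m, ∀ Z ∈ W.dist m, flat (B m) Z = 0)
    (hgauge : ∀ m, Function.Bijective (gaugeEnd (N.piNH EM m) (B m)))
    (hbasic : Form.Basic 𝓘(ℝ, ER) G (N.rho G) (fun m => B.d m + W.dJK m)) :
    -- there is exactly one reduced bivector field, there is exactly one 3-form `φ` on `M/G` with
    -- `ρ^* φ = -(dB + dJ ∧ K_W)`, and the reduced bivector field is `φ`-twisted Poisson, with
    -- integrable characteristic distribution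
    ∃ (piRed : SharpField 𝓘(ℝ, ER) (N.OrbitSpace G)) (φ : Form 𝓘(ℝ, ER) (N.OrbitSpace G) ℝ 3),
      (∀ pi', IsReducedBivector (N.rho G) (N.piB EM B) pi' ↔ pi' = piRed) ∧
      (∀ φ', Form.pullback 𝓘(ℝ, EM) (N.rho G) φ' = (fun m => -(B.d m + W.dJK m)) ↔ φ' = φ) ∧
      piRed.IsTwistedPoisson φ ∧
      IsIntegrable 𝓘(ℝ, ER) piRed.charDistribution := by

  obtain ⟨π', hπ'⟩ := NonholonomicSystem.exists_reduced_piB hM hrho.contMDiff hBinv hgauge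
  obtain ⟨φ, hφ⟩ := NonholonomicSystem.exists_reduced_basic hM hrho hbasic
  have hred := (hπ' π').2 rfl
  have hpull := (hφ φ).2 rfl
  have hsurj : Function.Surjective (N.rho G) := NonholonomicSystem.surjective_rho
  have hsmooth : π'.Smooth :=
    (NonholonomicSystem.smooth_piB W hM hB hgauge).reduced hrho hsurj hred
  have hskew : ∀ (x : N.OrbitSpace G) (α β : TangentSpace 𝓘(ℝ, ER) x →L[ℝ] ℝ),
      β (π' x α) = -α (π' x β) := by
    intro x α β
    obtain ⟨m, rfl⟩ := hsurj x
    rw [hred, hred]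
    exact NonholonomicSystem.piB_skew hM hgauge m
      (α ∘L mfderiv 𝓘(ℝ, EM) 𝓘(ℝ, ER) (N.rho G) m) (β ∘L mfderiv 𝓘(ℝ, EM) 𝓘(ℝ, ER) (N.rho G) m)
  have hdJK := NonholonomicSystem.smooth_dJK W hM hfree
  have hws : Form.Smooth (I := 𝓘(ℝ, EM)) (fun m => -(B.d m + W.dJK m)) := fun x₀ =>
    ((hB.d x₀).add (hdJK x₀)).neg
  -- The term dB is closed because d² = 0, the term dJ ∧ K_W by hypothesis.
  have hwc : Form.Closed (I := 𝓘(ℝ, EM)) (fun m => -(B.d m + W.dJK m)) :=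
    Form.Closed.neg (fun x₀ => (hB.d x₀).add (hdJK x₀)) (Form.Closed.add hB.d hdJK hB.d_d hclosed)
  have hφs : φ.Smooth := hws.of_pullback hrho hsurj hpull
  -- Proved for all functions smooth near a point of a chart, not just for global functions on the
  -- orbit space: the integrability argument applies it to linear functions of the chart.
  have hj : ∀ p₀ : N.OrbitSpace G, ∀ x ∈ (extChartAt 𝓘(ℝ, ER) p₀).target,
      ∀ F : Fin 3 → ER → ℝ, (∀ i, ContDiffAt ℝ ∞ (F i) x) →
      cyclicBracket (π'.inChart p₀) F x = -φ.inChart p₀ x ![π'.inChart p₀ x (fderiv ℝ (F 0) x),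
        π'.inChart p₀ x (fderiv ℝ (F 1) x), π'.inChart p₀ x (fderiv ℝ (F 2) x)] :=
    fun p₀ x hx F hF => cyclicBracket_eq_of_submersion hrho hsurj hsmooth hred hpull
      (fun x₀ y hy f hf hfρ => NonholonomicSystem.cyclicBracket_piB W hM hfree hrho.contMDiff hB
        hBW hgauge hy hf hfρ) hx hF
  exact ⟨π', φ, hπ', hφ, SharpField.isTwistedPoisson_of_chart hskew hsmooth hφs
    (Form.Closed.of_pullback hws hwc hrho hsurj hpull) hj,
    SharpField.isIntegrable_charDistribution hskew hsmooth hφs hj⟩
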